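/- **Theorem (Semi-parametric efficiency).** *Population.* Each market participant has covariates $X\in\mathcal X$, a binary treatment $W\in\{0,1\}$ and potential submissions $B(1),B(0)\in\mathcal B$; the researcher observes $(B,W,X)$ with $B=B(W)$. A population is a law of $(X,B(1),B(0),W)$ satisfying unconfoundedness and overlap: given $X=x$, $(B(1),B(0))$ has some conditional law (a Markov kernel in $x$) and, independently of it, $W\sim\mathrm{Bernoulli}(e(x))$ with $0<e(x)<1$ for all $x$. *Mechanism.* There are $J$ items, bounded allocation and outcome functions $d(b,p)\in\mathbb R^J$ and $y(b,p)\in\mathbb R$ for $b\in\mathcal B$ and cutoffs $p\in\mathcal S\subset\mathbb R^J$, measurable in $b$, and capacities $s^*\in[0,1]^J$. For $w\in\{0,1\}$ put $z_w(p)=\mathbb E[d(B(w),p)]-s^*$, $y_w(p)=\mathbb E[y(B(w),p)]$, $\mu^d_w(x,p)=\mathbb E[d(B(w),p)\mid X=x]$ and $\mu^y_w(x,p)=\mathbb E[y(B(w),p)\mid X=x]$. Market-clearing cutoffs are $p^*_w\in\mathcal S$ with $z_w(p^*_w)=0$, and $\tau^*_{\mathrm{GTE}}=y_1(p_1^*)-y_0(p_0^*)$.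 *Assumptions on the true population.* 1. Strong overlap: for some $\kappa>0$, $\kappa\le e(X)\le 1-\kappa$ almost surely. 2. There is $L>0$ with $\mathbb E[(d_j(B(w),p)-d_j(B(w),p'))^2]\le L\|p-p'\|$ and $\mathbb E[(y(B(w),p)-y(B(w),p'))^2]\le L\|p-p'\|$ for all $w$, $j$ and $p,p'\in\mathcal S$. 3. For all $w$ and $x$, $\mu^d_w(x,\cdot)$ and $\mu^y_w(x,\cdot)$ are twice continuously differentiable on the interior of $\mathcal S$, with first and second derivatives bounded uniformly in $w$, $x$ and $p$. 4. For $w\in\{0,1\}$ the singular values of $\nabla_p z_w(p^*_w)$ lie in an interval $[c_3,c_4]$ with $c_3>0$. 5. $\mathcal S$ is compact; for $w\in\{0,1\}$ market-clearing cutoffs $p^*_w$ exist and are unique in $\mathcal S$, and $\mathcal S$ contains a ball of some radius $c_1>0$ around $p_w^*$. *Variance.* Let $\nu^*_w=\nabla_p^\top y_w(p^*_w)\,[\nabla_p z_w(p^*_w)]^{-1}$, let $$\Gamma^{y}_w=\mu^y_w(X,p^*_w)+\frac{\mathbf 1(W=w)}{P(W=w\mid X)}\bigl(y(B(w),p^*_w)-\mu^y_w(X,p^*_w)\bigr),\qquad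 \Gamma^{d}_w=\mu^d_w(X,p^*_w)+\frac{\mathbf 1(W=w)}{P(W=w\mid X)}\bigl(d(B(w),p^*_w)-\mu^d_w(X,p^*_w)\bigr),$$ $\Gamma^q_w=\Gamma^y_w-\nu^*_w(\Gamma^d_w-s^*)$, and $$\sigma^2=\mathbb E\bigl[(\Gamma^q_1-\Gamma^q_0-\tau^*_{\mathrm{GTE}})^2\bigr].$$ *Model and efficiency bound.* The model consists of all populations for which market-clearing cutoffs in $\mathcal S$ exist for $w=0$ and $w=1$; it is otherwise nonparametric. The functional $\tau_{\mathrm{GTE}}$ is defined on it through any fixed rule that selects market-clearing cutoffs (at the true population there is no choice). A regular parametric submodel is a path $t\mapsto F_t$ through the true population $F_0$, in the model for $t$ near $0$, whose laws of $(B,W,X)$ are, for $t$ near $0$, dominated by a common $\sigma$-finite measure and differentiable in quadratic mean at $t=0$ with square-integrable score $s$. The tangent space is the closed linear span in $L^2$ (of the true law of $(B,W,X)$) of all such scores. *Claim.* Then $\sigma^2$ is the semiparametric efficiency bound for $\tau^*_{\mathrm{GTE}}$. That is: there is a function $\psi(B,W,X)$ in the tangent space such that along every regular parametric submodel $t\mapsto\tau_{\mathrm{GTE}}(F_t)$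 is differentiable at $0$ with derivative $\mathbb E[\psi\, s]$, and $\mathbb E[\psi^2]=\sigma^2$; and $\sigma^2$ is the supremum, over all regular parametric submodels with $\mathbb E[s^2]>0$, of the Cramér–Rao bounds $\bigl(\tfrac{d}{dt}\tau_{\mathrm{GTE}}(F_t)|_{t=0}\bigr)^2/\mathbb E[s^2]$. This holds for every selection rule. -/

import Mathlib

open MeasureTheory ProbabilityTheory Filter Topology

noncomputable section

/-! ## Semiparametric efficiency in a general statistical model

A model is a set `𝓜` of parameters `θ : Θ`; under `θ` one observes a draw from the law
`obs θ` on `Z`. The estimand is a real functional `τ` of the parameter. -/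

namespace Semiparametric

variable {Θ Z : Type*} [MeasurableSpace Z]

/-- `path` is a regular one-dimensional parametric submodel of `𝓜` through `θ₀` with score `s`:
it passes through `θ₀` at `t = 0`, it stays in the model for `t` near `0`, its observed laws have
densities `q t` with respect to a common σ-finite measure `ν`, and the root densities are
differentiable in quadratic mean at `t = 0`, with a score `s` that is square integrable. -/
structure IsRegularSubmodel (obs : Θ → Measure Z) (𝓜 : Set Θ) (θ₀ : Θ)
    (path : ℝ → Θ) (s : Z → ℝ) : Prop where
  base : path 0 = θ₀
  mem : ∀ᶠ t in 𝓝 (0 : ℝ), path t ∈ 𝓜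
  memLp : MemLp s 2 (obs θ₀)
  qmd : ∃ (ν : Measure Z) (q : ℝ → Z → ℝ), SigmaFinite ν ∧
    (∀ t, Measurable (q t)) ∧ (∀ t z, 0 ≤ q t z) ∧
    (∀ᶠ t in 𝓝 (0 : ℝ), obs (path t) = ν.withDensity (fun z => ENNReal.ofReal (q t z))) ∧
    Tendsto
      (fun t : ℝ => ∫⁻ z, ENNReal.ofReal
        (((√(q t z) - √(q 0 z)) / t - s z / 2 * √(q 0 z)) ^ 2) ∂ν)
      (𝓝[≠] 0) (𝓝 0)

/-- The tangent space at `θ₀`: the closed linear span in `L²(obs θ₀)` of the scores of all regular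
parametric submodels through `θ₀`. -/
def tangentSpace (obs : Θ → Measure Z) (𝓜 : Set Θ) (θ₀ : Θ) :
    Submodule ℝ (Lp ℝ 2 (obs θ₀)) :=
  (Submodule.span ℝ
    {g : Lp ℝ 2 (obs θ₀) | ∃ path, IsRegularSubmodel obs 𝓜 θ₀ path g}).topologicalClosure

/-- `ψ` is the efficient influence function of `τ` at `θ₀`: `τ` is differentiable at `θ₀` along
every regular parametric submodel, with derivative the inner product of `ψ` with the score,
and `ψ` lies in the tangent space. -/
structure IsEfficientInfluenceFunction (obs : Θ → Measure Z) (𝓜 : Set Θ) (τ : Θ → ℝ) (θ₀ : Θ)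
    (ψ : Lp ℝ 2 (obs θ₀)) : Prop where
  mem_tangentSpace : ψ ∈ tangentSpace obs 𝓜 θ₀
  hasDerivAt : ∀ (path : ℝ → Θ) (s : Z → ℝ), IsRegularSubmodel obs 𝓜 θ₀ path s →
    HasDerivAt (fun t => τ (path t)) (∫ z, ψ z * s z ∂(obs θ₀)) 0

/-- The Cramér–Rao bounds `τ'(0)² / I(0)` for estimating `τ`, over all regular parametric
submodels through `θ₀` with positive Fisher information `I(0) = E[s²]`. -/
def cramerRaoBounds (obs : Θ → Measure Z) (𝓜 : Set Θ) (τ : Θ → ℝ) (θ₀ : Θ) : Set ℝ :=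
  {v | ∃ (path : ℝ → Θ) (s : Z → ℝ) (τ' : ℝ), IsRegularSubmodel obs 𝓜 θ₀ path s ∧
    HasDerivAt (fun t => τ (path t)) τ' 0 ∧
    0 < ∫ z, s z ^ 2 ∂(obs θ₀) ∧ v = τ' ^ 2 / ∫ z, s z ^ 2 ∂(obs θ₀)}

/-- `V` is the semiparametric efficiency bound for `τ` at `θ₀`: `τ` is pathwise differentiable,
its efficient influence function has variance `V`, and `V` is the supremum of the Cramér–Rao
bounds of the regular parametric submodels. -/
def IsEfficiencyBound (obs : Θ → Measure Z) (𝓜 : Set Θ) (τ : Θ → ℝ) (θ₀ : Θ) (V : ℝ) : Prop :=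
  (∃ ψ : Lp ℝ 2 (obs θ₀), IsEfficientInfluenceFunction obs 𝓜 τ θ₀ ψ ∧
    ∫ z, (ψ z) ^ 2 ∂(obs θ₀) = V) ∧
  IsLUB (cramerRaoBounds obs 𝓜 τ θ₀) V

end Semiparametric

/-! ## Populations of market participants -/

/-- A population law for `(X, B(0), B(1), W)` under unconfoundedness and overlap, given through
its factorization: `X` has law `cov`; given `X = x`, the potential submissions
`(B(w))_{w : Bool}` have law `bid x` (arbitrarily dependent on each other), and, independently of
them, `W = true` (treated) with probability `prop x ∈ (0, 1)`. -/
structure Population (𝓑 𝓧 : Type*) [MeasurableSpace 𝓑] [MeasurableSpace 𝓧] where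
  cov : Measure 𝓧
  bid : Kernel 𝓧 (Bool → 𝓑)
  prop : 𝓧 → ℝ
  isProbabilityMeasure_cov : IsProbabilityMeasure cov
  isMarkovKernel_bid : IsMarkovKernel bid
  measurable_prop : Measurable prop
  prop_pos : ∀ x, 0 < prop x
  prop_lt_one : ∀ x, prop x < 1

namespace Population

variable {𝓑 𝓧 : Type*} [MeasurableSpace 𝓑] [MeasurableSpace 𝓧]

/-- `P(W = w | X = x)`. -/
def armProb (F : Population 𝓑 𝓧) (w : Bool) (x : 𝓧) : ℝ :=
  if w then F.prop x else 1 - F.prop x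

/-- The conditional law of the treatment `W` given `X = x`. -/
def treatment (F : Population 𝓑 𝓧) : Kernel 𝓧 Bool where
  toFun x := ENNReal.ofReal (F.prop x) • Measure.dirac true +
    ENNReal.ofReal (1 - F.prop x) • Measure.dirac false
  measurable' := by
    refine Measure.measurable_of_measurable_coe _ fun s hs => ?_
    simp only [Measure.coe_add, Measure.coe_smul, Pi.add_apply, Pi.smul_apply, smul_eq_mul]
    exact (F.measurable_prop.ennreal_ofReal.mul_const _).add
      ((measurable_const.sub F.measurable_prop).ennreal_ofReal.mul_const _)

/-- The joint law of `(X, ((B(w))_w, W))`. -/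
def fullLaw (F : Population 𝓑 𝓧) : Measure (𝓧 × (Bool → 𝓑) × Bool) :=
  F.cov.compProd (F.bid.prod F.treatment)

/-- What the researcher sees of one participant: `(B, W, X)` with `B = B(W)`. -/
def observe (ω : 𝓧 × (Bool → 𝓑) × Bool) : 𝓑 × Bool × 𝓧 :=
  (ω.2.1 ω.2.2, ω.2.2, ω.1)

theorem measurable_observe : Measurable (observe (𝓑 := 𝓑) (𝓧 := 𝓧)) := by
  have h : Measurable fun q : (Bool → 𝓑) × Bool => q.1 q.2 :=
    measurable_from_prod_countable_left fun w => measurable_pi_apply w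
  exact (h.comp measurable_snd).prodMk (measurable_snd.snd.prodMk measurable_fst)

/-- The law of the observed data `(B, W, X)`. -/
def obsLaw (F : Population 𝓑 𝓧) : Measure (𝓑 × Bool × 𝓧) :=
  F.fullLaw.map observe

/-- The law of the potential submission `B(w)`. -/
def potLaw (F : Population 𝓑 𝓧) (w : Bool) : Measure 𝓑 :=
  (F.cov.bind F.bid).map fun b => b w

end Population

/-! ## Cutoff mechanisms in the continuum market -/

/-- A cutoff mechanism for `J` items: the allocation `d(b, p)` and the outcome `y(b, p)` of a
participant with submission `b` at cutoffs `p`, the set `S` of admissible cutoffs, and the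
fractional capacities `s*`. -/
structure CutoffMechanism (𝓑 : Type*) [MeasurableSpace 𝓑] (J : ℕ) where
  alloc : 𝓑 → EuclideanSpace ℝ (Fin J) → EuclideanSpace ℝ (Fin J)
  outcome : 𝓑 → EuclideanSpace ℝ (Fin J) → ℝ
  cutoffs : Set (EuclideanSpace ℝ (Fin J))
  capacity : EuclideanSpace ℝ (Fin J)
  measurable_alloc : ∀ p, Measurable fun b => alloc b p
  measurable_outcome : ∀ p, Measurable fun b => outcome b p

namespace CutoffMechanism

variable {𝓑 𝓧 : Type*} [MeasurableSpace 𝓑] [MeasurableSpace 𝓧] {J : ℕ}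

/-- Expected excess demand when everyone has treatment `w`: `z_w(p) = E[d(B(w), p)] - s*`. -/
def excess (M : CutoffMechanism 𝓑 J) (F : Population 𝓑 𝓧) (w : Bool)
    (p : EuclideanSpace ℝ (Fin J)) : EuclideanSpace ℝ (Fin J) :=
  (∫ b, M.alloc b p ∂(F.potLaw w)) - M.capacity

/-- Expected outcome when everyone has treatment `w`: `y_w(p) = E[y(B(w), p)]`. -/
def meanOutcome (M : CutoffMechanism 𝓑 J) (F : Population 𝓑 𝓧) (w : Bool)
    (p : EuclideanSpace ℝ (Fin J)) : ℝ :=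
  ∫ b, M.outcome b p ∂(F.potLaw w)

/-- `μ^d_w(x, p) = E[d(B(w), p) | X = x]`. -/
def condAlloc (M : CutoffMechanism 𝓑 J) (F : Population 𝓑 𝓧) (w : Bool) (x : 𝓧)
    (p : EuclideanSpace ℝ (Fin J)) : EuclideanSpace ℝ (Fin J) :=
  ∫ b, M.alloc (b w) p ∂(F.bid x)

/-- `μ^y_w(x, p) = E[y(B(w), p) | X = x]`. -/
def condOutcome (M : CutoffMechanism 𝓑 J) (F : Population 𝓑 𝓧) (w : Bool) (x : 𝓧)
    (p : EuclideanSpace ℝ (Fin J)) : ℝ :=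
  ∫ b, M.outcome (b w) p ∂(F.bid x)

/-- The cutoffs `p ∈ S` clear the continuum market in which everyone has treatment `w`. -/
def Clears (M : CutoffMechanism 𝓑 J) (F : Population 𝓑 𝓧) (w : Bool)
    (p : EuclideanSpace ℝ (Fin J)) : Prop :=
  p ∈ M.cutoffs ∧ M.excess F w p = 0

/-- The semiparametric model: the populations for which market-clearing cutoffs exist, both when
everyone is treated and when nobody is. The law of the data is otherwise unrestricted. -/
def model (M : CutoffMechanism 𝓑 J) (𝓧 : Type*) [MeasurableSpace 𝓧] : Set (Population 𝓑 𝓧) :=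
  {F | ∀ w, ∃ p, M.Clears F w p}

/-- `cut` assigns to every population in which market-clearing cutoffs exist such cutoffs. Where
they are unique there is no choice; elsewhere the selection is arbitrary. -/
def IsCutoffRule (M : CutoffMechanism 𝓑 J)
    (cut : Population 𝓑 𝓧 → Bool → EuclideanSpace ℝ (Fin J)) : Prop :=
  ∀ F w, (∃ p, M.Clears F w p) → M.Clears F w (cut F w)

/-- The continuum-market global treatment effect at cutoffs `p`:
`E[y(B(1), p 1)] - E[y(B(0), p 0)]`. -/
def globalEffect (M : CutoffMechanism 𝓑 J) (F : Population 𝓑 𝓧)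
    (p : Bool → EuclideanSpace ℝ (Fin J)) : ℝ :=
  M.meanOutcome F true (p true) - M.meanOutcome F false (p false)

/-- `ν_w = ∇ᵀ y_w(p) [∇ z_w(p)]⁻¹`, as a linear functional on `ℝ^J`. -/
def nu (M : CutoffMechanism 𝓑 J) (F : Population 𝓑 𝓧) (w : Bool)
    (p : EuclideanSpace ℝ (Fin J)) : EuclideanSpace ℝ (Fin J) →L[ℝ] ℝ :=
  (fderiv ℝ (M.meanOutcome F w) p).comp (fderiv ℝ (M.excess F w) p).inverse

/-- `1(W = w) / P(W = w | X)`. -/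
def ipw (F : Population 𝓑 𝓧) (w : Bool) (ω : 𝓧 × (Bool → 𝓑) × Bool) : ℝ :=
  if ω.2.2 = w then (F.armProb w ω.1)⁻¹ else 0

/-- The doubly robust score for outcomes,
`Γ^y_w(p) = μ^y_w(X, p) + 1(W = w) / P(W = w | X) * (y(B(w), p) - μ^y_w(X, p))`. -/
def scoreOutcome (M : CutoffMechanism 𝓑 J) (F : Population 𝓑 𝓧) (w : Bool)
    (p : EuclideanSpace ℝ (Fin J)) (ω : 𝓧 × (Bool → 𝓑) × Bool) : ℝ :=
  M.condOutcome F w ω.1 p +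
    ipw F w ω * (M.outcome (ω.2.1 w) p - M.condOutcome F w ω.1 p)

/-- The doubly robust score for allocations,
`Γ^d_w(p) = μ^d_w(X, p) + 1(W = w) / P(W = w | X) * (d(B(w), p) - μ^d_w(X, p))`. -/
def scoreAlloc (M : CutoffMechanism 𝓑 J) (F : Population 𝓑 𝓧) (w : Bool)
    (p : EuclideanSpace ℝ (Fin J)) (ω : 𝓧 × (Bool → 𝓑) × Bool) : EuclideanSpace ℝ (Fin J) :=
  M.condAlloc F w ω.1 p +
    ipw F w ω • (M.alloc (ω.2.1 w) p - M.condAlloc F w ω.1 p)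

/-- `Γ^q_w(p) = Γ^y_w(p) - ν_w (Γ^d_w(p) - s*)`. -/
def scoreQ (M : CutoffMechanism 𝓑 J) (F : Population 𝓑 𝓧) (w : Bool)
    (p : EuclideanSpace ℝ (Fin J)) (ω : 𝓧 × (Bool → 𝓑) × Bool) : ℝ :=
  M.scoreOutcome F w p ω - M.nu F w p (M.scoreAlloc F w p ω - M.capacity)

/-- `σ² = E[(Γ^q_1(p 1) - Γ^q_0(p 0) - τ)²]`. -/
def asymptoticVariance (M : CutoffMechanism 𝓑 J) (F : Population 𝓑 𝓧)
    (p : Bool → EuclideanSpace ℝ (Fin J)) : ℝ :=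
  ∫ ω, (M.scoreQ F true (p true) ω - M.scoreQ F false (p false) ω - M.globalEffect F p) ^ 2
    ∂F.fullLaw

/-- The assumptions on the mechanism and on the true population `F`, whose market-clearing cutoffs
are `pstar w` when everyone has treatment `w`. -/
structure Assumptions (M : CutoffMechanism 𝓑 J) (F : Population 𝓑 𝓧)
    (pstar : Bool → EuclideanSpace ℝ (Fin J)) : Prop where
  capacity_mem : ∀ j, M.capacity j ∈ Set.Icc (0 : ℝ) 1
  strong_overlap : ∃ κ : ℝ, 0 < κ ∧ ∀ᵐ x ∂F.cov, κ ≤ F.prop x ∧ F.prop x ≤ 1 - κ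
  alloc_bounded : ∃ K : ℝ, ∀ b, ∀ p ∈ M.cutoffs, ‖M.alloc b p‖ ≤ K
  outcome_bounded : ∃ K : ℝ, ∀ b, ∀ p ∈ M.cutoffs, |M.outcome b p| ≤ K
  weak_continuity : ∃ L : ℝ, 0 < L ∧ ∀ w, ∀ p ∈ M.cutoffs, ∀ p' ∈ M.cutoffs,
    (∀ j, ∫ b, (M.alloc b p j - M.alloc b p' j) ^ 2 ∂(F.potLaw w) ≤ L * ‖p - p'‖) ∧
    ∫ b, (M.outcome b p - M.outcome b p') ^ 2 ∂(F.potLaw w) ≤ L * ‖p - p'‖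
  smooth : ∃ c' : ℝ, ∀ w x,
    ContDiffOn ℝ 2 (M.condAlloc F w x) (interior M.cutoffs) ∧
    ContDiffOn ℝ 2 (M.condOutcome F w x) (interior M.cutoffs) ∧
    ∀ k : ℕ, 1 ≤ k → k ≤ 2 → ∀ p ∈ interior M.cutoffs,
      ‖iteratedFDeriv ℝ k (M.condAlloc F w x) p‖ ≤ c' ∧
      ‖iteratedFDeriv ℝ k (M.condOutcome F w x) p‖ ≤ c'
  /-- The singular values of the Jacobian of excess demand lie in `[c₃, c₄]`. -/
  jacobian : ∃ c₃ c₄ : ℝ, 0 < c₃ ∧ ∀ w v,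
    c₃ * ‖v‖ ≤ ‖fderiv ℝ (M.excess F w) (pstar w) v‖ ∧
    ‖fderiv ℝ (M.excess F w) (pstar w) v‖ ≤ c₄ * ‖v‖
  compact_cutoffs : IsCompact M.cutoffs
  interior_equilibrium : ∃ c₁ : ℝ, 0 < c₁ ∧ ∀ w, Metric.ball (pstar w) c₁ ⊆ M.cutoffs
  clears : ∀ w, M.Clears F w (pstar w)
  /-- Uniqueness; as `S` is compact and `z_w` continuous on it, this makes `pstar w`
  well-separated. -/
  unique_equilibrium : ∀ w p, M.Clears F w p → p = pstar w

end CutoffMechanism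

end

/-!
The doubly robust score of a bounded function of `B(w)` is unbiased at `F₀`, and along a regular
submodel its bias is a product of two errors, in the treatment probability and in the regression,
each of first order in the Hellinger distance. Potential means are therefore differentiable along
the submodel, uniformly over bounded functions. The cutoffs move at first order, but with `ν` as
prices for excess demand the mean net outcome is stationary in them, so that the doubly robust
scores of the net outcomes form the influence function. It is itself the score of a submodel, a
bounded tilt of `F₀`; as the excess demand of a tilted population need only be continuous in the
cutoffs, Brouwer's theorem provides its market-clearing cutoffs.
-/

/-! ## Brouwer's fixed point theorem -/

namespace Brouwer

open Metric Set

section Determinant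

theorem exists_eval_eq_sum {K : Type*} [Field K] (n : ℕ) {S : Set K} (hS : S.Infinite) (x : K) :
    ∃ (s : Finset K) (c : K → K), ↑s ⊆ S ∧
      ∀ p : Polynomial K, p.natDegree ≤ n → p.eval x = ∑ t ∈ s, c t * p.eval t := by
  classical
  obtain ⟨s, hs, hcard⟩ := hS.exists_subset_card_eq (n + 1)
  refine ⟨s, fun t => (Lagrange.basis s id t).eval x, hs, fun p hp => ?_⟩
  have hdeg : p.degree < s.card :=
    p.degree_le_natDegree.trans_lt (by rw [hcard]; exact_mod_cast Nat.lt_succ_of_le hp)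
  conv_lhs => rw [Lagrange.eq_interpolate (v := id) (injOn_id _) hdeg, Lagrange.interpolate_apply,
    Polynomial.eval_finsetSum]
  simp only [id, Polynomial.eval_mul, Polynomial.eval_C, mul_comm]

theorem exists_polynomial_det_one_add_smul {R V : Type*} [CommRing R] [Nontrivial R]
    [AddCommGroup V] [Module R V] [Module.Free R V] [Module.Finite R V] (A : Module.End R V) :
    ∃ p : Polynomial R, p.natDegree ≤ Module.finrank R V ∧
      ∀ t : R, LinearMap.det (1 + t • A) = p.eval t := by
  classical
  let b := Module.finBasis R V
  let a := LinearMap.toMatrix b b A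
  refine ⟨((Polynomial.X : Polynomial R) • a.map Polynomial.C + (1 : Matrix _ _ R).map
    Polynomial.C).det, ?_, fun t => ?_⟩
  · simpa only [Fintype.card_fin] using Polynomial.natDegree_det_X_add_C_le a 1
  · rw [← Polynomial.coe_evalRingHom, RingHom.map_det, ← LinearMap.det_toMatrix b]
    congr 1
    ext i j
    simp [a, Module.End.one_eq_id, add_comm, Matrix.one_apply, apply_ite, mul_comm t]

variable {E : Type*} [NormedAddCommGroup E] [NormedSpace ℝ E] [FiniteDimensional ℝ E]

theorem det_one_add_ne_zero {A : E →L[ℝ] E} (hA : ‖A‖ < 1) : (1 + A).det ≠ 0 := by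
  have hunit : IsUnit (1 + A) := by simpa using isUnit_one_sub_of_norm_lt_one (x := -A) (by simpa)
  exact ((LinearMap.isUnit_iff_isUnit_det _).1
    (hunit.map ContinuousLinearMap.toLinearMapRingHom)).ne_zero

theorem det_one_add_pos {A : E →L[ℝ] E} (hA : ‖A‖ < 1) : 0 < (1 + A).det := by
  by_contra! hneg
  have hcont : Continuous fun t : ℝ => (1 + t • A).det :=
    ContinuousLinearMap.continuous_det.comp (by fun_prop)
  obtain ⟨t, ht, h0⟩ := intermediate_value_Icc' zero_le_one hcont.continuousOn
    (show (0 : ℝ) ∈ Icc _ _ from ⟨by simpa using hneg, by simp [ContinuousLinearMap.det]⟩)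
  refine det_one_add_ne_zero (A := t • A) ?_ h0
  rw [norm_smul, Real.norm_of_nonneg ht.1]
  nlinarith [ht.1, ht.2, norm_nonneg A]

end Determinant

section Retraction

theorem image_eq_self_of_isOpen_image {X : Type*} [TopologicalSpace X] [T2Space X] {U : Set X}
    {f : X → X} (hU : IsPreconnected U) (hne : U.Nonempty) (hcompact : IsCompact (closure U))
    (hf : ContinuousOn f (closure U)) (hopen : IsOpen (f '' U)) (hmaps : MapsTo f U U)
    (hfrontier : ∀ x ∈ closure U \ U, f x ∉ U) : f '' U = U := by
  have hclosed : IsClosed (f '' closure U) := (hcompact.image_of_continuousOn hf).isClosed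
  refine hmaps.image_subset.antisymm <|
    hU.subset_left_of_subset_union hopen hclosed.isOpen_compl ?_ (fun y hy => ?_) ?_
  · exact disjoint_compl_right_iff_subset.2 (image_mono subset_closure)
  · by_cases h : y ∈ f '' closure U
    · obtain ⟨x, hx, rfl⟩ := h
      exact .inl ⟨x, by_contra fun hxU => hfrontier x ⟨hx, hxU⟩ hy, rfl⟩
    · exact .inr h
  · obtain ⟨x, hx⟩ := hne
    exact ⟨f x, hmaps hx, mem_image_of_mem f hx⟩

theorem injOn_add_smul {E : Type*} [NormedAddCommGroup E] [NormedSpace ℝ E] {s : Set E}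
    {g : E → E} {K t : ℝ} (hg : ∀ x ∈ s, ∀ y ∈ s, ‖g x - g y‖ ≤ K * ‖x - y‖)
    (ht : 0 ≤ t) (htK : t * K < 1) : InjOn (fun x => x + t • g x) s := by
  intro x hx y hy hxy
  by_contra hne
  have hsub : x - y = t • (g y - g x) := by
    rw [smul_sub, sub_eq_sub_iff_add_eq_add, add_comm (t • g y)]
    exact hxy
  have hle : ‖x - y‖ ≤ t * (K * ‖x - y‖) := by
    calc ‖x - y‖ = t * ‖g y - g x‖ := by rw [hsub, norm_smul, Real.norm_of_nonneg ht]
      _ ≤ t * (K * ‖x - y‖) := by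
        rw [norm_sub_rev x]
        exact mul_le_mul_of_nonneg_left (hg y hy x hx) ht
  nlinarith [norm_pos_iff.2 (sub_ne_zero.2 hne)]

variable {E : Type*} [NormedAddCommGroup E] [InnerProductSpace ℝ E] [FiniteDimensional ℝ E]
  {r : E → E}

theorem isOpen_image_of_hasStrictFDerivAt {f : E → E} {f' : E → E →L[ℝ] E} {U : Set E}
    (hU : IsOpen U) (hf : ∀ x ∈ U, HasStrictFDerivAt f (f' x) x)
    (hdet : ∀ x ∈ U, (f' x).det ≠ 0) : IsOpen (f '' U) := by
  rw [isOpen_iff_mem_nhds]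
  rintro _ ⟨x, hx, rfl⟩
  rw [← HasStrictFDerivAt.map_nhds_eq_of_equiv
    (f' := (f' x).toContinuousLinearEquivOfDetNeZero (hdet x hx)) (hf x hx)]
  exact image_mem_map (hU.mem_nhds hx)

theorem det_eq_zero_of_norm_eventually_eq_one {x : E} {r' : E →L[ℝ] E} (hr : HasFDerivAt r r' x)
    (hnorm : ∀ᶠ y in 𝓝 x, ‖r y‖ = 1) : r'.det = 0 := by
  by_contra hne
  obtain ⟨v, hv⟩ : ∃ v, r' v = r x :=
    (r'.toContinuousLinearEquivOfDetNeZero hne).surjective (r x)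
  have hconst : (fun y => inner ℝ (r y) (r y)) =ᶠ[𝓝 x] fun _ => (1 : ℝ) := by
    filter_upwards [hnorm] with y hy
    rw [real_inner_self_eq_norm_sq, hy, one_pow]
  have hzero := (hr.inner ℝ hr).unique ((hasFDerivAt_const (1 : ℝ) x).congr_of_eventuallyEq hconst)
  simpa [hv, hnorm.self_of_nhds] using congrArg (fun L => L v) hzero

variable [MeasurableSpace E] [BorelSpace E]

theorem setIntegral_det_eq_volume_ball {f : E → E} {f' : E → E →L[ℝ] E}
    (hf : ∀ x ∈ closedBall 0 1, HasStrictFDerivAt f (f' x) x)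
    (hdet : ∀ x ∈ ball 0 1, 0 < (f' x).det) (hinj : InjOn f (ball 0 1))
    (hmaps : MapsTo f (ball 0 1) (ball 0 1)) (hid : ∀ x, ‖x‖ = 1 → f x = x) :
    ∫ x in ball (0 : E) 1, (f' x).det = volume.real (ball (0 : E) 1) := by
  have hball : ball (0 : E) 1 ⊆ closedBall 0 1 := ball_subset_closedBall
  have hclosure : closure (ball (0 : E) 1) = closedBall 0 1 := closure_ball 0 one_ne_zero
  have himage : f '' ball 0 1 = ball 0 1 := by
    refine image_eq_self_of_isOpen_image (convex_ball 0 1).isPreconnected ⟨0, by simp⟩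
      (hclosure ▸ isCompact_closedBall 0 1)
      (hclosure ▸ fun x hx => (hf x hx).continuousAt.continuousWithinAt)
      (isOpen_image_of_hasStrictFDerivAt isOpen_ball (fun x hx => hf x (hball hx))
        fun x hx => (hdet x hx).ne') hmaps ?_
    rw [hclosure, closedBall_sdiff_ball]
    intro x hx
    rw [hid x (mem_sphere_zero_iff_norm.1 hx)]
    simp [mem_sphere_zero_iff_norm.1 hx]
  have hvol := integral_image_eq_integral_abs_det_fderiv_smul volume measurableSet_ball
    (fun x hx => (hf x (hball hx)).hasFDerivAt.hasFDerivWithinAt) hinj (fun _ => (1 : ℝ))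
  simp only [smul_eq_mul, mul_one, integral_const, measureReal_restrict_apply_univ] at hvol
  rw [← congrArg volume.real himage, hvol]
  exact setIntegral_congr_fun measurableSet_ball fun x hx => (abs_of_pos (hdet x hx)).symm

theorem setIntegral_det_interpolation {K t : ℝ} (hr : ∀ x ∈ closedBall 0 1, ContDiffAt ℝ 1 r x)
    (hnorm : ∀ x ∈ closedBall 0 1, ‖r x‖ = 1) (hid : ∀ x, ‖x‖ = 1 → r x = x)
    (hK : ∀ x ∈ closedBall 0 1, ‖fderiv ℝ r x - 1‖ ≤ K) (ht : 0 ≤ t) (ht1 : t < 1)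
    (htK : t * K < 1) :
    ∫ x in ball (0 : E) 1, (1 + t • (fderiv ℝ r x - 1)).det = volume.real (ball (0 : E) 1) := by
  have hball : ball (0 : E) 1 ⊆ closedBall 0 1 := ball_subset_closedBall
  have hg : ∀ x ∈ closedBall (0 : E) 1,
      HasStrictFDerivAt (fun x => r x - x) (fderiv ℝ r x - 1) x := fun x hx =>
    ((hr x hx).hasStrictFDerivAt one_ne_zero).sub (hasStrictFDerivAt_id x)
  refine setIntegral_det_eq_volume_ball (f := fun x => x + t • (r x - x))
    (fun x hx => (hasStrictFDerivAt_id x).add ((hg x hx).const_smul t))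
    (fun x hx => det_one_add_pos ?_) ?_ (fun x hx => ?_) fun x hx => by simp [hid x hx]
  · rw [norm_smul, Real.norm_of_nonneg ht]
    exact (mul_le_mul_of_nonneg_left (hK x (hball hx)) ht).trans_lt htK
  · exact (injOn_add_smul (fun x hx y hy =>
      (convex_closedBall (0 : E) 1).norm_image_sub_le_of_norm_hasFDerivWithin_le
        (fun z hz => (hg z hz).hasFDerivAt.hasFDerivWithinAt) hK hy hx) ht htK).mono hball
  · have hx' : ‖x‖ < 1 := mem_ball_zero_iff.1 hx
    have hconvex : x + t • (r x - x) = (1 - t) • x + t • r x := by module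
    change x + t • (r x - x) ∈ ball 0 1
    rw [mem_ball_zero_iff, hconvex]
    calc ‖(1 - t) • x + t • r x‖ ≤ (1 - t) * ‖x‖ + t * 1 := by
          refine (norm_add_le _ _).trans_eq ?_
          rw [norm_smul, norm_smul, hnorm x (hball hx), Real.norm_of_nonneg ht,
            Real.norm_of_nonneg (by linarith)]
      _ < 1 := by nlinarith

theorem setIntegral_det_one_add_eq {D : E → E →L[ℝ] E} {s : Set E} {v δ : ℝ} (hs : IsCompact s)
    (hD : ContinuousOn D s) {U : Set E} (hU : U ⊆ s) (hδ : 0 < δ)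
    (hsmall : ∀ t ∈ Ioo 0 δ, ∫ x in U, (1 + t • D x).det = v) :
    ∫ x in U, (1 + D x).det = v := by
  obtain ⟨s', c, hs', hc⟩ := exists_eval_eq_sum (Module.finrank ℝ E) (Ioo_infinite hδ) 1
  have hdet (A : E →L[ℝ] E) : (1 + A).det = ∑ t ∈ s', c t * (1 + t • A).det := by
    obtain ⟨p, hdeg, hp⟩ := exists_polynomial_det_one_add_smul (A : E →ₗ[ℝ] E)
    have heval (t : ℝ) : (1 + t • A).det = p.eval t := hp t
    simpa only [← heval, one_smul] using hc p hdeg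
  have hsum : ∑ t ∈ s', c t = 1 := by simpa using (hc 1 (by simp)).symm
  have hint (t : ℝ) : IntegrableOn (fun x => (1 + t • D x).det) U :=
    (ContinuousOn.integrableOn_compact hs (ContinuousLinearMap.continuous_det.comp_continuousOn
      (continuousOn_const.add (hD.const_smul t)))).mono_set hU
  calc ∫ x in U, (1 + D x).det = ∫ x in U, ∑ t ∈ s', c t * (1 + t • D x).det := by
        exact integral_congr_ae (.of_forall fun x => hdet (D x))
    _ = ∑ t ∈ s', c t * ∫ x in U, (1 + t • D x).det := by
        rw [integral_finsetSum _ fun t _ => (hint t).const_mul _]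
        simp only [integral_const_mul]
    _ = v := by
        rw [Finset.sum_congr rfl fun t ht => by rw [hsmall t (hs' ht)], ← Finset.sum_mul, hsum,
          one_mul]

omit [MeasurableSpace E] [BorelSpace E] in
/-- `∫ det (1 + t (r' - 1))` over the ball is a polynomial in `t`. For small `t ≥ 0` it is the
volume of the image of the ball under `x ↦ x + t (r x - x)`, that is, of the ball itself, and so it
is at `t = 1` too, where however the integrand vanishes. -/
theorem not_retraction (hr : ∀ x ∈ closedBall 0 1, ContDiffAt ℝ 1 r x)
    (hnorm : ∀ x ∈ closedBall 0 1, ‖r x‖ = 1) (hid : ∀ x, ‖x‖ = 1 → r x = x) : False := by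
  borelize E
  have hball : ball (0 : E) 1 ⊆ closedBall 0 1 := ball_subset_closedBall
  have hcont : ContinuousOn (fun x => fderiv ℝ r x - 1) (closedBall (0 : E) 1) := fun x hx =>
    (((hr x hx).fderiv_right (m := 0) le_rfl).continuousAt.sub
      continuousAt_const).continuousWithinAt
  obtain ⟨K, hK⟩ := (isCompact_closedBall (0 : E) 1).exists_bound_of_continuousOn hcont
  have hK0 : 0 ≤ K := (norm_nonneg _).trans (hK 0 (by simp))
  have hone : ∫ x in ball (0 : E) 1, (1 + (fderiv ℝ r x - 1)).det =
      volume.real (ball (0 : E) 1) := by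
    refine setIntegral_det_one_add_eq (isCompact_closedBall 0 1) hcont hball
      (show 0 < 1 / (K + 1) by positivity) fun t ht => ?_
    have htK := ht.2
    rw [lt_div_iff₀ (by positivity)] at htK
    exact setIntegral_det_interpolation hr hnorm hid hK ht.1.le (by nlinarith [ht.1])
      (by nlinarith [ht.1])
  have hzero : ∀ x ∈ ball (0 : E) 1, (1 + (fderiv ℝ r x - 1)).det = 0 := fun x hx => by
    rw [add_sub_cancel]
    refine det_eq_zero_of_norm_eventually_eq_one
      ((hr x (hball hx)).differentiableAt one_ne_zero).hasFDerivAt ?_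
    filter_upwards [isOpen_ball.mem_nhds hx] with y hy using hnorm y (hball hy)
  rw [setIntegral_congr_fun measurableSet_ball hzero, integral_zero] at hone
  exact (ENNReal.toReal_pos (measure_ball_pos volume (0 : E) one_pos).ne'
    measure_ball_lt_top.ne).ne hone

end Retraction

section FixedPoint

variable {E : Type*} [NormedAddCommGroup E] [InnerProductSpace ℝ E] {x u : E}

/-- The discriminant of the quadratic equation `‖x + c u‖² = 1` for `c`, divided by `4`. -/
def rayDiscrim (x u : E) : ℝ := inner ℝ x u ^ 2 + ‖u‖ ^ 2 * (1 - ‖x‖ ^ 2)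

/-- The point where the ray from `x` in the direction `u` leaves the unit ball. -/
noncomputable def rayExit (x u : E) : E :=
  x + ((√(rayDiscrim x u) - inner ℝ x u) / ‖u‖ ^ 2) • u

theorem norm_rayExit (hu : u ≠ 0) (h : 0 ≤ rayDiscrim x u) : ‖rayExit x u‖ = 1 := by
  have hu0 : ‖u‖ ^ 2 ≠ 0 := by positivity
  set c := (√(rayDiscrim x u) - inner ℝ x u) / ‖u‖ ^ 2 with hc
  have hmul : c * ‖u‖ ^ 2 = √(rayDiscrim x u) - inner ℝ x u := div_mul_cancel₀ _ hu0
  have hsqrt : √(rayDiscrim x u) ^ 2 = inner ℝ x u ^ 2 + ‖u‖ ^ 2 * (1 - ‖x‖ ^ 2) := Real.sq_sqrt h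
  have hquad : (c * ‖u‖ ^ 2) ^ 2 + 2 * inner ℝ x u * (c * ‖u‖ ^ 2) = ‖u‖ ^ 2 * (1 - ‖x‖ ^ 2) := by
    rw [hmul]
    linear_combination hsqrt
  have hsq : ‖rayExit x u‖ ^ 2 = 1 := by
    rw [rayExit, ← hc, norm_add_sq_real, inner_smul_right, norm_smul, mul_pow, Real.norm_eq_abs,
      sq_abs]
    refine mul_right_cancel₀ hu0 ?_
    linear_combination hquad
  exact (pow_eq_one_iff_of_nonneg (norm_nonneg _) two_ne_zero).1 hsq

theorem rayExit_eq_self (hx : ‖x‖ = 1) (h : 0 ≤ inner ℝ x u) : rayExit x u = x := by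
  simp [rayExit, rayDiscrim, hx, Real.sqrt_sq h]

theorem rayDiscrim_sub_pos {y : E} (hx : ‖x‖ ≤ 1) (hy : ‖y‖ < 1) (hne : x ≠ y) :
    0 < rayDiscrim x (x - y) := by
  have hu : 0 < ‖x - y‖ ^ 2 := by have := sub_ne_zero.2 hne; positivity
  rcases hx.lt_or_eq with hx | hx
  · exact add_pos_of_nonneg_of_pos (sq_nonneg _) (mul_pos hu (by nlinarith [norm_nonneg x]))
  · have hinner : 0 < inner ℝ x (x - y) := by
      rw [inner_sub_right, real_inner_self_eq_norm_sq, hx]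
      nlinarith [real_inner_le_norm x y]
    simpa [rayDiscrim, hx] using pow_pos hinner 2

theorem exists_fixedPoint_of_contDiff [FiniteDimensional ℝ E] {k : E → E} (hk : ContDiff ℝ 1 k)
    (hlt : ∀ x ∈ closedBall 0 1, ‖k x‖ < 1) : ∃ x ∈ closedBall 0 1, k x = x := by
  by_contra! hne
  have hu : ContDiff ℝ 1 fun x => x - k x := contDiff_id.sub hk
  have hu0 : ∀ x ∈ closedBall 0 1, x - k x ≠ 0 := fun x hx => sub_ne_zero.2 (hne x hx).symm
  have hdiscrim : ∀ x ∈ closedBall 0 1, 0 < rayDiscrim x (x - k x) := fun x hx =>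
    rayDiscrim_sub_pos (mem_closedBall_zero_iff.1 hx) (hlt x hx) (hne x hx).symm
  have hdiscrim_smooth : ContDiff ℝ 1 fun x => rayDiscrim x (x - k x) :=
    ((contDiff_id.inner ℝ hu).pow 2).add
      ((hu.norm_sq ℝ).mul (contDiff_const.sub (contDiff_id.norm_sq ℝ)))
  refine not_retraction (r := fun x => rayExit x (x - k x)) (fun x hx => ?_)
    (fun x hx => norm_rayExit (hu0 x hx) (hdiscrim x hx).le) fun x hx => ?_
  · exact contDiffAt_id.add ((((hdiscrim_smooth.contDiffAt.sqrt (hdiscrim x hx).ne').sub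
      (contDiff_id.inner ℝ hu).contDiffAt).div (hu.norm_sq ℝ).contDiffAt
        (pow_ne_zero 2 (norm_ne_zero_iff.2 (hu0 x hx)))).smul hu.contDiffAt)
  · refine rayExit_eq_self hx ?_
    rw [inner_sub_right, real_inner_self_eq_norm_sq, hx]
    nlinarith [real_inner_le_norm x (k x), hlt x (by simp [hx])]

theorem exists_norm_sub_le_of_mapsTo_closedBall [FiniteDimensional ℝ E] {f : E → E}
    (hf : ContinuousOn f (closedBall 0 1)) (hmaps : MapsTo f (closedBall 0 1) (closedBall 0 1))
    {ε : ℝ} (hε : 0 < ε) : ∃ x ∈ closedBall 0 1, ‖f x - x‖ ≤ ε := by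
  obtain ⟨f', hf'⟩ := ContinuousMap.exists_restrict_eq isClosed_closedBall
    ⟨_, hf.domRestrict⟩
  have hf'_eq : ∀ x ∈ closedBall 0 1, f' x = f x := fun x hx => DFunLike.congr_fun hf' ⟨x, hx⟩
  obtain ⟨g, hg, hgf, -⟩ := f'.continuous.exists_contDiff_approx 1 (ε := fun _ => ε / 3)
    continuous_const fun _ => by positivity
  have hgf : ∀ x ∈ closedBall 0 1, ‖g x - f x‖ < ε / 3 := fun x hx => by
    simpa only [dist_eq_norm, hf'_eq x hx] using hgf x
  have hpos : 0 < 1 + ε / 3 := by positivity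
  obtain ⟨x, hx, hfix⟩ := exists_fixedPoint_of_contDiff (k := fun x => (1 + ε / 3)⁻¹ • g x)
    (hg.const_smul _) fun x hx => by
      rw [norm_smul, norm_inv, Real.norm_of_nonneg hpos.le, inv_mul_lt_iff₀ hpos, mul_one]
      linarith [norm_le_norm_add_norm_sub' (g x) (f x), hgf x hx,
        mem_closedBall_zero_iff.1 (hmaps hx)]
  have hgx : g x = (1 + ε / 3) • x := (inv_smul_eq_iff₀ hpos.ne').1 hfix
  refine ⟨x, hx, ?_⟩
  calc ‖f x - x‖ ≤ ‖g x - f x‖ + ‖g x - x‖ := by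
        rw [norm_sub_rev (g x)]
        exact norm_sub_le_norm_sub_add_norm_sub _ _ _
    _ ≤ ε / 3 + ε / 3 := by
        refine add_le_add (hgf x hx).le ?_
        rw [hgx, add_smul, one_smul, add_sub_cancel_left, norm_smul,
          Real.norm_of_nonneg (by positivity)]
        exact mul_le_of_le_one_right (by positivity) (mem_closedBall_zero_iff.1 hx)
    _ ≤ ε := by linarith

theorem exists_fixedPoint_of_mapsTo_closedBall [FiniteDimensional ℝ E] {f : E → E}
    (hf : ContinuousOn f (closedBall 0 1)) (hmaps : MapsTo f (closedBall 0 1) (closedBall 0 1)) :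
    ∃ x ∈ closedBall 0 1, f x = x := by
  obtain ⟨x₀, hx₀, hmin⟩ := (isCompact_closedBall (0 : E) 1).exists_isMinOn ⟨0, by simp⟩
    (hf.sub continuousOn_id).norm
  refine ⟨x₀, hx₀, sub_eq_zero.1 (norm_le_zero_iff.1 (le_of_forall_pos_le_add fun ε hε => ?_))⟩
  obtain ⟨x, hx, hle⟩ := exists_norm_sub_le_of_mapsTo_closedBall hf hmaps hε
  exact ((hmin hx).trans hle).trans_eq (zero_add ε).symm

theorem exists_zero_of_norm_sub_le [FiniteDimensional ℝ E] {Φ : E → E} {c : E} {R : ℝ}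
    (hR : 0 < R) (hΦ : ContinuousOn Φ (closedBall c R))
    (hclose : ∀ x ∈ closedBall c R, ‖Φ x - (x - c)‖ ≤ R) : ∃ x ∈ closedBall c R, Φ x = 0 := by
  have hmaps : MapsTo (fun u : E => c + R • u) (closedBall 0 1) (closedBall c R) := fun u hu => by
    rw [mem_closedBall_iff_norm, add_sub_cancel_left, norm_smul, Real.norm_of_nonneg hR.le]
    exact mul_le_of_le_one_right hR.le (mem_closedBall_zero_iff.1 hu)
  obtain ⟨u, hu, hfix⟩ := exists_fixedPoint_of_mapsTo_closedBall
    (f := fun u : E => u - R⁻¹ • Φ (c + R • u))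
    (continuousOn_id.sub ((hΦ.comp (by fun_prop) hmaps).const_smul R⁻¹)) fun u hu => by
      have hle := hclose _ (hmaps hu)
      have hrescale : u - R⁻¹ • Φ (c + R • u) = -(R⁻¹ • (Φ (c + R • u) - (c + R • u - c))) := by
        rw [add_sub_cancel_left, smul_sub, inv_smul_smul₀ hR.ne', neg_sub]
      change u - R⁻¹ • Φ (c + R • u) ∈ closedBall 0 1
      rw [mem_closedBall_zero_iff, hrescale, norm_neg, norm_smul, norm_inv,
        Real.norm_of_nonneg hR.le, inv_mul_le_iff₀ hR, mul_one]
      exact hle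
  exact ⟨_, hmaps hu, (smul_eq_zero.1 (sub_eq_self.1 hfix)).resolve_left (inv_ne_zero hR.ne')⟩

end FixedPoint

end Brouwer

/-! ## Differentiability in quadratic mean -/

/-- Bounded measurable real functions. They are stable under the algebraic operations and
integrable against every finite measure, whatever the value of the bound. -/
structure IsBoundedMeasurable {α : Type*} [MeasurableSpace α] (f : α → ℝ) : Prop where
  measurable : Measurable f
  exists_abs_le : ∃ K : ℝ, ∀ x, |f x| ≤ K

namespace IsBoundedMeasurable

variable {α β : Type*} [MeasurableSpace α] [MeasurableSpace β] {f g : α → ℝ}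

theorem of_abs_le (hf : Measurable f) {K : ℝ} (hK : ∀ x, |f x| ≤ K) : IsBoundedMeasurable f :=
  ⟨hf, K, hK⟩

theorem const (c : ℝ) : IsBoundedMeasurable fun _ : α => c :=
  ⟨measurable_const, |c|, fun _ => le_rfl⟩

theorem add (hf : IsBoundedMeasurable f) (hg : IsBoundedMeasurable g) :
    IsBoundedMeasurable fun x => f x + g x := by
  obtain ⟨K, hK⟩ := hf.exists_abs_le
  obtain ⟨L, hL⟩ := hg.exists_abs_le
  exact ⟨hf.measurable.add hg.measurable, K + L,
    fun x => (abs_add_le _ _).trans (add_le_add (hK x) (hL x))⟩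

theorem mul (hf : IsBoundedMeasurable f) (hg : IsBoundedMeasurable g) :
    IsBoundedMeasurable fun x => f x * g x := by
  obtain ⟨K, hK⟩ := hf.exists_abs_le
  obtain ⟨L, hL⟩ := hg.exists_abs_le
  refine ⟨hf.measurable.mul hg.measurable, K * L, fun x => ?_⟩
  rw [abs_mul]
  exact mul_le_mul (hK x) (hL x) (abs_nonneg _) ((abs_nonneg _).trans (hK x))

theorem const_mul (c : ℝ) (hf : IsBoundedMeasurable f) : IsBoundedMeasurable fun x => c * f x :=
  (const c).mul hf

theorem sub (hf : IsBoundedMeasurable f) (hg : IsBoundedMeasurable g) :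
    IsBoundedMeasurable fun x => f x - g x := by
  simpa only [neg_one_mul, ← sub_eq_add_neg] using hf.add (hg.const_mul (-1))

theorem sq (hf : IsBoundedMeasurable f) : IsBoundedMeasurable fun x => f x ^ 2 := by
  simpa only [pow_two] using hf.mul hf

theorem comp (hf : IsBoundedMeasurable f) {φ : β → α} (hφ : Measurable φ) :
    IsBoundedMeasurable fun y => f (φ y) :=
  ⟨hf.measurable.comp hφ, hf.exists_abs_le.imp fun _ hK y => hK (φ y)⟩

theorem ite (hf : IsBoundedMeasurable f) (hg : IsBoundedMeasurable g) {p : α → Prop}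
    [DecidablePred p] (hp : MeasurableSet {x | p x}) :
    IsBoundedMeasurable fun x => if p x then f x else g x := by
  obtain ⟨K, hK⟩ := hf.exists_abs_le
  obtain ⟨L, hL⟩ := hg.exists_abs_le
  refine ⟨.ite hp hf.measurable hg.measurable, max K L, fun x => ?_⟩
  split_ifs
  exacts [(hK x).trans (le_max_left _ _), (hL x).trans (le_max_right _ _)]

theorem inv_of_le {κ : ℝ} (hκ : 0 < κ) (hf : Measurable f) (hκf : ∀ x, κ ≤ f x) :
    IsBoundedMeasurable fun x => (f x)⁻¹ := by
  refine ⟨hf.inv, κ⁻¹, fun x => ?_⟩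
  rw [abs_of_nonneg (inv_nonneg.2 (hκ.le.trans (hκf x)))]
  exact inv_anti₀ hκ (hκf x)

theorem memLp (hf : IsBoundedMeasurable f) (p : ENNReal) (μ : Measure α) [IsFiniteMeasure μ] :
    MemLp f p μ := by
  obtain ⟨K, hK⟩ := hf.exists_abs_le
  exact .of_bound hf.measurable.aestronglyMeasurable K (.of_forall hK)

theorem integrable (hf : IsBoundedMeasurable f) (μ : Measure α) [IsFiniteMeasure μ] :
    Integrable f μ :=
  memLp_one_iff_integrable.1 (hf.memLp 1 μ)

end IsBoundedMeasurable

namespace Semiparametric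

variable {Θ Z : Type*} [MeasurableSpace Z]

section RootDensity

variable {ν : Measure Z} {f g h u v D q s : Z → ℝ}

theorem sq_integral_mul_le (hf : MemLp f 2 ν) (hg : MemLp g 2 ν) :
    (∫ z, f z * g z ∂ν) ^ 2 ≤ (∫ z, f z ^ 2 ∂ν) * ∫ z, g z ^ 2 ∂ν := by
  have hinner {f g : Z → ℝ} (hf : MemLp f 2 ν) (hg : MemLp g 2 ν) :
      inner ℝ (hf.toLp f) (hg.toLp g) = ∫ z, f z * g z ∂ν := by
    rw [L2.inner_def]
    refine integral_congr_ae ?_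
    filter_upwards [hf.coeFn_toLp, hg.coeFn_toLp] with z hfz hgz
    rw [hfz, hgz]
    exact mul_comm _ _
  have hcs := real_inner_mul_inner_self_le (hf.toLp f) (hg.toLp g)
  rw [hinner, hinner, hinner] at hcs
  simpa only [sq] using hcs

theorem integral_sq_add_le (hf : MemLp f 2 ν) (hg : MemLp g 2 ν) :
    ∫ z, (f z + g z) ^ 2 ∂ν ≤ 2 * (∫ z, f z ^ 2 ∂ν + ∫ z, g z ^ 2 ∂ν) := by
  rw [← integral_add hf.integrable_sq hg.integrable_sq, ← integral_const_mul]
  exact integral_mono (hf.add hg).integrable_sq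
    ((hf.integrable_sq.add hg.integrable_sq).const_mul 2) fun z => add_sq_le

theorem sq_integral_mul_sq_sub_le (hu : MemLp u 2 ν) (hv : MemLp v 2 ν)
    (hgu : MemLp (fun z => g z * u z) 2 ν) (hgv : MemLp (fun z => g z * v z) 2 ν) :
    (∫ z, g z * u z ^ 2 ∂ν - ∫ z, g z * v z ^ 2 ∂ν) ^ 2 ≤
      2 * (∫ z, (u z - v z) ^ 2 ∂ν) *
        (∫ z, g z ^ 2 * u z ^ 2 ∂ν + ∫ z, g z ^ 2 * v z ^ 2 ∂ν) := by
  have hfactor : ∫ z, g z * u z ^ 2 ∂ν - ∫ z, g z * v z ^ 2 ∂ν =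
      ∫ z, (u z - v z) * (g z * u z + g z * v z) ∂ν := by
    rw [← integral_sub]
    · exact integral_congr_ae (.of_forall fun z => by ring)
    · exact (hgu.integrable_mul hu).congr (.of_forall fun z => by simp only [Pi.mul_apply]; ring)
    · exact (hgv.integrable_mul hv).congr (.of_forall fun z => by simp only [Pi.mul_apply]; ring)
  calc (∫ z, g z * u z ^ 2 ∂ν - ∫ z, g z * v z ^ 2 ∂ν) ^ 2
      ≤ (∫ z, (u z - v z) ^ 2 ∂ν) * ∫ z, (g z * u z + g z * v z) ^ 2 ∂ν := by
        rw [hfactor]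
        exact sq_integral_mul_le (hu.sub hv) (hgu.add hgv)
    _ ≤ _ := by
        rw [mul_comm 2, mul_assoc]
        simp only [← mul_pow]
        exact mul_le_mul_of_nonneg_left (integral_sq_add_le hgu hgv)
          (integral_nonneg fun z => sq_nonneg _)

theorem memLp_bdd_mul (hg : IsBoundedMeasurable g) (hv : MemLp v 2 ν) :
    MemLp (fun z => g z * v z) 2 ν := by
  obtain ⟨K, hK⟩ := hg.exists_abs_le
  exact hv.mul' (memLp_top_of_bound hg.measurable.aestronglyMeasurable K (.of_forall hK))

theorem integral_mul_sq_sub_eq {t : ℝ} (hv : MemLp v 2 ν) (hh : MemLp h 2 ν) (hD : MemLp D 2 ν)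
    (hu : ∀ z, u z = v z + t * (D z + h z / 2)) (hg : IsBoundedMeasurable g) :
    ∫ z, g z * u z ^ 2 ∂ν - ∫ z, g z * v z ^ 2 ∂ν - t * ∫ z, g z * (v z * h z) ∂ν =
      2 * t * ∫ z, D z * (g z * v z) ∂ν + t ^ 2 * ∫ z, g z * (D z + h z / 2) ^ 2 ∂ν := by
  have hR : MemLp (fun z => D z + h z / 2) 2 ν :=
    hD.add (by simpa only [div_eq_inv_mul] using hh.const_mul 2⁻¹)
  have hbdd {f : Z → ℝ} (hf : Integrable f ν) : Integrable (fun z => g z * f z) ν := by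
    obtain ⟨K, hK⟩ := hg.exists_abs_le
    exact hf.bdd_mul hg.measurable.aestronglyMeasurable (.of_forall hK)
  have hgu2 : Integrable (fun z => g z * u z ^ 2) ν := by
    simpa only [hu, Pi.add_apply] using hbdd (hv.add (hR.const_mul t)).integrable_sq
  have hgv2 : Integrable (fun z => g z * v z ^ 2) ν := hbdd hv.integrable_sq
  have hgvh : Integrable (fun z => g z * (v z * h z)) ν := hbdd (hv.integrable_mul hh)
  have hDgv : Integrable (fun z => D z * (g z * v z)) ν := hD.integrable_mul (memLp_bdd_mul hg hv)
  have hgR : Integrable (fun z => g z * (D z + h z / 2) ^ 2) ν := hbdd hR.integrable_sq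
  have hdiff : Integrable (fun z => g z * u z ^ 2 - g z * v z ^ 2) ν := hgu2.sub hgv2
  rw [← integral_const_mul, ← integral_const_mul, ← integral_const_mul, ← integral_sub hgu2 hgv2,
    ← integral_sub hdiff (hgvh.const_mul t),
    ← integral_add (hDgv.const_mul _) (hgR.const_mul _)]
  refine integral_congr_ae (.of_forall fun z => ?_)
  simp only [hu]
  ring

theorem abs_integral_mul_sq_sub_le {t K : ℝ} (hv : MemLp v 2 ν) (hh : MemLp h 2 ν)
    (hD : MemLp D 2 ν) (hu : ∀ z, u z = v z + t * (D z + h z / 2)) (hg : Measurable g)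
    (hK0 : 0 ≤ K) (hK : ∀ z, |g z| ≤ K) :
    |∫ z, g z * u z ^ 2 ∂ν - ∫ z, g z * v z ^ 2 ∂ν - t * ∫ z, g z * (v z * h z) ∂ν| ≤
      K * (|t| * (2 * √((∫ z, D z ^ 2 ∂ν) * ∫ z, v z ^ 2 ∂ν) +
        |t| * ∫ z, (D z + h z / 2) ^ 2 ∂ν)) := by
  have hgb : IsBoundedMeasurable g := .of_abs_le hg hK
  have hR : MemLp (fun z => D z + h z / 2) 2 ν :=
    hD.add (by simpa only [div_eq_inv_mul] using hh.const_mul 2⁻¹)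
  have hgv : MemLp (fun z => g z * v z) 2 ν := memLp_bdd_mul hgb hv
  have hcross : |∫ z, D z * (g z * v z) ∂ν| ≤ K * √((∫ z, D z ^ 2 ∂ν) * ∫ z, v z ^ 2 ∂ν) := by
    rw [← Real.sqrt_sq hK0, ← Real.sqrt_mul (sq_nonneg K), mul_left_comm, ← integral_const_mul]
    refine Real.abs_le_sqrt ((sq_integral_mul_le hD hgv).trans ?_)
    refine mul_le_mul_of_nonneg_left
      (integral_mono hgv.integrable_sq (hv.integrable_sq.const_mul _) fun z => ?_)
      (integral_nonneg fun z => sq_nonneg _)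
    exact (mul_pow _ _ 2).trans_le (mul_le_mul_of_nonneg_right
      (sq_le_sq' (neg_le_of_abs_le (hK z)) (le_of_abs_le (hK z))) (sq_nonneg _))
  have hsq : |∫ z, g z * (D z + h z / 2) ^ 2 ∂ν| ≤ K * ∫ z, (D z + h z / 2) ^ 2 ∂ν := by
    rw [← integral_const_mul, ← Real.norm_eq_abs]
    refine norm_integral_le_of_norm_le (hR.integrable_sq.const_mul K) (.of_forall fun z => ?_)
    rw [norm_mul, Real.norm_of_nonneg (sq_nonneg _)]
    exact mul_le_mul_of_nonneg_right (hK z) (sq_nonneg _)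
  rw [integral_mul_sq_sub_eq hv hh hD hu hgb]
  refine (abs_add_le _ _).trans ?_
  rw [abs_mul, abs_mul, abs_mul, abs_two, abs_pow]
  nlinarith [mul_le_mul_of_nonneg_left hcross (abs_nonneg t),
    mul_le_mul_of_nonneg_left hsq (sq_nonneg |t|)]

theorem integral_withDensity_ofReal (hq : Measurable q) (hq0 : ∀ z, 0 ≤ q z) (g : Z → ℝ) :
    ∫ z, g z ∂(ν.withDensity fun z => ENNReal.ofReal (q z)) = ∫ z, g z * √(q z) ^ 2 ∂ν := by
  rw [integral_withDensity_eq_integral_toReal_smul hq.ennreal_ofReal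
    (.of_forall fun z => ENNReal.ofReal_lt_top)]
  refine integral_congr_ae (.of_forall fun z => ?_)
  simp only [ENNReal.toReal_ofReal (hq0 z), Real.sq_sqrt (hq0 z), smul_eq_mul, mul_comm]

theorem memLp_mul_sqrt (hq : Measurable q) (hq0 : ∀ z, 0 ≤ q z)
    (hs : MemLp s 2 (ν.withDensity fun z => ENNReal.ofReal (q z))) :
    MemLp (fun z => s z * √(q z)) 2 ν := by
  have hmeas : AEStronglyMeasurable (fun z => s z * √(q z)) ν := by
    have hqs : AEMeasurable (fun z => ((q z).toNNReal : ℝ) • s z * (√(q z))⁻¹) ν :=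
      ((aemeasurable_withDensity_iff hq.real_toNNReal).1 hs.1.aemeasurable).mul
        hq.sqrt.inv.aemeasurable
    refine (hqs.congr (.of_forall fun z => ?_)).aestronglyMeasurable
    simp only [Real.coe_toNNReal _ (hq0 z), smul_eq_mul]
    rw [mul_comm (q z), mul_assoc, ← div_eq_mul_inv, Real.div_sqrt]
  rw [memLp_two_iff_integrable_sq hmeas]
  refine ((integrable_withDensity_iff_integrable_smul' hq.ennreal_ofReal
    (.of_forall fun z => ENNReal.ofReal_lt_top)).1 hs.integrable_sq).congr (.of_forall fun z => ?_)
  simp only [ENNReal.toReal_ofReal (hq0 z), smul_eq_mul, mul_pow, Real.sq_sqrt (hq0 z), mul_comm]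

theorem integrable_sq_of_lintegral_ne_top (hf : AEStronglyMeasurable f ν)
    (hfin : ∫⁻ z, ENNReal.ofReal (f z ^ 2) ∂ν ≠ ⊤) : Integrable (fun z => f z ^ 2) ν := by
  refine ⟨hf.pow 2, ?_⟩
  rw [hasFiniteIntegral_iff_ofReal (.of_forall fun z => sq_nonneg _)]
  exact hfin.lt_top

end RootDensity

/-- `P` and `Q` are as close on bounded test functions as measures whose squared Hellinger distance
is of order `c`; this consequence is all that is needed of the distance. -/
def HellingerLe (P Q : Measure Z) (c : ℝ) : Prop :=
  ∀ g : Z → ℝ, IsBoundedMeasurable g →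
    (∫ z, g z ∂P - ∫ z, g z ∂Q) ^ 2 ≤ c * (∫ z, g z ^ 2 ∂P + ∫ z, g z ^ 2 ∂Q)

/-- A test function `g` that vanishes in `Q`-mean estimates the `P`-mean of `e` at the squared
rate: `(E_P e)² = (E_P g - E_Q g)²` is at most `c` times quantities of the order of `E_P e`. -/
theorem HellingerLe.integral_le {P Q : Measure Z} [IsFiniteMeasure P] [IsFiniteMeasure Q]
    {c k : ℝ} (h : HellingerLe P Q c) (hc : 0 ≤ c) {g e : Z → ℝ} (hg : IsBoundedMeasurable g)
    (he : IsBoundedMeasurable e) (he0 : ∀ z, 0 ≤ e z) (hgP : ∫ z, g z ∂P = ∫ z, e z ∂P)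
    (hgQ : ∫ z, g z ∂Q = 0) (hge : ∀ z, g z ^ 2 ≤ k * e z) (hek : ∀ z, e z ≤ k) (hk : 0 ≤ k) :
    ∫ z, e z ∂P ≤ 10 * c * k := by
  have hsum {f : Z → ℝ} (hf : IsBoundedMeasurable f) (hfe : ∀ z, f z ^ 2 ≤ k * e z) :
      ∫ z, f z ^ 2 ∂P + ∫ z, f z ^ 2 ∂Q ≤ k * (∫ z, e z ∂P + ∫ z, e z ∂Q) := by
    rw [mul_add, ← integral_const_mul, ← integral_const_mul]
    exact add_le_add (integral_mono (hf.sq.integrable P) ((he.integrable P).const_mul k) hfe)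
      (integral_mono (hf.sq.integrable Q) ((he.integrable Q).const_mul k) hfe)
  have hee (z : Z) : e z ^ 2 ≤ k * e z := by
    rw [sq]
    exact mul_le_mul_of_nonneg_right (hek z) (he0 z)
  have hgbound := (h g hg).trans (mul_le_mul_of_nonneg_left (hsum hg hge) hc)
  have hebound := (h e he).trans (mul_le_mul_of_nonneg_left (hsum he hee) hc)
  rw [hgP, hgQ, sub_zero] at hgbound
  have hP : 0 ≤ ∫ z, e z ∂P := integral_nonneg he0
  have hQ : 0 ≤ ∫ z, e z ∂Q := integral_nonneg he0
  set A := ∫ z, e z ∂P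
  set B := ∫ z, e z ∂Q
  have hquad : (A + B) * (A + B) ≤ 10 * c * k * (A + B) := by
    nlinarith [sq_nonneg (A + A + (A - B))]
  rcases (add_nonneg hP hQ).eq_or_lt with hzero | hpos
  · linarith [show 0 ≤ 10 * c * k by positivity]
  · linarith [le_of_mul_le_mul_right hquad hpos]

namespace IsRegularSubmodel

variable {obs : Θ → Measure Z} {𝓜 : Set Θ} {θ₀ : Θ} {path : ℝ → Θ} {s : Z → ℝ}

/-- The root densities `ξ t` of the observed laws are the useful coordinates: they lie in `L²`,
where `D t` is the remainder of the first order expansion of `ξ t` at `t = 0`. -/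
theorem exists_rootDensity [IsFiniteMeasure (obs θ₀)] (h : IsRegularSubmodel obs 𝓜 θ₀ path s) :
    ∃ (ν : Measure Z) (ξ D : ℝ → Z → ℝ), MemLp (ξ 0) 2 ν ∧ MemLp (fun z => s z * ξ 0 z) 2 ν ∧
      (∀ g : Z → ℝ, ∫ z, g z ∂(obs θ₀) = ∫ z, g z * ξ 0 z ^ 2 ∂ν) ∧
      Tendsto (fun t => ∫ z, D t z ^ 2 ∂ν) (𝓝[≠] 0) (𝓝 0) ∧
      ∀ᶠ t in 𝓝[≠] (0 : ℝ), MemLp (D t) 2 ν ∧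
        (∀ z, ξ t z = ξ 0 z + t * (D t z + s z * ξ 0 z / 2)) ∧
        ∀ g : Z → ℝ, ∫ z, g z ∂(obs (path t)) = ∫ z, g z * ξ t z ^ 2 ∂ν := by
  obtain ⟨ν, q, -, hqm, hq0, hobsq, hlim⟩ := h.qmd
  have hobs0 := hobsq.self_of_nhds
  rw [h.base] at hobs0
  have hs : MemLp s 2 (ν.withDensity fun z => ENNReal.ofReal (q 0 z)) := hobs0 ▸ h.memLp
  have hone : MemLp (fun _ => (1 : ℝ)) 2 (ν.withDensity fun z => ENNReal.ofReal (q 0 z)) :=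
    hobs0 ▸ memLp_const 1
  have hsξ := memLp_mul_sqrt (hqm 0) (hq0 0) hs
  let D : ℝ → Z → ℝ := fun t z => (√(q t z) - √(q 0 z)) / t - s z / 2 * √(q 0 z)
  have hD (t : ℝ) : AEStronglyMeasurable (D t) ν := by
    have hdiff : Measurable fun z => (√(q t z) - √(q 0 z)) / t :=
      ((hqm t).sqrt.sub (hqm 0).sqrt).div_const t
    refine (hdiff.aestronglyMeasurable.sub (hsξ.1.const_mul 2⁻¹)).congr (.of_forall fun z => ?_)
    simp only [D, Pi.sub_apply]
    ring
  refine ⟨ν, fun t z => √(q t z), D, by simpa using memLp_mul_sqrt (hqm 0) (hq0 0) hone, hsξ,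
    fun g => by rw [hobs0, integral_withDensity_ofReal (hqm 0) (hq0 0)], ?_, ?_⟩
  · refine ((ENNReal.tendsto_toReal ENNReal.zero_ne_top).comp hlim).congr fun t => ?_
    exact (integral_eq_lintegral_of_nonneg_ae (.of_forall fun z => sq_nonneg _)
      ((hD t).pow 2)).symm
  · filter_upwards [hlim.eventually (gt_mem_nhds ENNReal.zero_lt_top),
      hobsq.filter_mono nhdsWithin_le_nhds, self_mem_nhdsWithin] with t hfin hobst ht0
    have ht : t ≠ 0 := ht0
    refine ⟨(memLp_two_iff_integrable_sq (hD t)).2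
      (integrable_sq_of_lintegral_ne_top (hD t) hfin.ne), fun z => ?_,
      fun g => by rw [hobst, integral_withDensity_ofReal (hqm t) (hq0 t)]⟩
    simp only [D]
    field_simp
    ring

theorem exists_abs_integral_sub_le [IsFiniteMeasure (obs θ₀)]
    (h : IsRegularSubmodel obs 𝓜 θ₀ path s) :
    ∃ ρ : ℝ → ℝ, Tendsto ρ (𝓝[≠] 0) (𝓝 0) ∧ ∀ᶠ t in 𝓝[≠] (0 : ℝ), ∀ (g : Z → ℝ) (K : ℝ),
      Measurable g → 0 ≤ K → (∀ z, |g z| ≤ K) →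
        |∫ z, g z ∂(obs (path t)) - ∫ z, g z ∂(obs θ₀) - t * ∫ z, g z * s z ∂(obs θ₀)| ≤
          K * (|t| * ρ t) := by
  obtain ⟨ν, ξ, D, hξ, hsξ, hobs₀, hDlim, hev⟩ := h.exists_rootDensity
  have hsξ2 : MemLp (fun z => s z * ξ 0 z / 2) 2 ν := by
    simpa only [div_eq_inv_mul] using hsξ.const_mul 2⁻¹
  refine ⟨fun t => 2 * √((∫ z, D t z ^ 2 ∂ν) * ∫ z, ξ 0 z ^ 2 ∂ν) +
    |t| * (2 * (∫ z, D t z ^ 2 ∂ν + ∫ z, (s z * ξ 0 z / 2) ^ 2 ∂ν)), ?_, ?_⟩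
  · have habs : Tendsto (fun t : ℝ => |t|) (𝓝[≠] 0) (𝓝 0) := by
      simpa using (continuous_abs.tendsto (0 : ℝ)).mono_left nhdsWithin_le_nhds
    simpa using ((hDlim.mul_const _).sqrt.const_mul 2).add
      (habs.mul ((hDlim.add_const _).const_mul 2))
  · filter_upwards [hev] with t ⟨hD, hξt, hobs⟩ g K hg hK0 hK
    have hscore : ∫ z, g z * s z ∂(obs θ₀) = ∫ z, g z * (ξ 0 z * (s z * ξ 0 z)) ∂ν := by
      rw [hobs₀]
      exact integral_congr_ae (.of_forall fun z => by ring)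
    rw [hobs, hobs₀ g, hscore]
    refine (abs_integral_mul_sq_sub_le hξ hsξ hD hξt hg hK0 hK).trans ?_
    gcongr
    exact integral_sq_add_le hD hsξ2

theorem exists_hellingerLe [IsFiniteMeasure (obs θ₀)]
    (h : IsRegularSubmodel obs 𝓜 θ₀ path s) :
    ∃ C : ℝ, 0 ≤ C ∧ ∀ᶠ t in 𝓝[≠] (0 : ℝ), HellingerLe (obs (path t)) (obs θ₀) (C * t ^ 2) := by
  obtain ⟨ν, ξ, D, hξ, hsξ, hobs₀, hDlim, hev⟩ := h.exists_rootDensity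
  have hsξ2 : MemLp (fun z => s z * ξ 0 z / 2) 2 ν := by
    simpa only [div_eq_inv_mul] using hsξ.const_mul 2⁻¹
  refine ⟨2 * (2 * (1 + ∫ z, (s z * ξ 0 z / 2) ^ 2 ∂ν)), by positivity, ?_⟩
  filter_upwards [hev, hDlim.eventually (gt_mem_nhds one_pos)] with t ⟨hD, hξt, hobs⟩ hD1 g hg
  have hξtL : MemLp (ξ t) 2 ν := funext hξt ▸ hξ.add ((hD.add hsξ2).const_mul t)
  have hdist : ∫ z, (ξ t z - ξ 0 z) ^ 2 ∂ν ≤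
      t ^ 2 * (2 * (1 + ∫ z, (s z * ξ 0 z / 2) ^ 2 ∂ν)) := by
    calc ∫ z, (ξ t z - ξ 0 z) ^ 2 ∂ν = t ^ 2 * ∫ z, (D t z + s z * ξ 0 z / 2) ^ 2 ∂ν := by
          simp only [hξt, add_sub_cancel_left, mul_pow, integral_const_mul]
      _ ≤ _ := by
          gcongr
          refine (integral_sq_add_le hD hsξ2).trans ?_
          gcongr
  rw [hobs, hobs, hobs₀, hobs₀]
  refine (sq_integral_mul_sq_sub_le hξtL hξ (memLp_bdd_mul hg hξtL)
    (memLp_bdd_mul hg hξ)).trans ?_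
  rw [mul_assoc 2 _ (t ^ 2), mul_comm _ (t ^ 2)]
  gcongr

theorem integral_score [IsFiniteMeasure (obs θ₀)] (hobs : ∀ t, IsProbabilityMeasure (obs (path t)))
    (h : IsRegularSubmodel obs 𝓜 θ₀ path s) : ∫ z, s z ∂(obs θ₀) = 0 := by
  obtain ⟨ρ, hρ, hexp⟩ := h.exists_abs_integral_sub_le
  have hmass : (obs θ₀).real Set.univ = 1 := by
    have := hobs 0
    rw [← h.base, probReal_univ]
  refine abs_nonpos_iff.1 (ge_of_tendsto hρ ?_)
  filter_upwards [hexp, self_mem_nhdsWithin] with t ht ht0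
  have hle := ht (fun _ => 1) 1 measurable_const zero_le_one (by simp)
  simp only [integral_const, probReal_univ, hmass, smul_eq_mul, mul_one, sub_self, zero_sub,
    one_mul, abs_neg, abs_mul] at hle
  exact le_of_mul_le_mul_left hle (abs_pos.2 ht0)

theorem congr_score {s' : Z → ℝ} (h : IsRegularSubmodel obs 𝓜 θ₀ path s)
    (hs : s =ᵐ[obs θ₀] s') : IsRegularSubmodel obs 𝓜 θ₀ path s' := by
  obtain ⟨ν, q, hν, hqm, hq0, hobsq, hlim⟩ := h.qmd
  refine ⟨h.base, h.mem, (memLp_congr_ae hs).1 h.memLp, ν, q, hν, hqm, hq0, hobsq,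
    hlim.congr fun t => lintegral_congr_ae ?_⟩
  rw [← h.base, hobsq.self_of_nhds, EventuallyEq,
    ae_withDensity_iff (hqm 0).ennreal_ofReal] at hs
  filter_upwards [hs] with z hz
  rcases (hq0 0 z).eq_or_lt with hqz | hqz
  · rw [← hqz, Real.sqrt_zero, mul_zero, mul_zero]
  · rw [hz (ENNReal.ofReal_pos.2 hqz).ne']

end IsRegularSubmodel

theorem abs_sqrt_one_add_sub_le {x : ℝ} (hx : 0 ≤ 1 + x) : |√(1 + x) - 1 - x / 2| ≤ x ^ 2 / 2 := by
  have hsq := Real.sq_sqrt hx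
  have hdefect : √(1 + x) - 1 - x / 2 = -((√(1 + x) - 1) ^ 2 / 2) := by
    linear_combination (1 / 2) * hsq
  have hfactor : x ^ 2 = (√(1 + x) - 1) ^ 2 * (√(1 + x) + 1) ^ 2 := by
    linear_combination -(√(1 + x) ^ 2 - 1 + x) * hsq
  rw [hdefect, abs_neg, abs_of_nonneg (by positivity), hfactor]
  nlinarith [sq_nonneg (√(1 + x) - 1), Real.sqrt_nonneg (1 + x)]

theorem abs_sqrt_one_add_div_sub_le {a r t K : ℝ} (ha : |a| ≤ K) (hr : |r| ≤ K) (ht0 : t ≠ 0)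
    (ht1 : |t| ≤ 1) (htK : |t| * (2 * K) ≤ 1) :
    |(√(1 + (t * a + t ^ 2 * r)) - 1) / t - a / 2| ≤ |t| * (K / 2 + 2 * K ^ 2) := by
  set x := t * a + t ^ 2 * r with hx
  have hxle : |x| ≤ |t| * (2 * K) := by
    have hx' : x = t * (a + t * r) := by rw [hx]; ring
    rw [hx', abs_mul]
    gcongr
    refine (abs_add_le _ _).trans ?_
    rw [abs_mul]
    nlinarith [abs_nonneg r]
  have hx1 : 0 ≤ 1 + x := by linarith [neg_abs_le x]
  have hsplit : (√(1 + x) - 1) / t - a / 2 = (√(1 + x) - 1 - x / 2) / t + t * r / 2 := by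
    rw [hx]
    field_simp
    ring
  calc |(√(1 + x) - 1) / t - a / 2| ≤ x ^ 2 / 2 / |t| + |t| * |r| / 2 := by
        rw [hsplit]
        refine (abs_add_le _ _).trans ?_
        rw [abs_div, abs_div, abs_mul, abs_two]
        gcongr
        exact abs_sqrt_one_add_sub_le hx1
    _ ≤ (|t| * (2 * K)) ^ 2 / 2 / |t| + |t| * K / 2 := by
        rw [← sq_abs x]
        gcongr
    _ = |t| * (K / 2 + 2 * K ^ 2) := by
        field_simp
        ring

theorem IsRegularSubmodel.of_density {obs : Θ → Measure Z} {𝓜 : Set Θ} {θ₀ : Θ} {path : ℝ → Θ}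
    [IsFiniteMeasure (obs θ₀)] (hbase : path 0 = θ₀) (hmem : ∀ᶠ t in 𝓝 (0 : ℝ), path t ∈ 𝓜)
    {a r : Z → ℝ} (ha : IsBoundedMeasurable a) (hr : IsBoundedMeasurable r)
    (hdens : ∀ᶠ t in 𝓝 (0 : ℝ), obs (path t) =
      (obs θ₀).withDensity fun z => ENNReal.ofReal (1 + (t * a z + t ^ 2 * r z))) :
    IsRegularSubmodel obs 𝓜 θ₀ path a := by
  obtain ⟨Ka, hKa⟩ := ha.exists_abs_le
  obtain ⟨Kr, hKr⟩ := hr.exists_abs_le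
  let K := max Ka Kr
  have haK : ∀ z, |a z| ≤ K := fun z => (hKa z).trans (le_max_left _ _)
  have hrK : ∀ z, |r z| ≤ K := fun z => (hKr z).trans (le_max_right _ _)
  refine ⟨hbase, hmem, ha.memLp 2 _, obs θ₀,
    fun t z => max (1 + (t * a z + t ^ 2 * r z)) 0, inferInstance, fun t => (measurable_const.add
      ((ha.measurable.const_mul t).add (hr.measurable.const_mul _))).max measurable_const,
    fun t z => le_max_right _ _, ?_, ?_⟩
  · filter_upwards [hdens] with t ht
    simp only [ht, ENNReal.ofReal_max, ENNReal.ofReal_zero, max_eq_left zero_le]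
  · let c : ℝ := K / 2 + 2 * K ^ 2
    have hlim : Tendsto (fun t : ℝ => ENNReal.ofReal ((|t| * c) ^ 2) * obs θ₀ Set.univ)
        (𝓝[≠] 0) (𝓝 0) := by
      have hcont : Continuous fun t : ℝ => ENNReal.ofReal ((|t| * c) ^ 2) * obs θ₀ Set.univ :=
        (ENNReal.continuous_mul_const (measure_ne_top _ _)).comp
          (ENNReal.continuous_ofReal.comp (by fun_prop))
      simpa using (hcont.tendsto 0).mono_left nhdsWithin_le_nhds
    have hsmall : ∀ᶠ t in 𝓝[≠] (0 : ℝ), |t| ≤ 1 ∧ |t| * (2 * K) ≤ 1 := by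
      refine Filter.Eventually.filter_mono nhdsWithin_le_nhds (.and ?_ ?_)
      · exact (continuous_abs.tendsto (0 : ℝ)).eventually (ge_mem_nhds (by simp))
      · exact ((continuous_abs.mul continuous_const).tendsto (0 : ℝ)).eventually
          (ge_mem_nhds (by simp))
    refine tendsto_of_tendsto_of_tendsto_of_le_of_le' tendsto_const_nhds hlim
      (.of_forall fun _ => zero_le) ?_
    filter_upwards [hsmall, self_mem_nhdsWithin] with t ⟨ht1, htK⟩ ht0
    rw [← lintegral_const]
    refine lintegral_mono fun z => ?_
    have hle := abs_sqrt_one_add_div_sub_le (haK z) (hrK z) ht0 ht1 htK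
    have hsqrt (y : ℝ) : √(max y 0) = √y := by
      rcases le_total 0 y with hy | hy
      · rw [max_eq_left hy]
      · rw [max_eq_right hy, Real.sqrt_zero, Real.sqrt_eq_zero_of_nonpos hy]
    simp only [hsqrt, zero_mul, zero_pow two_ne_zero, add_zero, Real.sqrt_one, mul_one]
    exact ENNReal.ofReal_le_ofReal (sq_le_sq' (neg_le_of_abs_le hle) (le_of_abs_le hle))

/-- The bound is attained by the submodel whose score is `ψ`. If `ψ = 0` its Cramér–Rao bound is
not in the family, and any submodel with positive information attains the value `0` instead. -/
theorem IsRegularSubmodel.isEfficiencyBound {obs : Θ → Measure Z} {𝓜 : Set Θ} {τ : Θ → ℝ} {θ₀ : Θ}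
    {path : ℝ → Θ} {ψ : Z → ℝ} (hψ : IsRegularSubmodel obs 𝓜 θ₀ path ψ)
    (hderiv : ∀ (path : ℝ → Θ) (s : Z → ℝ), IsRegularSubmodel obs 𝓜 θ₀ path s →
      HasDerivAt (fun t => τ (path t)) (∫ z, ψ z * s z ∂(obs θ₀)) 0)
    (hinfo : ∃ (path : ℝ → Θ) (s : Z → ℝ), IsRegularSubmodel obs 𝓜 θ₀ path s ∧
      0 < ∫ z, s z ^ 2 ∂(obs θ₀)) :
    IsEfficiencyBound obs 𝓜 τ θ₀ (∫ z, ψ z ^ 2 ∂(obs θ₀)) := by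
  have htoLp : hψ.memLp.toLp ψ =ᵐ[obs θ₀] ψ := hψ.memLp.coeFn_toLp
  refine ⟨⟨hψ.memLp.toLp ψ, ⟨?_, fun path s h => ?_⟩, ?_⟩, ?_, fun u hu => ?_⟩
  · exact Submodule.le_topologicalClosure _
      (Submodule.subset_span ⟨path, hψ.congr_score htoLp.symm⟩)
  · convert hderiv path s h using 1
    exact integral_congr_ae (by filter_upwards [htoLp] with z hz; rw [hz])
  · exact integral_congr_ae (by filter_upwards [htoLp] with z hz; rw [hz])
  · rintro v ⟨path, s, τ', h, hτ', hpos, rfl⟩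
    rw [hτ'.unique (hderiv path s h), div_le_iff₀ hpos]
    exact sq_integral_mul_le hψ.memLp h.memLp
  · have hnonneg : 0 ≤ ∫ z, ψ z ^ 2 ∂(obs θ₀) := integral_nonneg fun z => sq_nonneg _
    rcases hnonneg.eq_or_lt with hzero | hpos
    · obtain ⟨path', s, h, hs⟩ := hinfo
      rw [← hzero]
      exact (div_nonneg (sq_nonneg _) hs.le).trans (hu ⟨path', s, _, h, hderiv _ _ h, hs, rfl⟩)
    · refine hu ⟨path, ψ, _, hψ, hderiv _ _ hψ, hpos, ?_⟩
      simp only [← sq]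
      rw [eq_div_iff hpos.ne', sq]

end Semiparametric

/-! ## Integrals with respect to the laws of a population -/

namespace Population

variable {𝓑 𝓧 : Type*} [MeasurableSpace 𝓑] [MeasurableSpace 𝓧]

instance (F : Population 𝓑 𝓧) : IsProbabilityMeasure F.cov := F.isProbabilityMeasure_cov

instance (F : Population 𝓑 𝓧) : IsMarkovKernel F.bid := F.isMarkovKernel_bid

theorem treatment_singleton (F : Population 𝓑 𝓧) (x : 𝓧) (w : Bool) :
    F.treatment x {w} = ENNReal.ofReal (F.armProb w x) := by
  change (ENNReal.ofReal (F.prop x) • Measure.dirac true +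
    ENNReal.ofReal (1 - F.prop x) • Measure.dirac false : Measure Bool) {w} = _
  cases w <;> simp [armProb]

section ArmProb

variable (F : Population 𝓑 𝓧) (w : Bool)

theorem armProb_pos (x : 𝓧) : 0 < F.armProb w x := by
  cases w
  · simpa [armProb] using F.prop_lt_one x
  · simpa [armProb] using F.prop_pos x

theorem armProb_lt_one (x : 𝓧) : F.armProb w x < 1 := by
  cases w
  · simpa [armProb] using F.prop_pos x
  · simpa [armProb] using F.prop_lt_one x

theorem isBoundedMeasurable_armProb : IsBoundedMeasurable (F.armProb w) := by
  have hmeas : Measurable (F.armProb w) := by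
    cases w
    exacts [measurable_const.sub F.measurable_prop, F.measurable_prop]
  refine .of_abs_le (K := 1) hmeas fun x => ?_
  rw [abs_of_pos (F.armProb_pos w x)]
  exact (F.armProb_lt_one w x).le

end ArmProb

instance (F : Population 𝓑 𝓧) : IsMarkovKernel F.treatment where
  isProbabilityMeasure x := by
    refine ⟨?_⟩
    rw [← lintegral_one, lintegral_fintype]
    simp only [Fintype.sum_bool, treatment_singleton, one_mul]
    rw [← ENNReal.ofReal_add (F.armProb_pos _ x).le (F.armProb_pos _ x).le]
    simp [armProb]

instance (F : Population 𝓑 𝓧) : IsProbabilityMeasure F.fullLaw :=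
  inferInstanceAs (IsProbabilityMeasure (F.cov.compProd (F.bid.prod F.treatment)))

instance (F : Population 𝓑 𝓧) : IsProbabilityMeasure F.obsLaw :=
  Measure.isProbabilityMeasure_map measurable_observe.aemeasurable

instance (F : Population 𝓑 𝓧) (w : Bool) : IsProbabilityMeasure (F.potLaw w) :=
  Measure.isProbabilityMeasure_map (measurable_pi_apply w).aemeasurable

/-- `E[h(B(w)) | X = x]`. -/
noncomputable def condMean (F : Population 𝓑 𝓧) (w : Bool) (h : 𝓑 → ℝ) (x : 𝓧) : ℝ :=
  ∫ b, h (b w) ∂(F.bid x)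

variable {F : Population 𝓑 𝓧} {w : Bool} {h : 𝓑 → ℝ}

theorem abs_condMean_le {K : ℝ} (hK : ∀ b, |h b| ≤ K) (x : 𝓧) : |F.condMean w h x| ≤ K := by
  simpa [condMean] using norm_integral_le_of_norm_le_const (μ := F.bid x)
    (f := fun b => h (b w)) (.of_forall fun b => hK (b w))

theorem isBoundedMeasurable_condMean (hh : IsBoundedMeasurable h) :
    IsBoundedMeasurable (F.condMean w h) := by
  obtain ⟨K, hK⟩ := hh.exists_abs_le
  exact .of_abs_le ((hh.measurable.comp
    (measurable_pi_apply w)).stronglyMeasurable.integral_kernel).measurable (abs_condMean_le hK)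

theorem integrable_bid (hh : IsBoundedMeasurable h) (x : 𝓧) :
    Integrable (fun b : Bool → 𝓑 => h (b w)) (F.bid x) :=
  (hh.comp (measurable_pi_apply w)).integrable _

theorem sq_condMean_le (hh : IsBoundedMeasurable h) (x : 𝓧) :
    F.condMean w h x ^ 2 ≤ F.condMean w (fun b => h b ^ 2) x := by
  simpa [condMean] using Semiparametric.sq_integral_mul_le
    ((hh.comp (measurable_pi_apply w)).memLp 2 (F.bid x)) (memLp_const (1 : ℝ))

theorem potLaw_eq_map_compProd :
    F.potLaw w = (F.cov.compProd F.bid).map fun ω => ω.2 w := by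
  rw [potLaw, ← Measure.snd_compProd, Measure.snd,
    Measure.map_map (measurable_pi_apply w) measurable_snd]
  rfl

theorem lintegral_potLaw {f : 𝓑 → ENNReal} (hf : Measurable f) :
    ∫⁻ b, f b ∂F.potLaw w = ∫⁻ x, ∫⁻ b, f (b w) ∂(F.bid x) ∂F.cov := by
  have hw : Measurable fun ω : 𝓧 × (Bool → 𝓑) => ω.2 w :=
    (measurable_pi_apply w).comp measurable_snd
  rw [potLaw_eq_map_compProd, lintegral_map hf hw,
    Measure.lintegral_compProd (f := fun ω : 𝓧 × (Bool → 𝓑) => f (ω.2 w)) (hf.comp hw)]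

theorem integral_potLaw {E : Type*} [NormedAddCommGroup E] [NormedSpace ℝ E] {g : 𝓑 → E}
    (hg : Integrable g (F.potLaw w)) :
    ∫ b, g b ∂F.potLaw w = ∫ x, ∫ b, g (b w) ∂(F.bid x) ∂F.cov := by
  have hw : AEMeasurable (fun ω : 𝓧 × (Bool → 𝓑) => ω.2 w) (F.cov.compProd F.bid) := by fun_prop
  rw [potLaw_eq_map_compProd] at hg ⊢
  rw [integral_map hw hg.aestronglyMeasurable,
    Measure.integral_compProd (f := fun ω : 𝓧 × (Bool → 𝓑) => g (ω.2 w)) (hg.comp_aemeasurable hw)]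

theorem integral_condMean (hh : IsBoundedMeasurable h) :
    ∫ x, F.condMean w h x ∂F.cov = ∫ b, h b ∂F.potLaw w :=
  (integral_potLaw (hh.integrable _)).symm

theorem lintegral_obsLaw {f : 𝓑 × Bool × 𝓧 → ENNReal} (hf : Measurable f) :
    ∫⁻ z, f z ∂F.obsLaw = ∫⁻ x, ∑ w, ENNReal.ofReal (F.armProb w x) *
      ∫⁻ b, f (b w, w, x) ∂(F.bid x) ∂F.cov := by
  rw [obsLaw, lintegral_map hf measurable_observe, fullLaw,
    Measure.lintegral_compProd (f := fun ω => f (observe ω)) (hf.comp measurable_observe)]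
  refine lintegral_congr fun x => ?_
  rw [Kernel.prod_apply, lintegral_prod_symm (f := fun q => f (observe (x, q)))
    ((hf.comp measurable_observe).comp measurable_prodMk_left).aemeasurable, lintegral_fintype]
  simp only [treatment_singleton, observe, mul_comm]

theorem integral_obsLaw {f : 𝓑 × Bool × 𝓧 → ℝ} (hf : IsBoundedMeasurable f) :
    ∫ z, f z ∂F.obsLaw =
      ∫ x, ∑ w, F.armProb w x * ∫ b, f (b w, w, x) ∂(F.bid x) ∂F.cov := by
  have hfo := hf.comp measurable_observe
  rw [obsLaw, integral_map measurable_observe.aemeasurable hf.measurable.aestronglyMeasurable,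
    fullLaw, Measure.integral_compProd (hfo.integrable _)]
  refine integral_congr_ae (.of_forall fun x => ?_)
  simp only
  rw [Kernel.prod_apply, integral_prod_symm (f := fun q => f (observe (x, q)))
    ((hfo.comp measurable_prodMk_left).integrable _), integral_fintype .of_finite]
  simp only [Measure.real, treatment_singleton, ENNReal.toReal_ofReal (F.armProb_pos _ x).le,
    observe, smul_eq_mul]

theorem map_obsLaw_covariate : F.obsLaw.map (fun z => z.2.2) = F.cov := by
  rw [obsLaw, Measure.map_map (by fun_prop) measurable_observe]
  exact Measure.fst_compProd F.cov (F.bid.prod F.treatment)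

theorem integral_obsLaw_covariate {a : 𝓧 → ℝ} (ha : Measurable a) :
    ∫ z, a z.2.2 ∂F.obsLaw = ∫ x, a x ∂F.cov := by
  rw [← map_obsLaw_covariate (F := F), integral_map (by fun_prop) ha.aestronglyMeasurable]

theorem isBoundedMeasurable_arm {f : 𝓑 × Bool × 𝓧 → ℝ} (hf : IsBoundedMeasurable f) (w : Bool) :
    IsBoundedMeasurable fun z : 𝓑 × Bool × 𝓧 => if z.2.1 = w then f z else 0 :=
  hf.ite (.const 0) (measurableSet_eq_fun measurable_snd.fst measurable_const)

theorem integral_obsLaw_arm {k : 𝓑 → ℝ} {m u : 𝓧 → ℝ} (hk : IsBoundedMeasurable k)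
    (hm : IsBoundedMeasurable m) (hu : IsBoundedMeasurable u) :
    ∫ z, (if z.2.1 = w then (k z.1 - m z.2.2) * u z.2.2 else 0) ∂F.obsLaw =
      ∫ x, F.armProb w x * ((F.condMean w k x - m x) * u x) ∂F.cov := by
  have hf : IsBoundedMeasurable fun z : 𝓑 × Bool × 𝓧 => (k z.1 - m z.2.2) * u z.2.2 :=
    ((hk.comp measurable_fst).sub (hm.comp measurable_snd.snd)).mul (hu.comp measurable_snd.snd)
  rw [integral_obsLaw (isBoundedMeasurable_arm hf w)]
  refine integral_congr_ae (.of_forall fun x => ?_)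
  have hcond : ∫ b : Bool → 𝓑, (k (b w) - m x) * u x ∂(F.bid x) =
      (F.condMean w k x - m x) * u x := by
    rw [integral_mul_const, integral_sub (integrable_bid hk x) (integrable_const _),
      integral_const, probReal_univ, one_smul, condMean]
  simp only [Fintype.sum_bool]
  rw [← hcond]
  cases w <;> simp

end Population

/-! ## The bias of the doubly robust score -/

namespace Population

open Semiparametric

variable {𝓑 𝓧 : Type*} [MeasurableSpace 𝓑] [MeasurableSpace 𝓧]

/-- Almost every participant receives either treatment with probability at least `κ`. -/
def StrongOverlap (F : Population 𝓑 𝓧) (κ : ℝ) : Prop :=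
  ∀ᵐ x ∂F.cov, ∀ w, κ ≤ F.armProb w x

/-- `P(W = w | X = x)`, truncated below at `κ`. Under `StrongOverlap F κ` this changes nothing
almost surely under `F`, but laws near that of `F` may charge the exceptional null set. -/
noncomputable def clippedProb (F : Population 𝓑 𝓧) (κ : ℝ) (w : Bool) (x : 𝓧) : ℝ :=
  max κ (F.armProb w x)

/-- The inverse probability weighted residual
`1(W = w) / P(W = w | X) * (h(B) - E[h(B(w)) | X])`; the treatment probabilities are truncated
at `κ`. -/
noncomputable def ipwResidual (F : Population 𝓑 𝓧) (κ : ℝ) (w : Bool) (h : 𝓑 → ℝ)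
    (z : 𝓑 × Bool × 𝓧) : ℝ :=
  if z.2.1 = w then (h z.1 - F.condMean w h z.2.2) * (F.clippedProb κ w z.2.2)⁻¹ else 0

/-- The doubly robust score `μ_w(X) + 1(W = w) / P(W = w | X) * (h(B) - μ_w(X))` of `E[h(B(w))]`,
where `μ_w(x) = E[h(B(w)) | X = x]`; the treatment probabilities are truncated at `κ`. -/
noncomputable def doublyRobust (F : Population 𝓑 𝓧) (κ : ℝ) (w : Bool) (h : 𝓑 → ℝ)
    (z : 𝓑 × Bool × 𝓧) : ℝ :=
  F.condMean w h z.2.2 + F.ipwResidual κ w h z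

variable {F F₀ : Population 𝓑 𝓧} {w : Bool} {h h' : 𝓑 → ℝ} {K κ c : ℝ}

theorem StrongOverlap.le_one (hov : F.StrongOverlap κ) : κ ≤ 1 := by
  obtain ⟨x, hx⟩ := Eventually.exists hov
  exact (hx true).trans (F.armProb_lt_one true x).le

theorem StrongOverlap.clippedProb_ae_eq (hov : F.StrongOverlap κ) (w : Bool) :
    F.clippedProb κ w =ᵐ[F.cov] F.armProb w := by
  filter_upwards [hov] with x hx
  exact max_eq_right (hx w)

theorem le_clippedProb (x : 𝓧) : κ ≤ F.clippedProb κ w x := le_max_left _ _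

theorem clippedProb_mem_Icc (hκ : κ ≤ 1) (x : 𝓧) : F.clippedProb κ w x ∈ Set.Icc (0 : ℝ) 1 :=
  ⟨(F.armProb_pos w x).le.trans (le_max_right _ _), max_le hκ (F.armProb_lt_one w x).le⟩

theorem measurable_clippedProb : Measurable (F.clippedProb κ w) :=
  measurable_const.max (isBoundedMeasurable_armProb F w).measurable

theorem isBoundedMeasurable_inv_clippedProb (hκ : 0 < κ) :
    IsBoundedMeasurable fun x => (F.clippedProb κ w x)⁻¹ :=
  .inv_of_le hκ measurable_clippedProb le_clippedProb

theorem isBoundedMeasurable_clippedProb (hκ : κ ≤ 1) :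
    IsBoundedMeasurable (F.clippedProb κ w) :=
  .of_abs_le measurable_clippedProb fun x => by
    rw [abs_of_nonneg (clippedProb_mem_Icc hκ x).1]
    exact (clippedProb_mem_Icc hκ x).2

theorem isBoundedMeasurable_ipwResidual (hκ : 0 < κ) (hh : IsBoundedMeasurable h) :
    IsBoundedMeasurable (F.ipwResidual κ w h) :=
  isBoundedMeasurable_arm (((hh.comp measurable_fst).sub
    ((isBoundedMeasurable_condMean hh).comp measurable_snd.snd)).mul
      ((isBoundedMeasurable_inv_clippedProb hκ).comp measurable_snd.snd)) w

theorem isBoundedMeasurable_doublyRobust (hκ : 0 < κ) (hh : IsBoundedMeasurable h) :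
    IsBoundedMeasurable (F.doublyRobust κ w h) :=
  ((isBoundedMeasurable_condMean hh).comp measurable_snd.snd).add
    (isBoundedMeasurable_ipwResidual hκ hh)

theorem integral_bid_ipwResidual (hh : IsBoundedMeasurable h) (v : Bool) (x : 𝓧) :
    ∫ b, F.ipwResidual κ w h (b v, v, x) ∂(F.bid x) = 0 := by
  simp only [ipwResidual]
  split_ifs with hvw
  · subst hvw
    rw [integral_mul_const, integral_sub (integrable_bid hh x) (integrable_const _)]
    simp [condMean]
  · exact integral_zero _ _

theorem abs_sub_condMean_le (hK : ∀ b, |h b| ≤ K) (b : 𝓑) (x : 𝓧) :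
    |h b - F.condMean w h x| ≤ 2 * K := by
  rw [two_mul]
  exact (abs_sub _ _).trans (add_le_add (hK b) (abs_condMean_le hK x))

theorem abs_condMean_sub_condMean_le (hK : ∀ b, |h b| ≤ K) (x : 𝓧) :
    |F.condMean w h x - F₀.condMean w h x| ≤ 2 * K := by
  rw [two_mul]
  exact (abs_sub _ _).trans (add_le_add (abs_condMean_le hK x) (abs_condMean_le hK x))

theorem abs_ipwResidual_le (hκ : 0 < κ) (hK : ∀ b, |h b| ≤ K) (z : 𝓑 × Bool × 𝓧) :
    |F.ipwResidual κ w h z| ≤ 2 * K * κ⁻¹ := by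
  have hK0 : 0 ≤ K := (abs_nonneg _).trans (hK z.1)
  unfold ipwResidual
  split_ifs
  · rw [abs_mul, abs_of_nonneg (inv_nonneg.2 (hκ.le.trans (le_clippedProb _)))]
    exact mul_le_mul (abs_sub_condMean_le hK z.1 z.2.2) (inv_anti₀ hκ (le_clippedProb _))
      (inv_nonneg.2 (hκ.le.trans (le_clippedProb _))) (by positivity)
  · rw [abs_zero]
    positivity

theorem abs_doublyRobust_le (hκ : 0 < κ) (hK : ∀ b, |h b| ≤ K) (z : 𝓑 × Bool × 𝓧) :
    |F.doublyRobust κ w h z| ≤ K * (1 + 2 * κ⁻¹) :=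
  calc |F.doublyRobust κ w h z| ≤ K + 2 * K * κ⁻¹ :=
        (abs_add_le _ _).trans (add_le_add (abs_condMean_le hK _) (abs_ipwResidual_le hκ hK z))
    _ = K * (1 + 2 * κ⁻¹) := by ring

/-- The mixed bias identity: the bias of the doubly robust score is a product of the error in the
treatment probability and the error in the regression, hence of second order. -/
theorem integral_potLaw_sub_integral_doublyRobust (hκ : 0 < κ) (hh : IsBoundedMeasurable h) :
    ∫ b, h b ∂F.potLaw w - ∫ z, F₀.doublyRobust κ w h z ∂F.obsLaw =
      ∫ x, (F₀.clippedProb κ w x)⁻¹ * ((F₀.clippedProb κ w x - F.armProb w x) *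
        (F.condMean w h x - F₀.condMean w h x)) ∂F.cov := by
  have hm := isBoundedMeasurable_condMean (F := F) (w := w) hh
  have hm₀ := isBoundedMeasurable_condMean (F := F₀) (w := w) hh
  have hinv := isBoundedMeasurable_inv_clippedProb (F := F₀) (w := w) hκ
  have hdr : ∫ z, F₀.doublyRobust κ w h z ∂F.obsLaw = ∫ x, F₀.condMean w h x ∂F.cov +
      ∫ x, F.armProb w x *
        ((F.condMean w h x - F₀.condMean w h x) * (F₀.clippedProb κ w x)⁻¹) ∂F.cov := by
    rw [← integral_obsLaw_covariate hm₀.measurable, ← integral_obsLaw_arm hh hm₀ hinv]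
    exact integral_add ((hm₀.comp measurable_snd.snd).integrable _)
      ((isBoundedMeasurable_ipwResidual hκ hh).integrable _)
  rw [← integral_condMean hh, hdr, ← sub_sub, ← integral_sub (hm.integrable _) (hm₀.integrable _),
    ← integral_sub ((hm.sub hm₀).integrable _)
      (((isBoundedMeasurable_armProb F w).mul ((hm.sub hm₀).mul hinv)).integrable _)]
  refine integral_congr_ae (.of_forall fun x => ?_)
  have hne : F₀.clippedProb κ w x ≠ 0 := (hκ.trans_le (le_clippedProb x)).ne'
  field_simp

theorem integral_doublyRobust_self (hκ : 0 < κ) (hh : IsBoundedMeasurable h) :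
    ∫ z, F.doublyRobust κ w h z ∂F.obsLaw = ∫ b, h b ∂F.potLaw w := by
  have hbias := integral_potLaw_sub_integral_doublyRobust (F := F) (F₀ := F) (w := w) hκ hh
  simp only [sub_self, mul_zero, integral_zero] at hbias
  exact (sub_eq_zero.1 hbias).symm

theorem integral_obsLaw_arm_covariate {a : 𝓧 → ℝ} (ha : IsBoundedMeasurable a) :
    ∫ z, (if z.2.1 = w then a z.2.2 else 0) ∂F.obsLaw = ∫ x, F.armProb w x * a x ∂F.cov := by
  rw [integral_obsLaw (isBoundedMeasurable_arm (ha.comp measurable_snd.snd) w)]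
  refine integral_congr_ae (.of_forall fun x => ?_)
  cases w <;> simp

theorem integral_sq_armProb_sub_clippedProb_le (hov : F₀.StrongOverlap κ) (hc : 0 ≤ c)
    (hclose : HellingerLe F.obsLaw F₀.obsLaw c) :
    ∫ x, (F.armProb w x - F₀.clippedProb κ w x) ^ 2 ∂F.cov ≤ 10 * c := by
  have hπ := isBoundedMeasurable_clippedProb (F := F₀) (w := w) hov.le_one
  have hmem := clippedProb_mem_Icc (F := F₀) (w := w) hov.le_one
  set π := F₀.clippedProb κ w
  set a : 𝓧 → ℝ := fun x => F.armProb w x - π x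
  have ha : IsBoundedMeasurable a := (isBoundedMeasurable_armProb F w).sub hπ
  have ha_sq_le (x : 𝓧) : a x ^ 2 ≤ 1 := by
    rw [sq_le_one_iff_abs_le_one, abs_le]
    constructor <;> linarith [(hmem x).1, (hmem x).2, F.armProb_pos w x, F.armProb_lt_one w x]
  have harm : IsBoundedMeasurable fun z : 𝓑 × Bool × 𝓧 => if z.2.1 = w then a z.2.2 else 0 :=
    isBoundedMeasurable_arm (ha.comp measurable_snd.snd) w
  have hπa : IsBoundedMeasurable fun z : 𝓑 × Bool × 𝓧 => π z.2.2 * a z.2.2 :=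
    (hπ.mul ha).comp measurable_snd.snd
  have htest (G : Population 𝓑 𝓧) :
      ∫ z, ((if z.2.1 = w then a z.2.2 else 0) - π z.2.2 * a z.2.2) ∂G.obsLaw =
        ∫ x, (G.armProb w x - π x) * a x ∂G.cov := by
    rw [integral_sub (harm.integrable _) (hπa.integrable _), integral_obsLaw_arm_covariate ha,
      integral_obsLaw_covariate (hπ.mul ha).measurable,
      ← integral_sub (((isBoundedMeasurable_armProb G w).mul ha).integrable _)
        ((hπ.mul ha).integrable _)]
    simp only [sub_mul]
  rw [← integral_obsLaw_covariate ha.sq.measurable, ← mul_one (10 * c)]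
  refine hclose.integral_le hc (harm.sub hπa) (ha.sq.comp measurable_snd.snd)
    (fun z => sq_nonneg _) ?_ ?_ (fun z => ?_) (fun z => ha_sq_le _) zero_le_one
  · rw [htest F, integral_obsLaw_covariate ha.sq.measurable]
    simp only [a, sq]
  · rw [htest F₀]
    refine integral_eq_zero_of_ae ?_
    filter_upwards [hov.clippedProb_ae_eq w] with x hx
    simp [π, hx]
  · obtain ⟨hπ0, hπ1⟩ := hmem z.2.2
    split_ifs
    · rw [← one_sub_mul, mul_pow]
      exact mul_le_mul_of_nonneg_right (by nlinarith) (sq_nonneg _)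
    · rw [zero_sub, neg_sq, mul_pow]
      exact mul_le_mul_of_nonneg_right (by nlinarith) (sq_nonneg _)

theorem integral_armProb_mul_sq_condMean_sub_le (hc : 0 ≤ c)
    (hclose : HellingerLe F.obsLaw F₀.obsLaw c) (hh : Measurable h) (hK : ∀ b, |h b| ≤ K) :
    ∫ x, F.armProb w x * (F.condMean w h x - F₀.condMean w h x) ^ 2 ∂F.cov ≤
      10 * c * (4 * K ^ 2) := by
  have hb : IsBoundedMeasurable h := .of_abs_le hh hK
  have hm₀ := isBoundedMeasurable_condMean (F := F₀) (w := w) hb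
  set v : 𝓧 → ℝ := fun x => F.condMean w h x - F₀.condMean w h x
  have hv : IsBoundedMeasurable v := (isBoundedMeasurable_condMean hb).sub hm₀
  have sq_le {y : ℝ} (hy : |y| ≤ 2 * K) : y ^ 2 ≤ 4 * K ^ 2 := by
    nlinarith [sq_le_sq' (neg_le_of_abs_le hy) (le_of_abs_le hy)]
  have hv_sq_le (x : 𝓧) : v x ^ 2 ≤ 4 * K ^ 2 :=
    sq_le (abs_condMean_sub_condMean_le hK x)
  rw [← integral_obsLaw_arm_covariate hv.sq]
  refine hclose.integral_le
    (g := fun z => if z.2.1 = w then (h z.1 - F₀.condMean w h z.2.2) * v z.2.2 else 0) hc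
    (isBoundedMeasurable_arm (((hb.comp measurable_fst).sub (hm₀.comp measurable_snd.snd)).mul
      (hv.comp measurable_snd.snd)) w)
    (isBoundedMeasurable_arm (hv.sq.comp measurable_snd.snd) w)
    (fun z => ?_) ?_ ?_ (fun z => ?_) (fun z => ?_) (by positivity)
  · split_ifs <;> positivity
  · rw [integral_obsLaw_arm hb hm₀ hv, integral_obsLaw_arm_covariate hv.sq]
    simp only [v, sq]
  · rw [integral_obsLaw_arm hb hm₀ hv]
    simp
  · split_ifs
    · rw [mul_pow]
      exact mul_le_mul_of_nonneg_right (sq_le (abs_sub_condMean_le hK _ _)) (sq_nonneg _)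
    · simp
  · split_ifs
    exacts [hv_sq_le _, by positivity]

/-- Where `p` is small compared to `κ ≤ π`, the error `|π - p|` is itself bounded below. -/
theorem abs_sub_mul_abs_le {π p v : ℝ} (hκ : 0 < κ) (hπ : κ ≤ π) (hp : 0 ≤ p)
    (hv : |v| ≤ 2 * K) :
    |(π - p) * v| ≤ κ⁻¹ * (κ + 1 + 4 * K) * ((p - π) ^ 2 + p * v ^ 2) := by
  have hK : 0 ≤ K := by linarith [abs_nonneg v]
  have hpv : 0 ≤ p * v ^ 2 := mul_nonneg hp (sq_nonneg v)
  have hq0 := abs_nonneg (π - p)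
  have hv0 := abs_nonneg v
  rw [abs_mul, mul_assoc, ← div_eq_inv_mul, le_div_iff₀ hκ, ← sq_abs (p - π), abs_sub_comm p π,
    ← sq_abs v]
  rw [← sq_abs v] at hpv
  have hcross : 0 ≤ K * (|π - p| ^ 2 + p * |v| ^ 2) := by positivity
  rcases le_total (κ / 2) p with hlarge | hsmall
  · have hweight : κ / 2 * |v| ^ 2 ≤ p * |v| ^ 2 := by gcongr
    nlinarith [mul_nonneg hκ.le (sq_nonneg (|π - p| - |v|)), mul_nonneg hκ.le hpv,
      mul_nonneg hκ.le (sq_nonneg |π - p|), sq_nonneg |π - p|]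
  · have hfar : κ / 2 ≤ |π - p| := (by linarith : κ / 2 ≤ π - p).trans (le_abs_self _)
    calc |π - p| * |v| * κ ≤ |π - p| * (2 * K) * (2 * |π - p|) := by
          gcongr
          linarith
      _ ≤ (κ + 1 + 4 * K) * (|π - p| ^ 2 + p * |v| ^ 2) := by
          nlinarith [mul_nonneg hκ.le (sq_nonneg |π - p|), mul_nonneg hκ.le hpv,
            sq_nonneg |π - p|, mul_nonneg hK hpv]

theorem abs_integral_potLaw_sub_doublyRobust_le (hκ : 0 < κ) (hov : F₀.StrongOverlap κ)
    (hc : 0 ≤ c) (hclose : HellingerLe F.obsLaw F₀.obsLaw c) (hh : Measurable h)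
    (hK : ∀ b, |h b| ≤ K) :
    |∫ b, h b ∂F.potLaw w - ∫ z, F₀.doublyRobust κ w h z ∂F.obsLaw| ≤
      κ⁻¹ * (κ⁻¹ * (κ + 1 + 4 * K)) * (10 + 40 * K ^ 2) * c := by
  have hb : IsBoundedMeasurable h := .of_abs_le hh hK
  have hp := isBoundedMeasurable_armProb F w
  have hv : IsBoundedMeasurable fun x => F.condMean w h x - F₀.condMean w h x :=
    (isBoundedMeasurable_condMean hb).sub (isBoundedMeasurable_condMean hb)
  have hq := (hp.sub (isBoundedMeasurable_clippedProb (F := F₀) (w := w) hov.le_one)).sq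
  have hK0 : 0 ≤ K := by
    obtain ⟨b⟩ := (F.potLaw w).nonempty_of_neZero
    exact (abs_nonneg _).trans (hK b)
  have hpointwise (x : 𝓧) : ‖(F₀.clippedProb κ w x)⁻¹ *
      ((F₀.clippedProb κ w x - F.armProb w x) * (F.condMean w h x - F₀.condMean w h x))‖ ≤
      κ⁻¹ * (κ⁻¹ * (κ + 1 + 4 * K)) * ((F.armProb w x - F₀.clippedProb κ w x) ^ 2 +
        F.armProb w x * (F.condMean w h x - F₀.condMean w h x) ^ 2) := by
    have hinv : (F₀.clippedProb κ w x)⁻¹ ≤ κ⁻¹ := inv_anti₀ hκ (le_clippedProb x)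
    rw [Real.norm_eq_abs, abs_mul, mul_assoc κ⁻¹,
      abs_of_nonneg (inv_nonneg.2 (hκ.le.trans (le_clippedProb x)))]
    exact mul_le_mul hinv (abs_sub_mul_abs_le hκ (le_clippedProb x) (F.armProb_pos w x).le
      (abs_condMean_sub_condMean_le hK x)) (abs_nonneg _) (inv_nonneg.2 hκ.le)
  rw [integral_potLaw_sub_integral_doublyRobust hκ hb]
  refine (norm_integral_le_of_norm_le (((hq.add (hp.mul hv.sq)).integrable _).const_mul _)
    (.of_forall hpointwise)).trans ?_
  rw [integral_const_mul, integral_add (hq.integrable _) ((hp.mul hv.sq).integrable _),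
    mul_assoc _ (10 + 40 * K ^ 2)]
  gcongr
  linarith [integral_sq_armProb_sub_clippedProb_le (w := w) hov hc hclose,
    integral_armProb_mul_sq_condMean_sub_le (w := w) hc hclose hh hK]

end Population

namespace Population

open Semiparametric

variable {𝓑 𝓧 : Type*} [MeasurableSpace 𝓑] [MeasurableSpace 𝓧] {F F₀ : Population 𝓑 𝓧} {w : Bool}
  {h h' : 𝓑 → ℝ} {K κ : ℝ}

theorem integral_sq_condMean_le (hh : IsBoundedMeasurable h) :
    ∫ x, F.condMean w h x ^ 2 ∂F.cov ≤ ∫ b, h b ^ 2 ∂F.potLaw w := by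
  rw [← integral_condMean hh.sq]
  exact integral_mono ((isBoundedMeasurable_condMean hh).sq.integrable _)
    ((isBoundedMeasurable_condMean hh.sq).integrable _) (sq_condMean_le hh)

theorem integral_obsLaw_arm_le (hh : IsBoundedMeasurable h) (h0 : ∀ b, 0 ≤ h b) :
    ∫ z, (if z.2.1 = w then h z.1 else 0) ∂F.obsLaw ≤ ∫ b, h b ∂F.potLaw w := by
  have harm := integral_obsLaw_arm (F := F) (w := w) hh (.const 0) (.const 1)
  simp only [sub_zero, mul_one] at harm
  have hm : IsBoundedMeasurable (F.condMean w h) := isBoundedMeasurable_condMean hh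
  rw [harm, ← integral_condMean hh]
  exact integral_mono (((isBoundedMeasurable_armProb F w).mul hm).integrable _) (hm.integrable _)
    fun x => mul_le_of_le_one_left (integral_nonneg fun b => h0 _) (F.armProb_lt_one w x).le

theorem sq_doublyRobust_le (hκ : 0 < κ) (z : 𝓑 × Bool × 𝓧) :
    F.doublyRobust κ w h z ^ 2 ≤ (2 + 4 * κ⁻¹ ^ 2) * F.condMean w h z.2.2 ^ 2 +
      4 * κ⁻¹ ^ 2 * if z.2.1 = w then h z.1 ^ 2 else 0 := by
  unfold doublyRobust ipwResidual
  set m := F.condMean w h z.2.2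
  have hinv0 : 0 ≤ (F.clippedProb κ w z.2.2)⁻¹ := inv_nonneg.2 (hκ.le.trans (le_clippedProb _))
  have hinv : (F.clippedProb κ w z.2.2)⁻¹ ^ 2 ≤ κ⁻¹ ^ 2 :=
    pow_le_pow_left₀ hinv0 (inv_anti₀ hκ (le_clippedProb _)) 2
  have hκ2 : 0 ≤ κ⁻¹ ^ 2 := sq_nonneg _
  set i := (F.clippedProb κ w z.2.2)⁻¹
  split_ifs
  · calc (m + (h z.1 - m) * i) ^ 2 ≤ 2 * m ^ 2 + 2 * ((h z.1 - m) ^ 2 * i ^ 2) := by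
          linarith [sq_nonneg (m - (h z.1 - m) * i)]
      _ ≤ 2 * m ^ 2 + 2 * ((2 * h z.1 ^ 2 + 2 * m ^ 2) * κ⁻¹ ^ 2) := by
          gcongr
          linarith [sq_nonneg (h z.1 + m)]
      _ = _ := by ring
  · nlinarith [mul_nonneg hκ2 (sq_nonneg m), sq_nonneg m]

theorem integral_sq_doublyRobust_le (hκ : 0 < κ) (hh : IsBoundedMeasurable h) :
    ∫ z, F.doublyRobust κ w h z ^ 2 ∂F.obsLaw ≤
      (2 + 8 * κ⁻¹ ^ 2) * ∫ b, h b ^ 2 ∂F.potLaw w := by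
  have hm := (isBoundedMeasurable_condMean (F := F) (w := w) hh).sq
  have hm' := hm.comp (measurable_snd.snd : Measurable fun z : 𝓑 × Bool × 𝓧 => z.2.2)
  have harm : IsBoundedMeasurable fun z : 𝓑 × Bool × 𝓧 => if z.2.1 = w then h z.1 ^ 2 else 0 :=
    isBoundedMeasurable_arm (hh.sq.comp measurable_fst) w
  refine (integral_mono ((isBoundedMeasurable_doublyRobust hκ hh).sq.integrable _)
    (((hm'.const_mul _).add (harm.const_mul _)).integrable _) (sq_doublyRobust_le hκ)).trans ?_
  rw [integral_add ((hm'.const_mul _).integrable _) ((harm.const_mul _).integrable _),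
    integral_const_mul, integral_const_mul, integral_obsLaw_covariate hm.measurable]
  have hregression := mul_le_mul_of_nonneg_left (integral_sq_condMean_le (F := F) (w := w) hh)
    (by positivity : 0 ≤ 2 + 4 * κ⁻¹ ^ 2)
  have hresidual := mul_le_mul_of_nonneg_left
    (integral_obsLaw_arm_le (F := F) (w := w) hh.sq fun b => sq_nonneg _)
    (by positivity : 0 ≤ 4 * κ⁻¹ ^ 2)
  linarith

theorem doublyRobust_sub (hh : IsBoundedMeasurable h) (hh' : IsBoundedMeasurable h')
    (z : 𝓑 × Bool × 𝓧) :
    F.doublyRobust κ w (fun b => h b - h' b) z =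
      F.doublyRobust κ w h z - F.doublyRobust κ w h' z := by
  have hmean : F.condMean w (fun b => h b - h' b) z.2.2 =
      F.condMean w h z.2.2 - F.condMean w h' z.2.2 :=
    integral_sub (integrable_bid hh _) (integrable_bid hh' _)
  unfold doublyRobust ipwResidual
  rw [hmean]
  split_ifs <;> ring

theorem sq_integral_doublyRobust_mul_sub_le (hκ : 0 < κ) (hh : IsBoundedMeasurable h)
    (hh' : IsBoundedMeasurable h') {s : 𝓑 × Bool × 𝓧 → ℝ} (hs : MemLp s 2 F.obsLaw) :
    (∫ z, F.doublyRobust κ w h z * s z ∂F.obsLaw -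
      ∫ z, F.doublyRobust κ w h' z * s z ∂F.obsLaw) ^ 2 ≤
      (2 + 8 * κ⁻¹ ^ 2) * (∫ b, (h b - h' b) ^ 2 ∂F.potLaw w) * ∫ z, s z ^ 2 ∂F.obsLaw := by
  have hdr {h : 𝓑 → ℝ} (hh : IsBoundedMeasurable h) : MemLp (F.doublyRobust κ w h) 2 F.obsLaw :=
    (isBoundedMeasurable_doublyRobust hκ hh).memLp 2 _
  have hmul {h : 𝓑 → ℝ} (hh : IsBoundedMeasurable h) :
      Integrable (fun z => F.doublyRobust κ w h z * s z) F.obsLaw := (hdr hh).integrable_mul hs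
  rw [← integral_sub (hmul hh) (hmul hh')]
  simp only [← sub_mul, ← doublyRobust_sub hh hh']
  exact (sq_integral_mul_le (hdr (hh.sub hh')) hs).trans (mul_le_mul_of_nonneg_right
    (integral_sq_doublyRobust_le hκ (hh.sub hh')) (integral_nonneg fun z => sq_nonneg _))

section RegularSubmodel

variable {𝓜 : Set (Population 𝓑 𝓧)} {path : ℝ → Population 𝓑 𝓧} {s : 𝓑 × Bool × 𝓧 → ℝ}

/-- The doubly robust score is the influence function of a potential mean. The expansion is uniform
over bounded functions because the evaluated function varies with `t` in the applications. -/
theorem exists_abs_integral_potLaw_sub_le (hκ : 0 < κ) (hov : F₀.StrongOverlap κ)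
    (hreg : IsRegularSubmodel obsLaw 𝓜 F₀ path s) (K : ℝ) :
    ∃ ρ : ℝ → ℝ, Tendsto ρ (𝓝[≠] 0) (𝓝 0) ∧ ∀ᶠ t in 𝓝[≠] (0 : ℝ), ∀ (w : Bool) (h : 𝓑 → ℝ),
      Measurable h → (∀ b, |h b| ≤ K) →
      |∫ b, h b ∂(path t).potLaw w - ∫ b, h b ∂F₀.potLaw w -
        t * ∫ z, F₀.doublyRobust κ w h z * s z ∂F₀.obsLaw| ≤ |t| * ρ t := by
  obtain ⟨C, hC, hclose⟩ := hreg.exists_hellingerLe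
  obtain ⟨ρ, hρ, hexp⟩ := hreg.exists_abs_integral_sub_le
  set B : ℝ := κ⁻¹ * (κ⁻¹ * (κ + 1 + 4 * K)) * (10 + 40 * K ^ 2)
  refine ⟨fun t => B * C * |t| + K * (1 + 2 * κ⁻¹) * ρ t, ?_, ?_⟩
  · have habs : Tendsto (fun t : ℝ => |t|) (𝓝[≠] 0) (𝓝 0) := by
      simpa using (continuous_abs.tendsto (0 : ℝ)).mono_left nhdsWithin_le_nhds
    simpa using (habs.const_mul (B * C)).add (hρ.const_mul (K * (1 + 2 * κ⁻¹)))
  · filter_upwards [hclose, hexp] with t hHellinger hlinear w h hh hK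
    have hb : IsBoundedMeasurable h := .of_abs_le hh hK
    have hbound := abs_doublyRobust_le (F := F₀) (w := w) hκ hK
    obtain ⟨z⟩ := F₀.obsLaw.nonempty_of_neZero
    have hbias := abs_integral_potLaw_sub_doublyRobust_le (w := w) hκ hov (by positivity)
      hHellinger hh hK
    have hscore := hlinear _ _ (isBoundedMeasurable_doublyRobust hκ hb).measurable
      ((abs_nonneg _).trans (hbound z)) hbound
    rw [integral_doublyRobust_self hκ hb] at hscore
    set d := F₀.doublyRobust κ w h
    calc _ = |(∫ b, h b ∂(path t).potLaw w - ∫ z, d z ∂(path t).obsLaw) +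
          (∫ z, d z ∂(path t).obsLaw - ∫ b, h b ∂F₀.potLaw w -
            t * ∫ z, d z * s z ∂F₀.obsLaw)| := by ring_nf
      _ ≤ B * (C * t ^ 2) + K * (1 + 2 * κ⁻¹) * (|t| * ρ t) :=
          (abs_add_le _ _).trans (add_le_add hbias hscore)
      _ = |t| * (B * C * |t| + K * (1 + 2 * κ⁻¹) * ρ t) := by
          rw [← sq_abs t]
          ring

theorem exists_abs_integral_potLaw_sub_le_mul_abs (hκ : 0 < κ) (hov : F₀.StrongOverlap κ)
    (hreg : IsRegularSubmodel obsLaw 𝓜 F₀ path s) (K : ℝ) :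
    ∃ C : ℝ, ∀ᶠ t in 𝓝[≠] (0 : ℝ), ∀ (w : Bool) (h : 𝓑 → ℝ), Measurable h → (∀ b, |h b| ≤ K) →
      |∫ b, h b ∂(path t).potLaw w - ∫ b, h b ∂F₀.potLaw w| ≤ C * |t| := by
  obtain ⟨ρ, hρ, hexp⟩ := exists_abs_integral_potLaw_sub_le hκ hov hreg K
  have hs : Integrable s F₀.obsLaw := hreg.memLp.integrable one_le_two
  refine ⟨1 + K * (1 + 2 * κ⁻¹) * ∫ z, |s z| ∂F₀.obsLaw, ?_⟩
  filter_upwards [hexp, hρ.eventually (gt_mem_nhds one_pos)] with t ht hρt w h hh hK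
  set d := F₀.doublyRobust κ w h
  have hslope : |∫ z, d z * s z ∂F₀.obsLaw| ≤ K * (1 + 2 * κ⁻¹) * ∫ z, |s z| ∂F₀.obsLaw := by
    rw [← integral_const_mul, ← Real.norm_eq_abs]
    refine norm_integral_le_of_norm_le (hs.abs.const_mul _) (.of_forall fun z => ?_)
    rw [Real.norm_eq_abs, abs_mul]
    exact mul_le_mul_of_nonneg_right (abs_doublyRobust_le hκ hK z) (abs_nonneg _)
  calc _ = |(∫ b, h b ∂(path t).potLaw w - ∫ b, h b ∂F₀.potLaw w -
          t * ∫ z, d z * s z ∂F₀.obsLaw) + t * ∫ z, d z * s z ∂F₀.obsLaw| := by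
        rw [sub_add_cancel]
    _ ≤ |t| * 1 + |t| * (K * (1 + 2 * κ⁻¹) * ∫ z, |s z| ∂F₀.obsLaw) := by
        refine (abs_add_le _ _).trans (add_le_add ((ht w h hh hK).trans ?_) ?_)
        · exact mul_le_mul_of_nonneg_left hρt.le (abs_nonneg _)
        · rw [abs_mul]
          exact mul_le_mul_of_nonneg_left hslope (abs_nonneg _)
    _ = _ := by ring

end RegularSubmodel

end Population

/-! ## Market-clearing cutoffs along a regular submodel -/

theorem tendsto_of_tendsto_comp_of_unique_preimage {X Y α : Type*} [TopologicalSpace X]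
    [TopologicalSpace Y] [T2Space Y] {l : Filter α} {u : α → X} {f : X → Y} {S : Set X} {x₀ : X}
    {y₀ : Y} (hS : IsCompact S) (hf : ContinuousOn f S) (hu : ∀ᶠ a in l, u a ∈ S)
    (hfu : Tendsto (fun a => f (u a)) l (𝓝 y₀)) (hunique : ∀ x ∈ S, f x = y₀ → x = x₀) :
    Tendsto u l (𝓝 x₀) := by
  refine hS.tendsto_nhds_of_unique_mapClusterPt hu fun x hx hcluster => hunique x hx ?_
  have hwithin : 𝓝 x ⊓ map u l ≤ 𝓝[S] x := inf_le_inf_left _ (le_principal_iff.2 hu)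
  have hcomp : ClusterPt (f x) (map (f ∘ u) l) :=
    hcluster.tendsto_comp' ((hf x hx).mono_left hwithin)
  have hne : (𝓝 (f x) ⊓ 𝓝 y₀).NeBot := hcomp.mono hfu
  exact eq_of_nhds_neBot hne

theorem isBigO_sub_rev_of_hasFDerivAt_equiv {E G : Type*} [NormedAddCommGroup E] [NormedSpace ℝ E]
    [NormedAddCommGroup G] [NormedSpace ℝ G] {f : E → G} {A : E ≃L[ℝ] G} {x₀ : E}
    (hf : HasFDerivAt f (A : E →L[ℝ] G) x₀) :
    (fun x => x - x₀) =O[𝓝 x₀] fun x => f x - f x₀ := by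
  have hlin := A.isBigO_sub_rev (𝓝 x₀) x₀
  refine hlin.trans ?_
  simpa using (hf.isLittleO.trans_isBigO hlin).right_isBigO_add

namespace CutoffMechanism

open Population Semiparametric

variable {𝓑 𝓧 : Type*} [MeasurableSpace 𝓑] [MeasurableSpace 𝓧] {J : ℕ}
  {M : CutoffMechanism 𝓑 J} {F F₀ : Population 𝓑 𝓧} {w : Bool}
  {p p' : EuclideanSpace ℝ (Fin J)} {ℓ : EuclideanSpace ℝ (Fin J) →L[ℝ] ℝ}

/-- The allocation and the outcome are bounded, uniformly over admissible cutoffs. -/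
structure IsBounded (M : CutoffMechanism 𝓑 J) : Prop where
  exists_norm_alloc_le : ∃ K : ℝ, ∀ b, ∀ p ∈ M.cutoffs, ‖M.alloc b p‖ ≤ K
  exists_abs_outcome_le : ∃ K : ℝ, ∀ b, ∀ p ∈ M.cutoffs, |M.outcome b p| ≤ K

/-- The outcome at cutoffs `p`, net of the allocation in excess of capacity valued at the
prices `ℓ`. -/
def netOutcome (M : CutoffMechanism 𝓑 J) (ℓ : EuclideanSpace ℝ (Fin J) →L[ℝ] ℝ)
    (p : EuclideanSpace ℝ (Fin J)) (b : 𝓑) : ℝ :=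
  M.outcome b p - ℓ (M.alloc b p - M.capacity)

theorem measurable_netOutcome (ℓ : EuclideanSpace ℝ (Fin J) →L[ℝ] ℝ)
    (p : EuclideanSpace ℝ (Fin J)) : Measurable (M.netOutcome ℓ p) :=
  (M.measurable_outcome p).sub (ℓ.measurable.comp ((M.measurable_alloc p).sub_const _))

namespace IsBounded

theorem isBoundedMeasurable_outcome (hM : M.IsBounded) (hp : p ∈ M.cutoffs) :
    IsBoundedMeasurable fun b => M.outcome b p :=
  have ⟨_, hK⟩ := hM.exists_abs_outcome_le
  .of_abs_le (M.measurable_outcome p) fun b => hK b p hp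

theorem integrable_alloc (hM : M.IsBounded) (hp : p ∈ M.cutoffs) (μ : Measure 𝓑)
    [IsFiniteMeasure μ] : Integrable (fun b => M.alloc b p) μ :=
  have ⟨K, hK⟩ := hM.exists_norm_alloc_le
  .of_bound (M.measurable_alloc p).aestronglyMeasurable K (.of_forall fun b => hK b p hp)

theorem isBoundedMeasurable_norm_alloc_sub (hM : M.IsBounded) (hp : p ∈ M.cutoffs)
    (hp' : p' ∈ M.cutoffs) : IsBoundedMeasurable fun b => ‖M.alloc b p - M.alloc b p'‖ := by
  obtain ⟨K, hK⟩ := hM.exists_norm_alloc_le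
  refine .of_abs_le (K := K + K) ((M.measurable_alloc p).sub (M.measurable_alloc p')).norm
    fun b => ?_
  rw [abs_norm]
  exact (norm_sub_le _ _).trans (add_le_add (hK b p hp) (hK b p' hp'))

theorem exists_abs_netOutcome_le (hM : M.IsBounded) (ℓ : EuclideanSpace ℝ (Fin J) →L[ℝ] ℝ) :
    ∃ K : ℝ, ∀ p ∈ M.cutoffs, ∀ b, |M.netOutcome ℓ p b| ≤ K := by
  obtain ⟨K, hK⟩ := hM.exists_abs_outcome_le
  obtain ⟨K', hK'⟩ := hM.exists_norm_alloc_le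
  refine ⟨K + ‖ℓ‖ * (K' + ‖M.capacity‖), fun p hp b => ?_⟩
  exact (abs_sub _ _).trans (add_le_add (hK b p hp) (ℓ.le_opNorm_of_le
    ((norm_sub_le _ _).trans (add_le_add_left (hK' b p hp) _))))

theorem isBoundedMeasurable_netOutcome (hM : M.IsBounded) (hp : p ∈ M.cutoffs) :
    IsBoundedMeasurable (M.netOutcome ℓ p) :=
  have ⟨_, hK⟩ := hM.exists_abs_netOutcome_le ℓ
  .of_abs_le (measurable_netOutcome ℓ p) (hK p hp)

theorem integral_netOutcome (hM : M.IsBounded) (hp : p ∈ M.cutoffs) :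
    ∫ b, M.netOutcome ℓ p b ∂F.potLaw w = M.meanOutcome F w p - ℓ (M.excess F w p) := by
  have hexcess : Integrable (fun b => M.alloc b p - M.capacity) (F.potLaw w) :=
    (hM.integrable_alloc hp _).sub (integrable_const _)
  unfold netOutcome
  rw [integral_sub ((hM.isBoundedMeasurable_outcome hp).integrable _) (ℓ.integrable_comp hexcess),
    ℓ.integral_comp_comm hexcess, integral_sub (hM.integrable_alloc hp _) (integrable_const _),
    integral_const, probReal_univ, one_smul]
  rfl

theorem sq_norm_excess_sub_le (hM : M.IsBounded) (hp : p ∈ M.cutoffs) (hp' : p' ∈ M.cutoffs) :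
    ‖M.excess F w p - M.excess F w p'‖ ^ 2 ≤ ∫ b, ‖M.alloc b p - M.alloc b p'‖ ^ 2 ∂F.potLaw w := by
  have hnorm : ‖M.excess F w p - M.excess F w p'‖ ≤
      ∫ b, ‖M.alloc b p - M.alloc b p'‖ ∂F.potLaw w := by
    rw [excess, excess, sub_sub_sub_cancel_right,
      ← integral_sub (hM.integrable_alloc hp _) (hM.integrable_alloc hp' _)]
    exact norm_integral_le_integral_norm _
  have hjensen := sq_integral_mul_le
    ((hM.isBoundedMeasurable_norm_alloc_sub hp hp').memLp 2 (F.potLaw w)) (memLp_const (1 : ℝ))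
  simp only [mul_one, one_pow, integral_const, probReal_univ, smul_eq_mul] at hjensen
  exact (pow_le_pow_left₀ (norm_nonneg _) hnorm 2).trans hjensen

theorem integral_sq_netOutcome_sub_le (hM : M.IsBounded) (hp : p ∈ M.cutoffs)
    (hp' : p' ∈ M.cutoffs) (μ : Measure 𝓑) [IsFiniteMeasure μ] :
    ∫ b, (M.netOutcome ℓ p b - M.netOutcome ℓ p' b) ^ 2 ∂μ ≤
      2 * ∫ b, (M.outcome b p - M.outcome b p') ^ 2 ∂μ +
        2 * ‖ℓ‖ ^ 2 * ∫ b, ‖M.alloc b p - M.alloc b p'‖ ^ 2 ∂μ := by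
  have houtcome := ((hM.isBoundedMeasurable_outcome hp).sub
    (hM.isBoundedMeasurable_outcome hp')).sq.const_mul 2
  have halloc := (hM.isBoundedMeasurable_norm_alloc_sub hp hp').sq.const_mul (2 * ‖ℓ‖ ^ 2)
  rw [← integral_const_mul, ← integral_const_mul,
    ← integral_add (houtcome.integrable μ) (halloc.integrable μ)]
  refine integral_mono (((hM.isBoundedMeasurable_netOutcome hp).sub
    (hM.isBoundedMeasurable_netOutcome hp')).sq.integrable μ)
    ((houtcome.add halloc).integrable μ) fun b => ?_
  have hvalue : ℓ (M.alloc b p - M.alloc b p') ^ 2 ≤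
      ‖ℓ‖ ^ 2 * ‖M.alloc b p - M.alloc b p'‖ ^ 2 := by
    rw [← mul_pow, ← sq_abs]
    exact pow_le_pow_left₀ (abs_nonneg _) (ℓ.le_opNorm _) 2
  calc (M.netOutcome ℓ p b - M.netOutcome ℓ p' b) ^ 2 =
        ((M.outcome b p - M.outcome b p') - ℓ (M.alloc b p - M.alloc b p')) ^ 2 := by
        simp only [netOutcome, map_sub]
        ring
    _ ≤ 2 * (M.outcome b p - M.outcome b p') ^ 2 + 2 * ℓ (M.alloc b p - M.alloc b p') ^ 2 := by
        rw [sub_eq_add_neg, ← neg_sq (ℓ _), ← mul_add]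
        exact add_sq_le
    _ ≤ _ := by linarith

end IsBounded

/-- Under `F` the cutoffs `pstar` are the only market-clearing ones, and the market is regular
there: overlap is strong, allocations and outcomes vary continuously in mean square, and mean
excess demand has an invertible derivative. -/
structure IsRegularEquilibrium (M : CutoffMechanism 𝓑 J) (F : Population 𝓑 𝓧)
    (pstar : Bool → EuclideanSpace ℝ (Fin J)) : Prop where
  isBounded : M.IsBounded
  exists_strongOverlap : ∃ κ : ℝ, 0 < κ ∧ F.StrongOverlap κ
  isCompact_cutoffs : IsCompact M.cutoffs
  cutoffs_mem_nhds : ∀ w, M.cutoffs ∈ 𝓝 (pstar w)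
  tendsto_alloc : ∀ w, ∀ p ∈ M.cutoffs,
    Tendsto (fun p' => ∫ b, ‖M.alloc b p' - M.alloc b p‖ ^ 2 ∂F.potLaw w) (𝓝[M.cutoffs] p) (𝓝 0)
  tendsto_outcome : ∀ w, Tendsto (fun p => ∫ b, (M.outcome b p - M.outcome b (pstar w)) ^ 2
    ∂F.potLaw w) (𝓝[M.cutoffs] pstar w) (𝓝 0)
  exists_hasFDerivAt_excess : ∀ w,
    ∃ A : EuclideanSpace ℝ (Fin J) ≃L[ℝ] EuclideanSpace ℝ (Fin J),
      HasFDerivAt (M.excess F w) (A : EuclideanSpace ℝ (Fin J) →L[ℝ] EuclideanSpace ℝ (Fin J))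
        (pstar w)
  differentiableAt_meanOutcome : ∀ w, DifferentiableAt ℝ (M.meanOutcome F w) (pstar w)
  clears : ∀ w, M.Clears F w (pstar w)
  eq_of_clears : ∀ w p, M.Clears F w p → p = pstar w

namespace IsRegularEquilibrium

variable {pstar : Bool → EuclideanSpace ℝ (Fin J)}

theorem continuousOn_excess (h : M.IsRegularEquilibrium F₀ pstar) {c : NNReal}
    (hle : F.potLaw w ≤ c • F₀.potLaw w) : ContinuousOn (M.excess F w) M.cutoffs := by
  intro p hp
  rw [ContinuousWithinAt, tendsto_iff_norm_sub_tendsto_zero]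
  have hlim := ((h.tendsto_alloc w p hp).const_mul (c : ℝ)).sqrt
  rw [mul_zero, Real.sqrt_zero] at hlim
  refine squeeze_zero' (.of_forall fun _ => norm_nonneg _) ?_ hlim
  filter_upwards [self_mem_nhdsWithin] with p' hp'
  refine Real.le_sqrt_of_sq_le ((h.isBounded.sq_norm_excess_sub_le hp' hp).trans ?_)
  have hmono := integral_mono_measure hle (.of_forall fun b => sq_nonneg _)
    ((h.isBounded.isBoundedMeasurable_norm_alloc_sub hp' hp).sq.integrable (c • F₀.potLaw w))
  rwa [integral_smul_nnreal_measure, NNReal.smul_def, smul_eq_mul] at hmono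

theorem tendsto_integral_sq_netOutcome_sub (h : M.IsRegularEquilibrium F₀ pstar) :
    Tendsto (fun p => ∫ b, (M.netOutcome ℓ p b - M.netOutcome ℓ (pstar w) b) ^ 2 ∂F₀.potLaw w)
      (𝓝[M.cutoffs] pstar w) (𝓝 0) := by
  have hstar := (h.clears w).1
  have hlim := ((h.tendsto_outcome w).const_mul 2).add
    ((h.tendsto_alloc w _ hstar).const_mul (2 * ‖ℓ‖ ^ 2))
  rw [mul_zero, mul_zero, add_zero] at hlim
  refine squeeze_zero' (.of_forall fun p => integral_nonneg fun b => sq_nonneg _) ?_ hlim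
  filter_upwards [self_mem_nhdsWithin] with p hp
  exact h.isBounded.integral_sq_netOutcome_sub_le hp hstar _

/-- The prices `ν` offset the effect of cutoffs on outcomes by their effect on excess demand. -/
theorem hasFDerivAt_meanOutcome_sub_nu_excess (h : M.IsRegularEquilibrium F₀ pstar) (w : Bool) :
    HasFDerivAt (fun p => M.meanOutcome F₀ w p - M.nu F₀ w (pstar w) (M.excess F₀ w p))
      (0 : EuclideanSpace ℝ (Fin J) →L[ℝ] ℝ) (pstar w) := by
  obtain ⟨A, hA⟩ := h.exists_hasFDerivAt_excess w
  have hnu : (M.nu F₀ w (pstar w)).comp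
      (A : EuclideanSpace ℝ (Fin J) →L[ℝ] EuclideanSpace ℝ (Fin J)) =
        fderiv ℝ (M.meanOutcome F₀ w) (pstar w) := by
    ext1 v
    simp only [nu, hA.fderiv, ContinuousLinearMap.inverse_equiv, ContinuousLinearMap.comp_apply,
      ContinuousLinearEquiv.coe_coe, ContinuousLinearEquiv.symm_apply_apply]
  have hder := (h.differentiableAt_meanOutcome w).hasFDerivAt.sub
    ((M.nu F₀ w (pstar w)).hasFDerivAt.comp (pstar w) hA)
  rwa [hnu, sub_self] at hder

variable {𝓜 : Set (Population 𝓑 𝓧)} {path : ℝ → Population 𝓑 𝓧} {s : 𝓑 × Bool × 𝓧 → ℝ}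
  {cut : Population 𝓑 𝓧 → Bool → EuclideanSpace ℝ (Fin J)} {κ : ℝ}

theorem cut_eq (h : M.IsRegularEquilibrium F₀ pstar) (hcut : M.IsCutoffRule cut) (w : Bool) :
    cut F₀ w = pstar w :=
  h.eq_of_clears w _ (hcut F₀ w ⟨_, h.clears w⟩)

theorem exists_norm_excess_sub_le (h : M.IsRegularEquilibrium F₀ pstar)
    (hreg : IsRegularSubmodel obsLaw 𝓜 F₀ path s) :
    ∃ C : ℝ, ∀ᶠ t in 𝓝[≠] (0 : ℝ), ∀ w, ∀ p ∈ M.cutoffs,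
      ‖M.excess (path t) w p - M.excess F₀ w p‖ ≤ C * |t| := by
  obtain ⟨κ, hκ, hov⟩ := h.exists_strongOverlap
  obtain ⟨K, hK⟩ := h.isBounded.exists_norm_alloc_le
  obtain ⟨C, hlip⟩ := exists_abs_integral_potLaw_sub_le_mul_abs hκ hov hreg K
  refine ⟨C, ?_⟩
  filter_upwards [hlip] with t ht w p hp
  obtain ⟨g, hg, hgv⟩ := exists_dual_vector'' ℝ (M.excess (path t) w p - M.excess F₀ w p)
  have hint := h.isBounded.integrable_alloc hp
  have hdual := ht w (fun b => g (M.alloc b p)) (g.measurable.comp (M.measurable_alloc p)) fun b =>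
    (g.le_of_opNorm_le hg _).trans (by simpa using hK b p hp)
  rw [g.integral_comp_comm (hint _), g.integral_comp_comm (hint _), ← map_sub,
    ← sub_sub_sub_cancel_right _ _ M.capacity] at hdual
  exact hgv.symm.le.trans ((le_abs_self _).trans hdual)

theorem eventually_clears_cut (hcut : M.IsCutoffRule cut)
    (hreg : IsRegularSubmodel obsLaw (M.model 𝓧) F₀ path s) (w : Bool) :
    ∀ᶠ t in 𝓝[≠] (0 : ℝ), M.Clears (path t) w (cut (path t) w) := by
  filter_upwards [hreg.mem.filter_mono nhdsWithin_le_nhds] with t ht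
  exact hcut _ w (ht w)

theorem isBigO_excess_cut (h : M.IsRegularEquilibrium F₀ pstar) (hcut : M.IsCutoffRule cut)
    (hreg : IsRegularSubmodel obsLaw (M.model 𝓧) F₀ path s) (w : Bool) :
    (fun t => M.excess F₀ w (cut (path t) w)) =O[𝓝[≠] 0] fun t : ℝ => t := by
  obtain ⟨C, hC⟩ := h.exists_norm_excess_sub_le hreg
  refine .of_bound C ?_
  filter_upwards [hC, eventually_clears_cut hcut hreg w] with t ht hclears
  simpa [hclears.2] using ht w _ hclears.1

theorem tendsto_cut (h : M.IsRegularEquilibrium F₀ pstar) (hcut : M.IsCutoffRule cut)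
    (hreg : IsRegularSubmodel obsLaw (M.model 𝓧) F₀ path s) (w : Bool) :
    Tendsto (fun t => cut (path t) w) (𝓝[≠] 0) (𝓝[M.cutoffs] pstar w) := by
  have hmem := (eventually_clears_cut hcut hreg w).mono fun t ht => ht.1
  have hcont : ContinuousOn (M.excess F₀ w) M.cutoffs :=
    h.continuousOn_excess (c := 1) (one_smul _ _).ge
  refine tendsto_nhdsWithin_iff.2 ⟨tendsto_of_tendsto_comp_of_unique_preimage h.isCompact_cutoffs
    hcont hmem ?_ fun p hp hzero => h.eq_of_clears w p ⟨hp, hzero⟩, hmem⟩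
  exact (h.isBigO_excess_cut hcut hreg w).trans_tendsto (tendsto_id.mono_left nhdsWithin_le_nhds)

theorem isBigO_cut_sub (h : M.IsRegularEquilibrium F₀ pstar) (hcut : M.IsCutoffRule cut)
    (hreg : IsRegularSubmodel obsLaw (M.model 𝓧) F₀ path s) (w : Bool) :
    (fun t => cut (path t) w - pstar w) =O[𝓝[≠] 0] fun t : ℝ => t := by
  obtain ⟨A, hA⟩ := h.exists_hasFDerivAt_excess w
  have hdist := (isBigO_sub_rev_of_hasFDerivAt_equiv hA).comp_tendsto
    ((h.tendsto_cut hcut hreg w).mono_right nhdsWithin_le_nhds)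
  simp only [(h.clears w).2, sub_zero] at hdist
  exact hdist.trans (h.isBigO_excess_cut hcut hreg w)

theorem tendsto_integral_doublyRobust_netOutcome (h : M.IsRegularEquilibrium F₀ pstar)
    (hκ : 0 < κ) (hs : MemLp s 2 F₀.obsLaw) :
    Tendsto (fun p => ∫ z, F₀.doublyRobust κ w (M.netOutcome ℓ p) z * s z ∂F₀.obsLaw)
      (𝓝[M.cutoffs] pstar w)
      (𝓝 (∫ z, F₀.doublyRobust κ w (M.netOutcome ℓ (pstar w)) z * s z ∂F₀.obsLaw)) := by
  have hlim := (((h.tendsto_integral_sq_netOutcome_sub (w := w) (ℓ := ℓ)).const_mul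
    (2 + 8 * κ⁻¹ ^ 2)).mul_const (∫ z, s z ^ 2 ∂F₀.obsLaw)).sqrt
  simp only [mul_zero, zero_mul, Real.sqrt_zero] at hlim
  rw [tendsto_iff_norm_sub_tendsto_zero]
  refine squeeze_zero' (.of_forall fun _ => norm_nonneg _) ?_ hlim
  filter_upwards [self_mem_nhdsWithin] with p hp
  exact Real.abs_le_sqrt (sq_integral_doublyRobust_mul_sub_le hκ
    (h.isBounded.isBoundedMeasurable_netOutcome hp)
    (h.isBounded.isBoundedMeasurable_netOutcome (h.clears w).1) hs)

theorem tendsto_slope_netOutcome (h : M.IsRegularEquilibrium F₀ pstar) (hcut : M.IsCutoffRule cut)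
    (hreg : IsRegularSubmodel obsLaw (M.model 𝓧) F₀ path s) (hκ : 0 < κ)
    (hov : F₀.StrongOverlap κ) :
    Tendsto (fun t : ℝ => t⁻¹ * (∫ b, M.netOutcome ℓ (cut (path t) w) b ∂(path t).potLaw w -
        ∫ b, M.netOutcome ℓ (cut (path t) w) b ∂F₀.potLaw w)) (𝓝[≠] 0)
      (𝓝 (∫ z, F₀.doublyRobust κ w (M.netOutcome ℓ (pstar w)) z * s z ∂F₀.obsLaw)) := by
  obtain ⟨K, hK⟩ := h.isBounded.exists_abs_netOutcome_le ℓ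
  obtain ⟨ρ, hρ, hexp⟩ := exists_abs_integral_potLaw_sub_le hκ hov hreg K
  have hlimit := (h.tendsto_integral_doublyRobust_netOutcome (ℓ := ℓ) hκ hreg.memLp).comp
    (h.tendsto_cut hcut hreg w)
  refine tendsto_of_tendsto_of_dist hlimit (squeeze_zero' (.of_forall fun _ => dist_nonneg) ?_ hρ)
  filter_upwards [hexp, eventually_clears_cut hcut hreg w, self_mem_nhdsWithin]
    with t ht hclears (ht0 : t ≠ 0)
  rw [dist_comm, Real.dist_eq, ← mul_le_mul_iff_right₀ (abs_pos.2 ht0), ← abs_mul, mul_sub,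
    mul_inv_cancel_left₀ ht0]
  exact ht w _ (measurable_netOutcome ℓ _) (hK _ hclears.1)

/-- The mean outcome at market-clearing cutoffs is differentiable although these cutoffs need not
be: with `ν` as prices, the mean net outcome is stationary in the cutoffs at `pstar`. -/
theorem hasDerivAt_meanOutcome (h : M.IsRegularEquilibrium F₀ pstar) (hcut : M.IsCutoffRule cut)
    (hreg : IsRegularSubmodel obsLaw (M.model 𝓧) F₀ path s) (hκ : 0 < κ)
    (hov : F₀.StrongOverlap κ) (w : Bool) :
    HasDerivAt (fun t => M.meanOutcome (path t) w (cut (path t) w))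
      (∫ z, F₀.doublyRobust κ w (M.netOutcome (M.nu F₀ w (pstar w)) (pstar w)) z * s z ∂F₀.obsLaw)
      0 := by
  set ν := M.nu F₀ w (pstar w)
  have hdirect := h.tendsto_slope_netOutcome (ℓ := ν) (w := w) hcut hreg hκ hov
  have hcutoffs : Tendsto (fun t : ℝ => t⁻¹ * (∫ b, M.netOutcome ν (cut (path t) w) b ∂F₀.potLaw w -
      ∫ b, M.netOutcome ν (pstar w) b ∂F₀.potLaw w)) (𝓝[≠] 0) (𝓝 0) := by
    have hlittle := ((h.hasFDerivAt_meanOutcome_sub_nu_excess w).isLittleO.comp_tendsto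
      ((h.tendsto_cut hcut hreg w).mono_right nhdsWithin_le_nhds)).trans_isBigO
        (h.isBigO_cut_sub hcut hreg w)
    refine hlittle.tendsto_div_nhds_zero.congr' ?_
    filter_upwards [eventually_clears_cut hcut hreg w] with t hclears
    rw [h.isBounded.integral_netOutcome hclears.1, h.isBounded.integral_netOutcome (h.clears w).1,
      div_eq_inv_mul]
    simp [ν]
  rw [hasDerivAt_iff_tendsto_slope_zero]
  have hsum := hdirect.add hcutoffs
  rw [add_zero] at hsum
  refine hsum.congr' ?_
  filter_upwards [eventually_clears_cut hcut hreg w] with t hclears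
  rw [← mul_add, sub_add_sub_cancel, h.isBounded.integral_netOutcome hclears.1,
    h.isBounded.integral_netOutcome (h.clears w).1, hclears.2, (h.clears w).2]
  simp only [map_zero, sub_zero, zero_add, hreg.base, h.cut_eq hcut, smul_eq_mul]

end IsRegularEquilibrium

end CutoffMechanism

/-! ## Regularity of the continuum market -/

section FDerivIntegral

variable {X E G : Type*} [MeasurableSpace X] [NormedAddCommGroup E] [NormedSpace ℝ E]
  [FiniteDimensional ℝ E] [NormedAddCommGroup G] [NormedSpace ℝ G] {f : X → E → G} {p : E}

theorem stronglyMeasurable_fderiv_of_differentiableAt (hf : ∀ q, StronglyMeasurable fun x => f x q)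
    (hd : ∀ x, DifferentiableAt ℝ (f x) p) : StronglyMeasurable fun x => fderiv ℝ (f x) p := by
  have hdir : ∀ v : E, StronglyMeasurable fun x => fderiv ℝ (f x) p v := by
    intro v
    obtain ⟨u, hu⟩ := exists_seq_tendsto (𝓝[≠] (0 : ℝ))
    refine stronglyMeasurable_of_tendsto atTop
      (f := fun n x => (u n)⁻¹ • (f x (p + u n • v) - f x p))
      (fun n => ((hf _).sub (hf p)).const_smul _) (tendsto_pi_nhds.2 fun x => ?_)
    exact ((hd x).hasFDerivAt.hasLineDerivAt v).tendsto_slope_zero.comp hu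
  let b := Module.finBasis ℝ E
  let coord i : E →L[ℝ] ℝ := (b.coord i).toContinuousLinearMap
  have hsum : (fun x => fderiv ℝ (f x) p) =
      fun x => ∑ i, (coord i).smulRight (fderiv ℝ (f x) p (b i)) := by
    ext x v
    conv_lhs => rw [← b.sum_repr v, map_sum]
    simp [coord]
  rw [hsum]
  exact Finset.stronglyMeasurable_fun_sum _ fun i _ =>
    (ContinuousLinearMap.smulRightL ℝ E G (coord i)).continuous.comp_stronglyMeasurable (hdir (b i))

theorem differentiableAt_integral_of_norm_fderiv_le {μ : Measure X} [IsFiniteMeasure μ] {U : Set E}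
    {C : ℝ} (hf : ∀ q, StronglyMeasurable fun x => f x q) (hU : U ∈ 𝓝 p)
    (hint : Integrable (fun x => f x p) μ) (hd : ∀ x, ∀ q ∈ U, DifferentiableAt ℝ (f x) q)
    (hC : ∀ x, ∀ q ∈ U, ‖fderiv ℝ (f x) q‖ ≤ C) :
    DifferentiableAt ℝ (fun q => ∫ x, f x q ∂μ) p :=
  (hasFDerivAt_integral_of_dominated_of_fderiv_le (bound := fun _ => C)
    (F' := fun q x => fderiv ℝ (f x) q) hU (.of_forall fun q => (hf q).aestronglyMeasurable) hint
    (stronglyMeasurable_fderiv_of_differentiableAt hf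
      fun x => hd x p (mem_of_mem_nhds hU)).aestronglyMeasurable
    (.of_forall hC) (integrable_const C)
    (.of_forall fun x q hq => (hd x q hq).hasFDerivAt)).differentiableAt

end FDerivIntegral

theorem tendsto_const_mul_norm_sub_nhdsWithin {E : Type*} [SeminormedAddCommGroup E] {S : Set E}
    (L : ℝ) (p : E) : Tendsto (fun p' => L * ‖p' - p‖) (𝓝[S] p) (𝓝 0) := by
  have hcont : Continuous fun p' => L * ‖p' - p‖ := by fun_prop
  simpa using (hcont.tendsto p).mono_left nhdsWithin_le_nhds

namespace CutoffMechanism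

open Population

variable {𝓑 𝓧 : Type*} [MeasurableSpace 𝓑] [MeasurableSpace 𝓧] {J : ℕ}
  {M : CutoffMechanism 𝓑 J} {F : Population 𝓑 𝓧} {pstar : Bool → EuclideanSpace ℝ (Fin J)}

namespace Assumptions

theorem isBounded (hF : M.Assumptions F pstar) : M.IsBounded :=
  ⟨hF.alloc_bounded, hF.outcome_bounded⟩

theorem exists_strongOverlap (hF : M.Assumptions F pstar) :
    ∃ κ : ℝ, 0 < κ ∧ F.StrongOverlap κ := by
  obtain ⟨κ, hκ, hov⟩ := hF.strong_overlap
  refine ⟨κ, hκ, hov.mono fun x ⟨hlower, hupper⟩ w => ?_⟩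
  cases w
  · simpa [armProb] using le_sub_comm.1 hupper
  · simpa [armProb] using hlower

theorem interior_cutoffs_mem_nhds (hF : M.Assumptions F pstar) (w : Bool) :
    interior M.cutoffs ∈ 𝓝 (pstar w) := by
  obtain ⟨c₁, hc₁, hball⟩ := hF.interior_equilibrium
  exact interior_mem_nhds.2 (mem_of_superset (Metric.ball_mem_nhds _ hc₁) (hball w))

theorem integral_sq_norm_alloc_sub_le (hF : M.Assumptions F pstar) :
    ∃ L : ℝ, ∀ w, ∀ p ∈ M.cutoffs, ∀ p' ∈ M.cutoffs,
      ∫ b, ‖M.alloc b p - M.alloc b p'‖ ^ 2 ∂F.potLaw w ≤ L * ‖p - p'‖ := by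
  obtain ⟨L, -, hL⟩ := hF.weak_continuity
  refine ⟨J * L, fun w p hp p' hp' => ?_⟩
  have hint : ∀ j, Integrable (fun b => (M.alloc b p j - M.alloc b p' j) ^ 2) (F.potLaw w) := by
    intro j
    refine ((hF.isBounded.isBoundedMeasurable_norm_alloc_sub hp hp').sq.integrable _).mono'
      (by have := M.measurable_alloc p; have := M.measurable_alloc p'; fun_prop)
      (.of_forall fun b => ?_)
    rw [norm_pow]
    exact pow_le_pow_left₀ (norm_nonneg _) (PiLp.norm_apply_le (M.alloc b p - M.alloc b p') j) 2
  calc ∫ b, ‖M.alloc b p - M.alloc b p'‖ ^ 2 ∂F.potLaw w =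
        ∑ j, ∫ b, (M.alloc b p j - M.alloc b p' j) ^ 2 ∂F.potLaw w := by
        rw [← integral_finsetSum _ fun j _ => hint j]
        simp only [EuclideanSpace.real_norm_sq_eq, PiLp.sub_apply]
    _ ≤ ∑ _j : Fin J, L * ‖p - p'‖ := Finset.sum_le_sum fun j _ => (hL w p hp p' hp').1 j
    _ = J * L * ‖p - p'‖ := by simp [mul_assoc]

theorem differentiableAt_meanOutcome (hF : M.Assumptions F pstar) (w : Bool) :
    DifferentiableAt ℝ (M.meanOutcome F w) (pstar w) := by
  obtain ⟨C, hsmooth⟩ := hF.smooth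
  have hM := hF.isBounded
  have hU := hF.interior_cutoffs_mem_nhds w
  have hdiff : DifferentiableAt ℝ (fun p => ∫ x, M.condOutcome F w x p ∂F.cov) (pstar w) := by
    refine differentiableAt_integral_of_norm_fderiv_le (C := C) (fun p => ?_) hU
      (((isBoundedMeasurable_condMean
        (hM.isBoundedMeasurable_outcome (hF.clears w).1))).integrable _)
      (fun x p hp => ?_) fun x p hp => ?_
    · exact ((M.measurable_outcome p).comp
        (measurable_pi_apply w)).stronglyMeasurable.integral_kernel
    · exact ((hsmooth w x).2.1.contDiffAt
        (isOpen_interior.mem_nhds hp)).differentiableAt two_ne_zero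
    · rw [← norm_iteratedFDeriv_one]
      exact ((hsmooth w x).2.2 1 le_rfl one_le_two p hp).2
  refine hdiff.congr_of_eventuallyEq ?_
  filter_upwards [hU] with p hp
  exact integral_potLaw ((hM.isBoundedMeasurable_outcome (interior_subset hp)).integrable _)

theorem differentiableAt_excess (hF : M.Assumptions F pstar) (w : Bool) :
    DifferentiableAt ℝ (M.excess F w) (pstar w) := by
  obtain ⟨C, hsmooth⟩ := hF.smooth
  obtain ⟨K, hK⟩ := hF.alloc_bounded
  have hU := hF.interior_cutoffs_mem_nhds w
  have hmeas : ∀ p, StronglyMeasurable fun x => M.condAlloc F w x p := fun p =>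
    ((M.measurable_alloc p).comp (measurable_pi_apply w)).stronglyMeasurable.integral_kernel
  have hdiff : DifferentiableAt ℝ (fun p => ∫ x, M.condAlloc F w x p ∂F.cov) (pstar w) := by
    refine differentiableAt_integral_of_norm_fderiv_le (C := C) hmeas hU
      (.of_bound (hmeas _).aestronglyMeasurable K (.of_forall fun x => ?_))
      (fun x p hp => ?_) fun x p hp => ?_
    · simpa [condAlloc] using norm_integral_le_of_norm_le_const (μ := F.bid x)
        (f := fun b => M.alloc (b w) (pstar w)) (.of_forall fun b => hK (b w) _ (hF.clears w).1)
    · exact ((hsmooth w x).1.contDiffAt (isOpen_interior.mem_nhds hp)).differentiableAt two_ne_zero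
    · rw [← norm_iteratedFDeriv_one]
      exact ((hsmooth w x).2.2 1 le_rfl one_le_two p hp).1
  refine (hdiff.congr_of_eventuallyEq ?_).sub_const M.capacity
  filter_upwards [hU] with p hp
  exact integral_potLaw (hF.isBounded.integrable_alloc (interior_subset hp) _)

theorem exists_hasFDerivAt_excess (hF : M.Assumptions F pstar) (w : Bool) :
    ∃ A : EuclideanSpace ℝ (Fin J) ≃L[ℝ] EuclideanSpace ℝ (Fin J),
      HasFDerivAt (M.excess F w) (A : EuclideanSpace ℝ (Fin J) →L[ℝ] EuclideanSpace ℝ (Fin J))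
        (pstar w) := by
  obtain ⟨c₃, _, hc₃, hjacobian⟩ := hF.jacobian
  set D := fderiv ℝ (M.excess F w) (pstar w) with hD
  have hinj : Function.Injective D := by
    refine (injective_iff_map_eq_zero D).2 fun v hv => ?_
    have hlower := (hjacobian w v).1
    rw [← hD, hv, norm_zero] at hlower
    exact norm_le_zero_iff.1 (nonpos_of_mul_nonpos_right hlower hc₃)
  exact ⟨(LinearEquiv.ofInjectiveEndo (D : EuclideanSpace ℝ (Fin J) →ₗ[ℝ]
    EuclideanSpace ℝ (Fin J)) hinj).toContinuousLinearEquiv,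
    (hF.differentiableAt_excess w).hasFDerivAt⟩

theorem isRegularEquilibrium (hF : M.Assumptions F pstar) : M.IsRegularEquilibrium F pstar where
  isBounded := hF.isBounded
  exists_strongOverlap := hF.exists_strongOverlap
  isCompact_cutoffs := hF.compact_cutoffs
  cutoffs_mem_nhds w := interior_mem_nhds.1 (hF.interior_cutoffs_mem_nhds w)
  tendsto_alloc w p hp := by
    obtain ⟨L, hL⟩ := hF.integral_sq_norm_alloc_sub_le
    refine squeeze_zero' (.of_forall fun p' => integral_nonneg fun b => sq_nonneg _)
      (eventually_mem_nhdsWithin.mono fun p' hp' => hL w p' hp' p hp)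
      (tendsto_const_mul_norm_sub_nhdsWithin L p)
  tendsto_outcome w := by
    obtain ⟨L, -, hL⟩ := hF.weak_continuity
    refine squeeze_zero' (.of_forall fun p => integral_nonneg fun b => sq_nonneg _)
      (eventually_mem_nhdsWithin.mono fun p hp => (hL w p hp _ (hF.clears w).1).2)
      (tendsto_const_mul_norm_sub_nhdsWithin L _)
  exists_hasFDerivAt_excess := hF.exists_hasFDerivAt_excess
  differentiableAt_meanOutcome := hF.differentiableAt_meanOutcome
  clears := hF.clears
  eq_of_clears := hF.unique_equilibrium

end Assumptions

end CutoffMechanism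

/-! ## Submodels through a population -/

theorem eventually_abs_mul_le_one {Ω : Type*} [MeasurableSpace Ω] {f : Ω → ℝ}
    (hf : IsBoundedMeasurable f) : ∀ᶠ t in 𝓝 (0 : ℝ), ∀ z, |t * f z| ≤ 1 := by
  obtain ⟨K, hK⟩ := hf.exists_abs_le
  have hlim : Tendsto (fun t : ℝ => |t| * K) (𝓝 0) (𝓝 0) := by
    simpa using (continuous_abs.mul_const K).tendsto (0 : ℝ)
  filter_upwards [hlim.eventually (ge_mem_nhds one_pos)] with t ht z
  rw [abs_mul]
  exact (mul_le_mul_of_nonneg_left (hK z) (abs_nonneg t)).trans ht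

theorem lintegral_ofReal_one_add_mul {Ω : Type*} [MeasurableSpace Ω] {μ : Measure Ω}
    [IsProbabilityMeasure μ] {f : Ω → ℝ} (hf : Integrable f μ) (h0 : ∫ z, f z ∂μ = 0) {t : ℝ}
    (ht : ∀ z, |t * f z| ≤ 1) : ∫⁻ z, ENNReal.ofReal (1 + t * f z) ∂μ = 1 := by
  have hint : Integrable (fun z => 1 + t * f z) μ := (integrable_const 1).add (hf.const_mul t)
  rw [← ofReal_integral_eq_lintegral_ofReal hint
      (.of_forall fun z => neg_le_iff_add_nonneg'.1 (abs_le.1 (ht z)).1),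
    integral_add (integrable_const 1) (hf.const_mul t), integral_const_mul, h0]
  simp

theorem ofReal_one_add_le_two {y : ℝ} (hy : |y| ≤ 1) : ENNReal.ofReal (1 + y) ≤ 2 := by
  refine ENNReal.ofReal_le_of_le_toReal ?_
  rw [ENNReal.toReal_ofNat]
  linarith [le_of_abs_le hy]

namespace Population

open Semiparametric

variable {𝓑 𝓧 : Type*} [MeasurableSpace 𝓑] [MeasurableSpace 𝓧]

/-- A bounded direction in which to tilt the laws of the covariates and of the submissions:
`cov` is the score of `X`, and `bid` that of `B` given `(W, X)`. -/
structure Tilt (F : Population 𝓑 𝓧) where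
  cov : 𝓧 → ℝ
  bid : 𝓑 × Bool × 𝓧 → ℝ
  isBoundedMeasurable_cov : IsBoundedMeasurable cov
  isBoundedMeasurable_bid : IsBoundedMeasurable bid
  integral_cov : ∫ x, cov x ∂F.cov = 0
  integral_bid : ∀ w x, ∫ b, bid (b w, w, x) ∂(F.bid x) = 0

namespace Tilt

variable {F : Population 𝓑 𝓧} (T : F.Tilt) {t : ℝ}

/-- The step `t` is so small that the tilted densities are nonnegative. -/
def IsAdmissible (t : ℝ) : Prop := (∀ x, |t * T.cov x| ≤ 1) ∧ ∀ z, |t * T.bid z| ≤ 1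

theorem eventually_isAdmissible : ∀ᶠ t in 𝓝 (0 : ℝ), T.IsAdmissible t :=
  (eventually_abs_mul_le_one T.isBoundedMeasurable_cov).and
    (eventually_abs_mul_le_one T.isBoundedMeasurable_bid)

theorem measurable_covDensity (t : ℝ) :
    Measurable fun x => ENNReal.ofReal (1 + t * T.cov x) :=
  ((T.isBoundedMeasurable_cov.measurable.const_mul t).const_add 1).ennreal_ofReal

theorem measurable_bidDensity (t : ℝ) :
    Measurable fun z => ENNReal.ofReal (1 + t * T.bid z) :=
  ((T.isBoundedMeasurable_bid.measurable.const_mul t).const_add 1).ennreal_ofReal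

theorem measurable_armDensity (t : ℝ) (w : Bool) :
    Measurable (Function.uncurry fun (x : 𝓧) (b : Bool → 𝓑) =>
      ENNReal.ofReal (1 + t * T.bid (b w, w, x))) :=
  (T.measurable_bidDensity t).comp (f := fun q : 𝓧 × (Bool → 𝓑) => (q.2 w, w, q.1)) (by fun_prop)

/-- The conditional law of the potential submissions, tilted in the direction of `B(w)`. -/
noncomputable def armKernel (t : ℝ) (w : Bool) : Kernel 𝓧 (Bool → 𝓑) :=
  Kernel.withDensity F.bid fun x b => ENNReal.ofReal (1 + t * T.bid (b w, w, x))

variable {T} in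
theorem IsAdmissible.isMarkovKernel_armKernel (ht : T.IsAdmissible t) (w : Bool) :
    IsMarkovKernel (T.armKernel t w) where
  isProbabilityMeasure x := by
    refine ⟨?_⟩
    rw [armKernel, Kernel.withDensity_apply' _ (T.measurable_armDensity t w), setLIntegral_univ]
    exact lintegral_ofReal_one_add_mul ((T.isBoundedMeasurable_bid.comp
      (φ := fun b : Bool → 𝓑 => (b w, w, x)) (by fun_prop)).integrable _)
      (T.integral_bid w x) fun b => ht.2 _

/-- The submission `B(1)` of one draw together with the submission `B(0)` of another. -/
def join (q : (Bool → 𝓑) × (Bool → 𝓑)) (w : Bool) : 𝓑 := if w then q.1 w else q.2 w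

theorem measurable_join : Measurable (join (𝓑 := 𝓑)) := by
  refine measurable_pi_iff.2 fun w => ?_
  cases w
  exacts [(measurable_pi_apply false).comp measurable_snd,
    (measurable_pi_apply true).comp measurable_fst]

/-- The population tilted by `t`. The data do not reveal the dependence between the potential
submissions; they are taken to be independent given the covariates, which normalizes the density
of each arm separately. -/
noncomputable def population (t : ℝ) (ht : T.IsAdmissible t) : Population 𝓑 𝓧 where
  cov := F.cov.withDensity fun x => ENNReal.ofReal (1 + t * T.cov x)
  bid := (T.armKernel t true ×ₖ T.armKernel t false).map join
  prop := F.prop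
  isProbabilityMeasure_cov := by
    refine ⟨?_⟩
    rw [withDensity_apply _ .univ, setLIntegral_univ]
    exact lintegral_ofReal_one_add_mul (T.isBoundedMeasurable_cov.integrable _) T.integral_cov ht.1
  isMarkovKernel_bid := by
    have := ht.isMarkovKernel_armKernel
    exact Kernel.IsMarkovKernel.map _ measurable_join
  measurable_prop := F.measurable_prop
  prop_pos := F.prop_pos
  prop_lt_one := F.prop_lt_one

theorem lintegral_population_cov (ht : T.IsAdmissible t) (f : 𝓧 → ENNReal) :
    ∫⁻ x, f x ∂(T.population t ht).cov =
      ∫⁻ x, ENNReal.ofReal (1 + t * T.cov x) * f x ∂F.cov :=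
  lintegral_withDensity_eq_lintegral_mul_non_measurable _ (T.measurable_covDensity t)
    (.of_forall fun _ => ENNReal.ofReal_lt_top) f

theorem lintegral_population_bid (ht : T.IsAdmissible t) (w : Bool) {f : 𝓑 → ENNReal}
    (hf : Measurable f) (x : 𝓧) :
    ∫⁻ b, f (b w) ∂((T.population t ht).bid x) =
      ∫⁻ b, ENNReal.ofReal (1 + t * T.bid (b w, w, x)) * f (b w) ∂(F.bid x) := by
  have := ht.isMarkovKernel_armKernel
  have hfw (w : Bool) : Measurable fun b : Bool → 𝓑 => f (b w) := hf.comp (measurable_pi_apply w)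
  change ∫⁻ b, f (b w) ∂(((T.armKernel t true) ×ₖ (T.armKernel t false)).map join x) = _
  rw [← Kernel.lintegral_withDensity F.bid (T.measurable_armDensity t w) x (hfw w),
    Kernel.map_apply _ measurable_join, lintegral_map (hfw w) measurable_join, Kernel.prod_apply]
  cases w
  · simp only [join, Bool.false_eq_true, if_false]
    rw [lintegral_prod (fun q : (Bool → 𝓑) × (Bool → 𝓑) => f (q.2 false))
      ((hfw false).comp measurable_snd).aemeasurable]
    simp only [lintegral_const, measure_univ, mul_one]
    rfl
  · simp only [join, if_true]
    rw [lintegral_prod (fun q : (Bool → 𝓑) × (Bool → 𝓑) => f (q.1 true))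
      ((hfw true).comp measurable_fst).aemeasurable]
    simp only [lintegral_const, measure_univ, mul_one]
    rfl

theorem potLaw_population_le (ht : T.IsAdmissible t) (w : Bool) :
    (T.population t ht).potLaw w ≤ (4 : NNReal) • F.potLaw w := by
  refine Measure.le_iff.2 fun s hs => ?_
  set f : 𝓑 → ENNReal := s.indicator 1
  have hf : Measurable f := measurable_one.indicator hs
  rw [Measure.smul_apply, ← lintegral_indicator_one hs, ← lintegral_indicator_one hs]
  calc ∫⁻ b, f b ∂(T.population t ht).potLaw w
      = ∫⁻ x, ENNReal.ofReal (1 + t * T.cov x) *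
          ∫⁻ b, ENNReal.ofReal (1 + t * T.bid (b w, w, x)) * f (b w) ∂(F.bid x) ∂F.cov := by
        simp_rw [lintegral_potLaw hf, lintegral_population_cov, T.lintegral_population_bid ht w hf]
    _ ≤ ∫⁻ x, 2 * ∫⁻ b, 2 * f (b w) ∂(F.bid x) ∂F.cov := by
        gcongr
        exacts [ofReal_one_add_le_two (ht.1 _), ofReal_one_add_le_two (ht.2 _)]
    _ = (4 : NNReal) • ∫⁻ b, f b ∂F.potLaw w := by
        rw [lintegral_potLaw hf, ENNReal.smul_def, smul_eq_mul]
        simp_rw [lintegral_const_mul' 2 _ ENNReal.ofNat_ne_top, ← mul_assoc]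
        norm_num

/-- The score of the tilt as a function of the observation `(B, W, X)`. -/
def score (z : 𝓑 × Bool × 𝓧) : ℝ := T.cov z.2.2 + T.bid z

theorem isBoundedMeasurable_score : IsBoundedMeasurable T.score :=
  (T.isBoundedMeasurable_cov.comp measurable_snd.snd).add T.isBoundedMeasurable_bid

theorem obsLaw_population (ht : T.IsAdmissible t) :
    (T.population t ht).obsLaw = F.obsLaw.withDensity fun z =>
      ENNReal.ofReal (1 + t * T.cov z.2.2) * ENNReal.ofReal (1 + t * T.bid z) := by
  have hdens : Measurable fun z : 𝓑 × Bool × 𝓧 =>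
      ENNReal.ofReal (1 + t * T.cov z.2.2) * ENNReal.ofReal (1 + t * T.bid z) :=
    ((T.measurable_covDensity t).comp measurable_snd.snd).mul (T.measurable_bidDensity t)
  refine Measure.ext_of_lintegral _ fun f hf => ?_
  rw [lintegral_withDensity_eq_lintegral_mul _ hdens hf, lintegral_obsLaw hf,
    lintegral_obsLaw (hdens.mul hf), T.lintegral_population_cov ht]
  refine lintegral_congr fun x => ?_
  have hfx (w : Bool) : Measurable fun b => f (b, w, x) := hf.comp (by fun_prop)
  have hprob (w : Bool) : (T.population t ht).armProb w x = F.armProb w x := rfl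
  simp only [Pi.mul_apply, Finset.mul_sum, mul_assoc, hprob,
    T.lintegral_population_bid ht _ (hfx _) x, lintegral_const_mul' _ _ ENNReal.ofReal_ne_top]
  exact Finset.sum_congr rfl fun w _ => mul_left_comm _ _ _

open Classical in
/-- The path of populations along a tilt; it stays at `F` for steps that are not admissible. -/
noncomputable def path (t : ℝ) : Population 𝓑 𝓧 :=
  if h : t ≠ 0 ∧ T.IsAdmissible t then T.population t h.2 else F

theorem path_zero : T.path 0 = F := dif_neg fun h => h.1 rfl

variable {T} in
theorem IsAdmissible.path_eq (ht : T.IsAdmissible t) (h0 : t ≠ 0) : T.path t = T.population t ht :=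
  dif_pos ⟨h0, ht⟩

theorem isRegularSubmodel {𝓜 : Set (Population 𝓑 𝓧)} (hmem : ∀ᶠ t in 𝓝 (0 : ℝ), T.path t ∈ 𝓜) :
    IsRegularSubmodel obsLaw 𝓜 F T.path T.score := by
  refine .of_density (r := fun z => T.cov z.2.2 * T.bid z) T.path_zero hmem
    T.isBoundedMeasurable_score ((T.isBoundedMeasurable_cov.comp measurable_snd.snd).mul
      T.isBoundedMeasurable_bid) ?_
  filter_upwards [T.eventually_isAdmissible] with t ht
  rcases eq_or_ne t 0 with rfl | h0
  · simp [T.path_zero]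
  · rw [ht.path_eq h0, T.obsLaw_population ht]
    congr with z
    rw [← ENNReal.ofReal_mul (neg_le_iff_add_nonneg'.1 (abs_le.1 (ht.1 _)).1), score]
    ring_nf

end Tilt

variable (F : Population 𝓑 𝓧)

/-- The population with treatment probabilities `e + t e (1 - e)`, whose score is
`propensityScore F`. -/
def propensityTilt (t : ℝ) (ht : |t| < 1) : Population 𝓑 𝓧 where
  cov := F.cov
  bid := F.bid
  prop x := F.prop x * (1 + t * (1 - F.prop x))
  isProbabilityMeasure_cov := inferInstance
  isMarkovKernel_bid := inferInstance
  measurable_prop := F.measurable_prop.mul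
    (measurable_const.add ((measurable_const.sub F.measurable_prop).const_mul t))
  prop_pos x := mul_pos (F.prop_pos x) (by nlinarith [F.prop_pos x, F.prop_lt_one x, abs_lt.1 ht])
  prop_lt_one x := by
    have hfactor : 0 < (1 - F.prop x) * (1 - t * F.prop x) :=
      mul_pos (by linarith [F.prop_lt_one x])
        (by nlinarith [F.prop_pos x, F.prop_lt_one x, abs_lt.1 ht])
    linarith

/-- The score `W - e(X)` of a change in the log odds of treatment that is the same for all
covariates. -/
def propensityScore (z : 𝓑 × Bool × 𝓧) : ℝ :=
  (if z.2.1 = true then 1 else 0) - F.prop z.2.2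

theorem abs_propensityScore_mem_Ioo (z : 𝓑 × Bool × 𝓧) :
    |F.propensityScore z| ∈ Set.Ioo (0 : ℝ) 1 := by
  have hpos := F.prop_pos z.2.2
  have hlt := F.prop_lt_one z.2.2
  unfold propensityScore
  split_ifs
  · rw [abs_of_pos (by linarith)]
    constructor <;> linarith
  · rw [abs_of_neg (by linarith)]
    constructor <;> linarith

theorem isBoundedMeasurable_propensityScore : IsBoundedMeasurable F.propensityScore :=
  .of_abs_le ((Measurable.ite (measurableSet_eq_fun measurable_snd.fst measurable_const)
    measurable_const measurable_const).sub (F.measurable_prop.comp measurable_snd.snd))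
    fun z => (F.abs_propensityScore_mem_Ioo z).2.le

theorem integral_sq_propensityScore_pos : 0 < ∫ z, F.propensityScore z ^ 2 ∂F.obsLaw := by
  rw [integral_pos_iff_support_of_nonneg (fun z => sq_nonneg _)
    (F.isBoundedMeasurable_propensityScore.sq.integrable _)]
  have hsupport : (Function.support fun z => F.propensityScore z ^ 2) = Set.univ :=
    Set.eq_univ_of_forall fun z => pow_ne_zero 2 (abs_pos.1 (F.abs_propensityScore_mem_Ioo z).1)
  simp [hsupport]

theorem armProb_propensityTilt {t : ℝ} (ht : |t| < 1) (w : Bool) (x : 𝓧) (b : 𝓑) :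
    (F.propensityTilt t ht).armProb w x =
      F.armProb w x * (1 + t * F.propensityScore (b, w, x)) := by
  cases w
  · simp only [armProb, propensityTilt, propensityScore, Bool.false_eq_true, if_false]
    ring
  · simp [armProb, propensityTilt, propensityScore]

theorem obsLaw_propensityTilt {t : ℝ} (ht : |t| < 1) :
    (F.propensityTilt t ht).obsLaw = F.obsLaw.withDensity fun z =>
      ENNReal.ofReal (1 + t * F.propensityScore z) := by
  have hdens : Measurable fun z => ENNReal.ofReal (1 + t * F.propensityScore z) :=
    ((F.isBoundedMeasurable_propensityScore.measurable.const_mul t).const_add 1).ennreal_ofReal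
  refine Measure.ext_of_lintegral _ fun f hf => ?_
  rw [lintegral_withDensity_eq_lintegral_mul _ hdens hf, lintegral_obsLaw hf,
    lintegral_obsLaw (hdens.mul hf)]
  refine lintegral_congr fun x => Finset.sum_congr rfl fun w _ => ?_
  rw [← lintegral_const_mul' _ _ ENNReal.ofReal_ne_top,
    ← lintegral_const_mul' _ _ ENNReal.ofReal_ne_top]
  refine lintegral_congr fun b => ?_
  rw [F.armProb_propensityTilt ht w x (b w), ENNReal.ofReal_mul (F.armProb_pos w x).le, mul_assoc]
  rfl

open Classical in
/-- The path of populations along which only the treatment probabilities vary; it stays at `F`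
for steps that are too large. -/
noncomputable def propensityPath (t : ℝ) : Population 𝓑 𝓧 :=
  if h : t ≠ 0 ∧ |t| < 1 then F.propensityTilt t h.2 else F

theorem propensityPath_zero : F.propensityPath 0 = F := dif_neg fun h => h.1 rfl

theorem potLaw_propensityPath (t : ℝ) : (F.propensityPath t).potLaw = F.potLaw := by
  unfold propensityPath
  split_ifs <;> rfl

theorem isRegularSubmodel_propensityPath {𝓜 : Set (Population 𝓑 𝓧)}
    (hmem : ∀ t, F.propensityPath t ∈ 𝓜) :
    IsRegularSubmodel obsLaw 𝓜 F F.propensityPath F.propensityScore := by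
  refine .of_density (r := fun _ => 0) F.propensityPath_zero (.of_forall hmem)
    F.isBoundedMeasurable_propensityScore (.const 0) ?_
  have hsmall : ∀ᶠ t in 𝓝 (0 : ℝ), |t| < 1 :=
    continuous_abs.continuousAt.eventually (gt_mem_nhds (by simp))
  filter_upwards [hsmall] with t ht
  simp only [mul_zero, add_zero]
  rcases eq_or_ne t 0 with rfl | h0
  · simp [propensityPath_zero]
  · rw [propensityPath, dif_pos ⟨h0, ht⟩, F.obsLaw_propensityTilt ht]

end Population

/-! ## The influence function of the global treatment effect -/

namespace CutoffMechanism

open Population Semiparametric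

variable {𝓑 𝓧 : Type*} [MeasurableSpace 𝓑] [MeasurableSpace 𝓧] {J : ℕ}

/-- The difference of the centred doubly robust scores of the mean net outcomes, at prices `ν_w`,
with the treatment probabilities truncated at `κ`. This is `Γ^q_1 - Γ^q_0 - τ` as a function of
the observation `(B, W, X)`. -/
noncomputable def influence (M : CutoffMechanism 𝓑 J) (F : Population 𝓑 𝓧)
    (p : Bool → EuclideanSpace ℝ (Fin J)) (κ : ℝ) (z : 𝓑 × Bool × 𝓧) : ℝ :=
  F.doublyRobust κ true (M.netOutcome (M.nu F true (p true)) (p true)) z -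
    F.doublyRobust κ false (M.netOutcome (M.nu F false (p false)) (p false)) z -
    M.globalEffect F p

variable {M : CutoffMechanism 𝓑 J} {F F₀ : Population 𝓑 𝓧}
  {p pstar : Bool → EuclideanSpace ℝ (Fin J)} {κ : ℝ}

theorem IsBounded.isBoundedMeasurable_influence (hM : M.IsBounded) (hp : ∀ w, p w ∈ M.cutoffs)
    (hκ : 0 < κ) : IsBoundedMeasurable (M.influence F p κ) :=
  ((isBoundedMeasurable_doublyRobust hκ (hM.isBoundedMeasurable_netOutcome (hp true))).sub
    (isBoundedMeasurable_doublyRobust hκ (hM.isBoundedMeasurable_netOutcome (hp false)))).sub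
      (.const _)

theorem IsBounded.condMean_netOutcome (hM : M.IsBounded) {w : Bool} {q : EuclideanSpace ℝ (Fin J)}
    (hq : q ∈ M.cutoffs) (ℓ : EuclideanSpace ℝ (Fin J) →L[ℝ] ℝ) (x : 𝓧) :
    F.condMean w (M.netOutcome ℓ q) x =
      M.condOutcome F w x q - ℓ (M.condAlloc F w x q - M.capacity) := by
  obtain ⟨K, hK⟩ := hM.exists_norm_alloc_le
  have halloc : Integrable (fun b : Bool → 𝓑 => M.alloc (b w) q) (F.bid x) :=
    .of_bound ((M.measurable_alloc q).comp (measurable_pi_apply w)).aestronglyMeasurable K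
      (.of_forall fun b => hK (b w) q hq)
  have hexcess : Integrable (fun b : Bool → 𝓑 => M.alloc (b w) q - M.capacity) (F.bid x) :=
    halloc.sub (integrable_const _)
  simp only [condMean, netOutcome]
  rw [integral_sub (integrable_bid (hM.isBoundedMeasurable_outcome hq) x)
      (ℓ.integrable_comp hexcess), ℓ.integral_comp_comm hexcess,
    integral_sub halloc (integrable_const _), integral_const, probReal_univ, one_smul]
  rfl

theorem IsBounded.scoreQ_eq_doublyRobust (hM : M.IsBounded) {w : Bool}
    {q : EuclideanSpace ℝ (Fin J)} (hq : q ∈ M.cutoffs) {ω : 𝓧 × (Bool → 𝓑) × Bool}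
    (hκ : F.clippedProb κ w ω.1 = F.armProb w ω.1) :
    M.scoreQ F w q ω = F.doublyRobust κ w (M.netOutcome (M.nu F w q) q) (observe ω) := by
  simp only [scoreQ, scoreOutcome, scoreAlloc, ipw, doublyRobust, ipwResidual, observe,
    hM.condMean_netOutcome hq, hκ]
  split_ifs with hw
  · rw [hw]
    simp only [netOutcome, map_sub, map_add, map_smul, smul_eq_mul]
    ring
  · simp only [zero_mul, zero_smul, add_zero]

theorem IsBounded.asymptoticVariance_eq (hM : M.IsBounded) (hp : ∀ w, p w ∈ M.cutoffs)
    (hκ : 0 < κ) (hov : F.StrongOverlap κ) :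
    M.asymptoticVariance F p = ∫ z, M.influence F p κ z ^ 2 ∂F.obsLaw := by
  rw [obsLaw, integral_map measurable_observe.aemeasurable
    (hM.isBoundedMeasurable_influence hp hκ).sq.measurable.aestronglyMeasurable]
  have hfst : F.fullLaw.map Prod.fst = F.cov := Measure.fst_compProd F.cov _
  have hclipped (w : Bool) : ∀ᵐ ω ∂F.fullLaw, F.clippedProb κ w ω.1 = F.armProb w ω.1 :=
    ae_of_ae_map measurable_fst.aemeasurable (hfst ▸ hov.clippedProb_ae_eq w)
  refine integral_congr_ae ?_
  filter_upwards [hclipped true, hclipped false] with ω htrue hfalse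
  simp only [influence, hM.scoreQ_eq_doublyRobust (hp _) htrue,
    hM.scoreQ_eq_doublyRobust (hp _) hfalse]

namespace IsRegularEquilibrium

theorem hasDerivAt_globalEffect (h : M.IsRegularEquilibrium F₀ pstar)
    {cut : Population 𝓑 𝓧 → Bool → EuclideanSpace ℝ (Fin J)} (hcut : M.IsCutoffRule cut)
    {path : ℝ → Population 𝓑 𝓧} {s : 𝓑 × Bool × 𝓧 → ℝ}
    (hreg : IsRegularSubmodel obsLaw (M.model 𝓧) F₀ path s) (hκ : 0 < κ)
    (hov : F₀.StrongOverlap κ) :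
    HasDerivAt (fun t => M.globalEffect (path t) (cut (path t)))
      (∫ z, M.influence F₀ pstar κ z * s z ∂F₀.obsLaw) 0 := by
  have hscore (w : Bool) : Integrable (fun z => F₀.doublyRobust κ w
      (M.netOutcome (M.nu F₀ w (pstar w)) (pstar w)) z * s z) F₀.obsLaw :=
    ((isBoundedMeasurable_doublyRobust hκ (h.isBounded.isBoundedMeasurable_netOutcome
      (h.clears w).1)).memLp 2 _).integrable_mul hreg.memLp
  refine ((h.hasDerivAt_meanOutcome hcut hreg hκ hov true).sub
    (h.hasDerivAt_meanOutcome hcut hreg hκ hov false)).congr_deriv ?_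
  have hsplit := integral_sub ((hscore true).sub (hscore false))
    ((hreg.memLp.integrable one_le_two).const_mul (M.globalEffect F₀ pstar))
  rw [integral_const_mul, hreg.integral_score fun t => inferInstance, mul_zero, sub_zero] at hsplit
  rw [← integral_sub (hscore true) (hscore false)]
  simp only [influence, sub_mul]
  exact hsplit.symm

/-- The influence function splits into its conditional mean given `X` and the remainder. -/
theorem exists_tilt_score_eq_influence (h : M.IsRegularEquilibrium F₀ pstar) (hκ : 0 < κ) :
    ∃ T : F₀.Tilt, T.score = M.influence F₀ pstar κ := by
  let q (w : Bool) : 𝓑 → ℝ := M.netOutcome (M.nu F₀ w (pstar w)) (pstar w)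
  have hq (w : Bool) : IsBoundedMeasurable (q w) :=
    h.isBounded.isBoundedMeasurable_netOutcome (h.clears w).1
  have hmean (w : Bool) : IsBoundedMeasurable (F₀.condMean w (q w)) :=
    isBoundedMeasurable_condMean (hq w)
  have hresidual (w : Bool) : IsBoundedMeasurable (F₀.ipwResidual κ w (q w)) :=
    isBoundedMeasurable_ipwResidual hκ (hq w)
  have hintegral (w : Bool) :
      ∫ x, F₀.condMean w (q w) x ∂F₀.cov = M.meanOutcome F₀ w (pstar w) := by
    rw [integral_condMean (hq w), h.isBounded.integral_netOutcome (h.clears w).1, (h.clears w).2,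
      map_zero, sub_zero]
  refine ⟨{
    cov := fun x => F₀.condMean true (q true) x - F₀.condMean false (q false) x -
      M.globalEffect F₀ pstar
    bid := fun z => F₀.ipwResidual κ true (q true) z - F₀.ipwResidual κ false (q false) z
    isBoundedMeasurable_cov := ((hmean true).sub (hmean false)).sub (.const _)
    isBoundedMeasurable_bid := (hresidual true).sub (hresidual false)
    integral_cov := ?_
    integral_bid := fun w x => ?_ }, ?_⟩
  · rw [integral_sub (((hmean true).sub (hmean false)).integrable _) (integrable_const _),
      integral_sub ((hmean true).integrable _) ((hmean false).integrable _), hintegral, hintegral]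
    simp [globalEffect]
  · have hint (v : Bool) :
        Integrable (fun b : Bool → 𝓑 => F₀.ipwResidual κ v (q v) (b w, w, x)) (F₀.bid x) :=
      ((hresidual v).comp (φ := fun b : Bool → 𝓑 => (b w, w, x)) (by fun_prop)).integrable _
    rw [integral_sub (hint true) (hint false), integral_bid_ipwResidual (hq _),
      integral_bid_ipwResidual (hq _), sub_self]
  · funext z
    simp only [Tilt.score, influence, doublyRobust, q]
    ring

/-- If `A` is the derivative of excess demand at `pstar`, then `A⁻¹ ∘ z_w` is within `R` of
`p ↦ p - pstar` on a ball of radius `R`, for excess demand `z_w` close to the true one. -/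
theorem exists_clears_of_norm_excess_sub_le (h : M.IsRegularEquilibrium F₀ pstar) (w : Bool) :
    ∃ η : ℝ, 0 < η ∧ ∀ F : Population 𝓑 𝓧, ContinuousOn (M.excess F w) M.cutoffs →
      (∀ p ∈ M.cutoffs, ‖M.excess F w p - M.excess F₀ w p‖ ≤ η) → ∃ p, M.Clears F w p := by
  obtain ⟨A, hA⟩ := h.exists_hasFDerivAt_excess w
  set N : ℝ := ‖(A.symm : EuclideanSpace ℝ (Fin J) →L[ℝ] EuclideanSpace ℝ (Fin J))‖
  have hN : 0 ≤ N := norm_nonneg _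
  set ε : ℝ := 1 / (2 * (N + 1))
  have hε : 0 < ε := by positivity
  have hNε : N * (2 * ε) ≤ 1 := by
    simp only [ε]
    field_simp
    linarith
  obtain ⟨R, hR, hball⟩ := Metric.nhds_basis_closedBall.eventually_iff.1
    ((hA.isLittleO.def hε).and (h.cutoffs_mem_nhds w))
  have hsub : Metric.closedBall (pstar w) R ⊆ M.cutoffs := fun p hp => (hball hp).2
  refine ⟨ε * R, by positivity, fun F hcont hclose => ?_⟩
  have hnear (p) (hp : p ∈ Metric.closedBall (pstar w) R) :
      ‖A.symm (M.excess F w p) - (p - pstar w)‖ ≤ R := by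
    have hlinear : ‖M.excess F₀ w p - A (p - pstar w)‖ ≤ ε * R := by
      have hdiff := (hball hp).1
      rw [(h.clears w).2, sub_zero] at hdiff
      exact hdiff.trans (mul_le_mul_of_nonneg_left (mem_closedBall_iff_norm.1 hp) hε.le)
    calc ‖A.symm (M.excess F w p) - (p - pstar w)‖
        = ‖A.symm (M.excess F w p - A (p - pstar w))‖ := by rw [map_sub, A.symm_apply_apply]
      _ ≤ N * ‖M.excess F w p - A (p - pstar w)‖ :=
          (A.symm : EuclideanSpace ℝ (Fin J) →L[ℝ] EuclideanSpace ℝ (Fin J)).le_opNorm _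
      _ ≤ N * (ε * R + ε * R) := by
          gcongr
          exact (norm_sub_le_norm_sub_add_norm_sub _ _ _).trans
            (add_le_add (hclose p (hsub hp)) hlinear)
      _ = N * (2 * ε) * R := by ring
      _ ≤ R := mul_le_of_le_one_left hR.le hNε
  obtain ⟨p, hp, hzero⟩ := Brouwer.exists_zero_of_norm_sub_le
    (Φ := fun p => A.symm (M.excess F w p)) hR
    (A.symm.continuous.comp_continuousOn (hcont.mono hsub)) hnear
  exact ⟨p, hsub hp, by simpa using hzero⟩

theorem eventually_tilt_mem_model (h : M.IsRegularEquilibrium F₀ pstar) (T : F₀.Tilt) :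
    ∀ᶠ t in 𝓝 (0 : ℝ), T.path t ∈ M.model 𝓧 := by
  obtain ⟨C, hC⟩ := h.exists_norm_excess_sub_le
    (T.isRegularSubmodel (𝓜 := Set.univ) (.of_forall fun _ => Set.mem_univ _))
  choose η hη hclears using h.exists_clears_of_norm_excess_sub_le
  have hsmall : ∀ᶠ t in 𝓝 (0 : ℝ), ∀ w, C * |t| ≤ η w := by
    have hlim : Tendsto (fun t : ℝ => C * |t|) (𝓝 0) (𝓝 0) := by
      simpa using (continuous_abs.const_mul C).tendsto (0 : ℝ)
    exact eventually_all.2 fun w => hlim.eventually (ge_mem_nhds (hη w))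
  rw [eventually_nhdsWithin_iff] at hC
  filter_upwards [hC, hsmall, T.eventually_isAdmissible] with t hclose ht hadm w
  rcases eq_or_ne t 0 with rfl | h0
  · exact ⟨_, T.path_zero ▸ h.clears w⟩
  · refine hclears w _ ?_ fun p hp => (hclose h0 w p hp).trans (ht w)
    rw [hadm.path_eq h0]
    exact h.continuousOn_excess (T.potLaw_population_le hadm w)

theorem propensityPath_mem_model (h : M.IsRegularEquilibrium F₀ pstar) (t : ℝ) :
    F₀.propensityPath t ∈ M.model 𝓧 := by
  refine fun w => ⟨pstar w, (h.clears w).1, ?_⟩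
  rw [excess, potLaw_propensityPath]
  exact (h.clears w).2

end IsRegularEquilibrium

end CutoffMechanism

theorem mainTheorem4_general {𝓑 𝓧 : Type*} [MeasurableSpace 𝓑] [MeasurableSpace 𝓧] {J : ℕ}
    (M : CutoffMechanism 𝓑 J) (F₀ : Population 𝓑 𝓧)
    (pstar : Bool → EuclideanSpace ℝ (Fin J)) (hF₀ : M.IsRegularEquilibrium F₀ pstar)
    (cut : Population 𝓑 𝓧 → Bool → EuclideanSpace ℝ (Fin J)) (hcut : M.IsCutoffRule cut) :
    Semiparametric.IsEfficiencyBound Population.obsLaw (M.model 𝓧)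
      (fun F => M.globalEffect F (cut F)) F₀ (M.asymptoticVariance F₀ pstar) := by
  obtain ⟨κ, hκ, hov⟩ := hF₀.exists_strongOverlap
  obtain ⟨T, hT⟩ := hF₀.exists_tilt_score_eq_influence hκ
  have hinfluence := T.isRegularSubmodel (hF₀.eventually_tilt_mem_model T)
  have hinformation := F₀.isRegularSubmodel_propensityPath hF₀.propensityPath_mem_model
  rw [hF₀.isBounded.asymptoticVariance_eq (fun w => (hF₀.clears w).1) hκ hov]
  exact (hT ▸ hinfluence).isEfficiencyBound
    (fun path s hreg => hF₀.hasDerivAt_globalEffect hcut hreg hκ hov)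
    ⟨_, _, hinformation, F₀.integral_sq_propensityScore_pos⟩

theorem mainTheorem4 {𝓑 𝓧 : Type*} [MeasurableSpace 𝓑] [MeasurableSpace 𝓧] {J : ℕ}
    (M : CutoffMechanism 𝓑 J) (F₀ : Population 𝓑 𝓧)
    (pstar : Bool → EuclideanSpace ℝ (Fin J)) (hF₀ : M.Assumptions F₀ pstar)
    (cut : Population 𝓑 𝓧 → Bool → EuclideanSpace ℝ (Fin J)) (hcut : M.IsCutoffRule cut) :
    Semiparametric.IsEfficiencyBound Population.obsLaw (M.model 𝓧)
      (fun F => M.globalEffect F (cut F)) F₀ (M.asymptoticVariance F₀ pstar) :=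
  mainTheorem4_general M F₀ pstar hF₀.isRegularEquilibrium cut hcut
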